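/- Let $m\in\{2,3\}$ and $k>0$. Let $\Omega_0,\Omega_1,\Omega_2\subset\mathbb R^m$ be bounded open sets with $\overline{\Omega}_0\subset\Omega_1\subset\overline{\Omega}_1\subset\Omega_2$ such that $\Gamma=\partial\Omega_1$ is smooth, $\Sigma=\partial\Omega_2$ is Lipschitz (for example polygonal or polyhedral), and $\Omega_1^{\rm c}:=\mathbb R^m\setminus\overline{\Omega}_1$ is connected; put $\Omega_{12}:=\Omega_1^{\rm c}\cap\Omega_2$. Let $n:\mathbb R^m\to\mathbb R$ be bounded and measurable (for example piecewise smooth) with $n=1$ on $\mathbb R^m\setminus\overline{\Omega}_0$. Let $u^{\rm inc}$ be an incident wave, i.e. a solution of $\Delta u^{\rm inc}+k^2u^{\rm inc}=0$ in all of $\mathbb R^m$. All Helmholtz equations below are understood in the sense of distributions, and $\gamma_\Sigma,\gamma_\Gamma$ are the trace operators. A function $v$ is called radiating if $\partial_r v-\mathrm i k v=o(r^{-(m-1)/2})$ as $r=|x|\to\infty$, uniformly in $x/|x|$ (Sommerfeld radiation condition). For $f\in H^{1/2}(\Sigma)$ let $\mathrm K_{\Omega_2\Sigma}f=w\in H^1(\Omega_2)$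 be the solution of $\Delta w+k^2n^2w=0$ in $\Omega_2$, $\gamma_\Sigma w=f$, and let $\mathrm K_{\Gamma\Sigma}f=\gamma_\Gamma w$; assume that this interior problem is uniquely solvable for every $f\in H^{1/2}(\Sigma)$. For $f\in H^{1/2}(\Gamma)$ let $\mathrm K_{\Omega_1^{\rm c}\Gamma}f=\omega$ be the radiating solution, in $H^1(\Omega_1^{\rm c}\cap B)$ for every ball $B$, of $\Delta\omega+k^2\omega=0$ in $\Omega_1^{\rm c}$, $\gamma_\Gamma\omega=f$, and let $\mathrm K_{\Sigma\Gamma}f=\gamma_\Sigma\omega$. Assume also that the only $v\in H^1(\Omega_{12})$ with $\Delta v+k^2v=0$ in $\Omega_{12}$ and $\gamma_\Gamma v=0$, $\gamma_\Sigma v=0$ is $v=0$. Suppose that $(f_\Sigma,f_\Gamma)\in H^{1/2}(\Sigma)\times H^{1/2}(\Gamma)$ solves the interface system $$f_\Sigma-\mathrm K_{\Sigma\Gamma}f_\Gamma=\gamma_\Sigma u^{\rm inc},\qquad -\mathrm K_{\Gamma\Sigma}f_\Sigma+f_\Gamma=-\gamma_\Gamma u^{\rm inc}.$$ Then $\mathrm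 K_{\Omega_2\Sigma}f_\Sigma=\mathrm K_{\Omega_1^{\rm c}\Gamma}f_\Gamma+u^{\rm inc}$ in $\Omega_{12}$, so that $$u:=\begin{cases}\mathrm K_{\Omega_2\Sigma}f_\Sigma&\text{in }\Omega_2,\\ \mathrm K_{\Omega_1^{\rm c}\Gamma}f_\Gamma+u^{\rm inc}&\text{in }\Omega_1^{\rm c}\end{cases}$$ is well defined. Moreover $u\in H^1_{\rm loc}(\mathbb R^m)$, and $u$ is the unique (up to null sets) function in $H^1_{\rm loc}(\mathbb R^m)$ such that $\Delta u+k^2n^2u=0$ in $\mathbb R^m$ and $u-u^{\rm inc}$ is radiating. -/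

import Mathlib

open MeasureTheory Filter Topology Asymptotics

namespace OverlapHelmholtz

/-- The Euclidean space `ℝ^m`. -/
abbrev Space (m : ℕ) : Type := EuclideanSpace ℝ (Fin m)

/-- The open exterior `ℝ^m ∖ closure Ω` of a set `Ω`. -/
def exterior {m : ℕ} (Ω : Set (Space m)) : Set (Space m) := (closure Ω)ᶜ

/-- `Ω` lies locally, near each of its boundary points and in suitable orthonormal coordinates,
strictly below the graph of a function from the class `P`. Here `e` is the vertical direction
and `y - ⟪e, y⟫ e` the horizontal part of `y`; only the values of `φ` on the hyperplane orthogonal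
to `e` matter. -/
def IsLocalHypograph {m : ℕ} (P : (Space m → ℝ) → Prop) (Ω : Set (Space m)) : Prop :=
  ∀ x ∈ frontier Ω, ∃ e : Space m, ‖e‖ = 1 ∧ ∃ φ : Space m → ℝ, P φ ∧
    ∀ᶠ y in 𝓝 x, (y ∈ Ω ↔ inner ℝ e y < φ (y - (inner ℝ e y : ℝ) • e))

/-- `Ω` has a Lipschitz boundary. -/
def HasLipschitzBoundary {m : ℕ} (Ω : Set (Space m)) : Prop :=
  IsLocalHypograph (fun φ => ∃ K : NNReal, LipschitzWith K φ) Ω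

/-- `Ω` has a smooth boundary. -/
def HasSmoothBoundary {m : ℕ} (Ω : Set (Space m)) : Prop :=
  IsLocalHypograph (fun φ => ContDiff ℝ (⊤ : ℕ∞) φ) Ω

/-- The surface measure on a hypersurface `S` of `ℝ^m`: the `(m-1)`-dimensional Hausdorff
measure restricted to `S`. -/
noncomputable def surfaceMeasure {m : ℕ} (S : Set (Space m)) : Measure (Space m) :=
  (Measure.hausdorffMeasure ((m : ℝ) - 1)).restrict S

/-- The space `C_c^∞(D)` of complex-valued test functions on `D`. -/
structure IsTestFunction {m : ℕ} (D : Set (Space m)) (φ : Space m → ℂ) : Prop where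
  smooth : ContDiff ℝ (⊤ : ℕ∞) φ
  compact : HasCompactSupport φ
  support_subset : tsupport φ ⊆ D

/-- The classical partial derivative `∂_i φ`. -/
noncomputable def partialDeriv {m : ℕ} (i : Fin m) (φ : Space m → ℂ) (x : Space m) : ℂ :=
  fderiv ℝ φ x (EuclideanSpace.single i 1)

/-- `G = (G_1, …, G_m)` is the weak gradient on the open set `D` of `u`, and both belong to
`L²(D)`. -/
structure HasWeakGradient {m : ℕ} (D : Set (Space m)) (u : Space m → ℂ)
    (G : Fin m → Space m → ℂ) : Prop where
  memLp : MemLp u 2 (volume.restrict D)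
  memLp_grad : ∀ i, MemLp (G i) 2 (volume.restrict D)
  integral_eq : ∀ φ, IsTestFunction D φ → ∀ i,
    ∫ x in D, u x * partialDeriv i φ x = - ∫ x in D, G i x * φ x

/-- `u ∈ H¹(D)`. -/
def MemH1 {m : ℕ} (D : Set (Space m)) (u : Space m → ℂ) : Prop :=
  ∃ G, HasWeakGradient D u G

/-- `u ∈ H¹_loc`, up to the boundary of `D`: `u ∈ H¹(D ∩ B)` for all balls `B`. For `D = ℝ^m`
this is the space `H¹_loc(ℝ^m)`. -/
def MemH1loc {m : ℕ} (D : Set (Space m)) (u : Space m → ℂ) : Prop :=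
  ∀ R : ℝ, MemH1 (D ∩ Metric.ball 0 R) u

/-- The smooth functions `φ_j` converge to `u` in the norm of `H¹(D)`. -/
def TendstoH1 {m : ℕ} (D : Set (Space m)) (φ : ℕ → Space m → ℂ) (u : Space m → ℂ) : Prop :=
  ∃ G, HasWeakGradient D u G ∧
    Tendsto (fun j => eLpNorm (φ j - u) 2 (volume.restrict D)) atTop (𝓝 0) ∧
    ∀ i, Tendsto (fun j => eLpNorm (partialDeriv i (φ j) - G i) 2 (volume.restrict D))
      atTop (𝓝 0)

/-- `f = γ_S u`: the function `f ∈ L²(S)` is the trace on the hypersurface `S ⊆ closure D` of the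
function `u ∈ H¹_loc` on `D`. The trace operator is the continuous extension of the restriction
`φ ↦ φ|_S` of smooth functions, so that its graph is the closure of the graph of the
restriction. -/
def IsTrace {m : ℕ} (D S : Set (Space m)) (u f : Space m → ℂ) : Prop :=
  MemLp f 2 (surfaceMeasure S) ∧
  ∃ φ : ℕ → Space m → ℂ, (∀ j, ContDiff ℝ (⊤ : ℕ∞) (φ j)) ∧
    (∀ R : ℝ, TendstoH1 (D ∩ Metric.ball 0 R) φ u) ∧
    Tendsto (fun j => eLpNorm (φ j - f) 2 (surfaceMeasure S)) atTop (𝓝 0)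

/-- `f ∈ H^{1/2}(∂D)`, for a bounded Lipschitz domain `D`: the space of traces of `H¹(D)`. -/
def MemHHalf {m : ℕ} (D : Set (Space m)) (f : Space m → ℂ) : Prop :=
  ∃ u, MemH1 D u ∧ IsTrace D (frontier D) u f

/-- `Δu + k² n² u = 0` in the open set `D`, in the sense of distributions. -/
def SolvesHelmholtz {m : ℕ} (k : ℝ) (n : Space m → ℝ) (D : Set (Space m)) (u : Space m → ℂ) :
    Prop :=
  ∀ φ, IsTestFunction D φ →
    ∫ x in D, u x * (Laplacian.laplacian φ x + ((k ^ 2 * n x ^ 2 : ℝ) : ℂ) * φ x) = 0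

/-- The Sommerfeld radiation condition `∂_r u - i k u = o(r^{-(m-1)/2})` as `r = |x| → ∞`,
uniformly in the direction `x / |x|`. It refers to the representative of `u` which is continuously
differentiable outside a large ball. -/
def IsRadiating {m : ℕ} (k : ℝ) (u : Space m → ℂ) : Prop :=
  ∃ (R : ℝ) (v : Space m → ℂ), ContDiffOn ℝ 1 v {x | R < ‖x‖} ∧
    (∀ᵐ x ∂(volume.restrict {x : Space m | R < ‖x‖}), u x = v x) ∧
    (fun x => fderiv ℝ v x (‖x‖⁻¹ • x) - Complex.I * k * v x)
      =o[Bornology.cobounded (Space m)] (fun x => ‖x‖ ^ (-((m : ℝ) - 1) / 2))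

/-- An incident wave with wavenumber `k`: a classical solution of `Δu + k² u = 0` in the whole
space, for instance a plane wave. -/
structure IsIncidentWave {m : ℕ} (k : ℝ) (uinc : Space m → ℂ) : Prop where
  contDiff : ContDiff ℝ 2 uinc
  helmholtz : ∀ x, Laplacian.laplacian uinc x + ((k ^ 2 : ℝ) : ℂ) * uinc x = 0

/-- `u` is a total field of the scattering problem in the full space: `u ∈ H¹_loc(ℝ^m)`,
`Δu + k² n² u = 0` in `ℝ^m`, and `u - u^inc` is radiating. -/
structure IsTotalField {m : ℕ} (k : ℝ) (n : Space m → ℝ) (uinc u : Space m → ℂ) : Prop where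
  memH1loc : MemH1loc Set.univ u
  helmholtz : SolvesHelmholtz k n Set.univ u
  radiating : IsRadiating k (u - uinc)

/-- `w = K_{Ω₂Σ} f`: the field `w ∈ H¹(Ω₂)` solves `Δw + k² n² w = 0` in `Ω₂` and `γ_Σ w = f`,
where `Σ = ∂Ω₂`. -/
structure IsInteriorField {m : ℕ} (k : ℝ) (n : Space m → ℝ) (Ω₂ : Set (Space m))
    (f w : Space m → ℂ) : Prop where
  memH1 : MemH1 Ω₂ w
  helmholtz : SolvesHelmholtz k n Ω₂ w
  trace : IsTrace Ω₂ (frontier Ω₂) w f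

/-- `ω = K_{Ω₁ᶜΓ} f`: the field `ω ∈ H¹_loc` on `Ω₁ᶜ = ℝ^m ∖ closure Ω₁` solves `Δω + k² ω = 0`
in `Ω₁ᶜ`, is radiating, and `γ_Γ ω = f`, where `Γ = ∂Ω₁`. -/
structure IsExteriorField {m : ℕ} (k : ℝ) (Ω₁ : Set (Space m)) (f ω : Space m → ℂ) : Prop where
  memH1loc : MemH1loc (exterior Ω₁) ω
  helmholtz : SolvesHelmholtz k (fun _ => 1) (exterior Ω₁) ω
  trace : IsTrace (exterior Ω₁) (frontier Ω₁) ω f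
  radiating : IsRadiating k ω

/-- The interior problem in `Ω₂` is uniquely solvable, for all Dirichlet data in `H^{1/2}(Σ)`. -/
def InteriorUniquelySolvable {m : ℕ} (k : ℝ) (n : Space m → ℝ) (Ω₂ : Set (Space m)) : Prop :=
  ∀ f, MemHHalf Ω₂ f →
    (∃ w, IsInteriorField k n Ω₂ f w) ∧
    ∀ w w', IsInteriorField k n Ω₂ f w → IsInteriorField k n Ω₂ f w' →
      ∀ᵐ x ∂(volume.restrict Ω₂), w x = w' x

/-- The homogeneous Dirichlet problem `Δv + k² v = 0` in `Ω₁₂ = Ω₁ᶜ ∩ Ω₂`, `γ_Γ v = γ_Σ v = 0`,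
has in `H¹(Ω₁₂)` only the trivial solution. -/
def OverlapDirichletUnique {m : ℕ} (k : ℝ) (Ω₁ Ω₂ : Set (Space m)) : Prop :=
  ∀ v, MemH1 (exterior Ω₁ ∩ Ω₂) v →
    SolvesHelmholtz k (fun _ => 1) (exterior Ω₁ ∩ Ω₂) v →
    IsTrace (exterior Ω₁ ∩ Ω₂) (frontier Ω₁) v 0 →
    IsTrace (exterior Ω₁ ∩ Ω₂) (frontier Ω₂) v 0 →
    ∀ᵐ x ∂(volume.restrict (exterior Ω₁ ∩ Ω₂)), v x = 0

/-- `(fSig, fGam)` solves the interface system with the data of `uinc`, where `w = K_{Ω₂Σ} fSig` and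
`ω = K_{Ω₁ᶜΓ} fGam`. Here `gSig = γ_Σ ω = K_{ΣΓ} fGam` and `gGam = γ_Γ w = K_{ΓΣ} fSig`. -/
structure SolvesInterfaceSystem {m : ℕ} (k : ℝ) (n : Space m → ℝ) (Ω₁ Ω₂ : Set (Space m))
    (uinc fSig fGam w ω : Space m → ℂ) : Prop where
  memHHalfSig : MemHHalf Ω₂ fSig
  memHHalfGam : MemHHalf Ω₁ fGam
  interiorField : IsInteriorField k n Ω₂ fSig w
  exteriorField : IsExteriorField k Ω₁ fGam ω
  equationSig : ∃ gSig, IsTrace (exterior Ω₁) (frontier Ω₂) ω gSig ∧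
    ∀ᵐ x ∂(surfaceMeasure (frontier Ω₂)), fSig x - gSig x = uinc x
  equationGam : ∃ gGam, IsTrace Ω₂ (frontier Ω₁) w gGam ∧
    ∀ᵐ x ∂(surfaceMeasure (frontier Ω₁)), - gGam x + fGam x = - uinc x

end OverlapHelmholtz

/-!
Let `w` and `ω` be the interior and the exterior field of a solution of the interface system.

*Consistency.* On the overlap of the two domains `w - ω - uinc` solves the Helmholtz equation with
index one, and the interface equations say that its traces on both boundary components vanish;
hence it is zero by the assumption on the overlap (`SolvesInterfaceSystem.ae_eq`). The only
analytic input is that the trace of the incident wave is its restriction (`isTrace_of_contDiff`),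
which requires the surface measure of a compact boundary to be finite. The domain of `w` and that
of `ω` cover the space, and since a test function on a union of two open sets splits into test
functions on each of them (`IsTestFunction.exists_add`), weak gradients and distributional
equations glue (`isTotalField_of_overlap`).

*Uniqueness* (`IsTotalField.ae_eq`). Let `d` be the difference of two total fields: a radiating
solution in the whole space. Since `k` and `n` are real, testing the equation with `conj d` times a
radial cutoff shows that the energy flux `Im (conj d ∂ᵣd)`, averaged over a shell, is zero
(`integral_flux_eq_zero`). As `|∂ᵣd - i k d|² = |∂ᵣd|² + k² |d|² - 2 k Im (conj d ∂ᵣd)`, the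
radiation condition makes the mass of `d` in shells of thickness one tend to zero
(`tendsto_integral_shell_sq`). Rellich's lemma (`ae_eq_zero_of_helmholtz_exterior`) gives `d = 0`
far out, and unique continuation (`ae_eq_zero_of_helmholtz_preconnected`) gives `d = 0` in the
connected exterior of `Ω₁`, where the index is one. So `d` is supported in `closure Ω₁ ⊆ Ω₂`; it has
trace zero on `∂Ω₂`, and the unique solvability of the interior problem yields `d = 0`. No unique
continuation across the region of variable index is needed.

Rellich's lemma and unique continuation are both proved by duality, without regularity theory or
spherical harmonics. The equation for `d` is tested with `⟪ξ, x⟫ ^ l * G ‖x‖`. Because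
`Δ ⟪ξ, x⟫ ^ l = l (l - 1) ‖ξ‖² ⟪ξ, x⟫ ^ (l - 2)`, induction on `l` reduces the vanishing of all
moments `∫ d(x) ⟪ξ, x⟫ ^ l F ‖x‖` to an ordinary differential equation for `G` with right-hand side
`F` (`moments_eq_zero`). Its solutions need not have compact support and are cut off. For unique
continuation in a ball, the equation is solved inwards and cut off near the center, where `d`
vanishes (`exists_profile_backward`). For Rellich's lemma it is solved outwards and cut off in a far
shell; the solution has bounded energy, and the error tends to zero by the decay of `d`
(`exists_profile_forward`). When all moments vanish, so do the Fourier transforms of all products of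
`d` with radial cutoffs, and hence `d` itself (`integral_mul_eq_zero_of_moments`).
-/

namespace OverlapHelmholtz

/-! ### A linear second-order equation on a compact interval -/

/-- The linear system `y' = z`, `z' = q y + H` has a solution on the whole of a compact interval;
the Picard-Lindelöf theorem by itself is local, as the field is unbounded. -/
theorem exists_linear_ode_solution {a b : ℝ} (hab : a ≤ b) {q H : ℝ → ℝ}
    (hq : ContinuousOn q (Set.Icc a b)) (hH : ContinuousOn H (Set.Icc a b)) :
    ∃ Y : ℝ → ℝ × ℝ, Y a = 0 ∧ ∀ t ∈ Set.Icc a b,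
      HasDerivWithinAt Y ((Y t).2, q t * (Y t).1 + H t) (Set.Icc a b) t := by
  obtain ⟨Q, hQ⟩ := isCompact_Icc.exists_bound_of_continuousOn hq
  obtain ⟨B, hB⟩ := isCompact_Icc.exists_bound_of_continuousOn hH
  have haI : a ∈ Set.Icc a b := ⟨le_rfl, hab⟩
  have hQ0 : 0 ≤ Q := (norm_nonneg _).trans (hQ a haI)
  have hB0 : 0 ≤ B := (norm_nonneg _).trans (hB a haI)
  set K : ℝ := Q + 1 with hK
  have hK0 : 0 < K := by positivity
  set N : ℝ := gronwallBound 0 K B (b - a) with hN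
  have hmono := gronwallBound_mono (le_refl (0 : ℝ)) hB0 hK0.le
  have hN0 : 0 ≤ N := by
    have := hmono (show (0 : ℝ) ≤ b - a by linarith)
    simpa [gronwallBound_x0] using this
  -- The field is truncated outside a ball which, by Grönwall's inequality, the solution
  -- never leaves; this makes the field bounded, as the Picard-Lindelöf theorem requires.
  set c : ℝ → ℝ := fun x => max (-N) (min x N) with hc
  have hcN : ∀ x, |c x| ≤ N := fun x => by
    rw [abs_le]; exact ⟨le_max_left _ _, max_le (by linarith) (min_le_right _ _)⟩
  have hcx : ∀ x, |c x| ≤ |x| := fun x => by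
    simp only [hc]
    rcases max_cases (-N) (min x N) with h | h <;> rcases min_cases x N with h' | h' <;>
      rw [h.1] <;> (try rw [h'.1]) <;> cases abs_cases x <;> (try cases abs_cases N) <;>
      (try cases abs_cases (-N)) <;> linarith
  have hcid : ∀ x, |x| ≤ N → c x = x := fun x hx => by
    rw [abs_le] at hx
    simp only [hc]
    rw [min_eq_left hx.2, max_eq_right hx.1]
  have hcL : ∀ x y, |c x - c y| ≤ |x - y| := fun x y => by
    have := ((LipschitzWith.id (α := ℝ)).min_const N).const_max (-N)
    simpa [Real.dist_eq] using this.dist_le_mul x y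
  set f : ℝ → ℝ × ℝ → ℝ × ℝ := fun t Y => (c Y.2, q t * c Y.1 + H t) with hf
  have hPL : IsPicardLindelof f (tmin := a) (tmax := b) ⟨a, haI⟩ (0 : ℝ × ℝ)
      (((K * N + B) * (b - a)).toNNReal) 0 ((K * N + B).toNNReal) K.toNNReal := by
    refine ⟨fun t ht => ?_, fun Y _ => ?_, fun t ht Y _ => ?_, ?_⟩
    · refine LipschitzOnWith.of_dist_le_mul fun Y _ Z _ => ?_
      rw [Real.coe_toNNReal _ hK0.le, Prod.dist_eq, Prod.dist_eq]
      have h1 := hcL Y.2 Z.2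
      have h2 := hcL Y.1 Z.1
      have h3 : |q t| ≤ Q := hQ t ht
      simp only [Real.dist_eq, hf]
      have hM1 := le_max_left |Y.1 - Z.1| |Y.2 - Z.2|
      have hM2 := le_max_right |Y.1 - Z.1| |Y.2 - Z.2|
      set M := max |Y.1 - Z.1| |Y.2 - Z.2|
      have hM0 : 0 ≤ M := (abs_nonneg _).trans hM1
      refine max_le ?_ ?_
      · nlinarith
      · rw [show q t * c Y.1 + H t - (q t * c Z.1 + H t) = q t * (c Y.1 - c Z.1) by ring, abs_mul]
        have := mul_le_mul h3 (h2.trans hM1) (abs_nonneg _) hQ0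
        nlinarith
    · exact continuousOn_const.prodMk ((hq.mul continuousOn_const).add hH)
    · rw [Real.coe_toNNReal _ (by positivity), Prod.norm_def]
      have h3 : |q t| ≤ Q := hQ t ht
      have h4 : |H t| ≤ B := hB t ht
      refine max_le ?_ ?_
      · have := hcN Y.2
        simp only [hf, Real.norm_eq_abs]
        nlinarith
      · simp only [hf, Real.norm_eq_abs]
        refine (abs_add_le _ _).trans (add_le_add ?_ h4)
        rw [abs_mul]
        exact mul_le_mul (by linarith) (hcN _) (abs_nonneg _) hK0.le
    · rw [Real.coe_toNNReal _ (by positivity),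
        Real.coe_toNNReal _ (mul_nonneg (by positivity) (by linarith))]
      simp [hab]
  obtain ⟨Y, hY0, hY⟩ := hPL.exists_eq_forall_mem_Icc_hasDerivWithinAt₀
  have hbd : ∀ t ∈ Set.Icc a b, ‖Y t‖ ≤ N := by
    intro t ht
    refine (norm_le_gronwallBound_of_norm_deriv_right_le (f := Y) (f' := fun t => f t (Y t))
      (δ := 0) (K := K) (ε := B) (HasDerivWithinAt.continuousOn hY) (fun x hx => ?_) ?_
      (fun x hx => ?_) t ht).trans (hmono (by linarith [ht.2]))
    · exact (hY x ⟨hx.1, hx.2.le⟩).mono_of_mem_nhdsWithin (Icc_mem_nhdsGE_of_mem hx)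
    · simpa using le_of_eq (congrArg norm hY0)
    · have hxI : x ∈ Set.Icc a b := ⟨hx.1, hx.2.le⟩
      have h3 : |q x| ≤ Q := hQ x hxI
      have h4 : |H x| ≤ B := hB x hxI
      have n1 : |(Y x).1| ≤ ‖Y x‖ := norm_fst_le (Y x)
      have n2 : |(Y x).2| ≤ ‖Y x‖ := norm_snd_le (Y x)
      have n0 := norm_nonneg (Y x)
      rw [Prod.norm_def]
      refine max_le ?_ ?_
      · simp only [hf, Real.norm_eq_abs]
        have := (hcx (Y x).2).trans n2
        nlinarith
      · simp only [hf, Real.norm_eq_abs]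
        refine (abs_add_le _ _).trans (add_le_add ?_ h4)
        rw [abs_mul]
        exact mul_le_mul (by linarith) ((hcx _).trans n1) (abs_nonneg _) hK0.le
  refine ⟨Y, hY0, fun t ht => ?_⟩
  have h := hY t ht
  have n1 : |(Y t).1| ≤ N := (norm_fst_le (Y t)).trans (hbd t ht)
  have n2 : |(Y t).2| ≤ N := (norm_snd_le (Y t)).trans (hbd t ht)
  simpa only [hf, hcid _ n1, hcid _ n2] using h

/-- If the right-hand side vanishes on `[a, a']`, the solution of `y'' = q y + H` with zero initial
data at `a` also does, so that its extension by zero to the left of `a` is smooth. -/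
theorem exists_smooth_ode_solution {a a' b : ℝ} (haa : a < a') (hab : a' < b) {q H : ℝ → ℝ}
    (hq : ContDiffOn ℝ (⊤ : ℕ∞) q (Set.Icc a b)) (hH : ContDiffOn ℝ (⊤ : ℕ∞) H (Set.Icc a b))
    (hH0 : ∀ t ∈ Set.Icc a a', H t = 0) :
    ∃ y z : ℝ → ℝ, ContDiffOn ℝ (⊤ : ℕ∞) y (Set.Iio b) ∧
      (∀ t < a', y t = 0) ∧ (∀ t < a', z t = 0) ∧
      (∀ t < b, HasDerivAt y (z t) t) ∧
      (∀ t ∈ Set.Ioo a b, HasDerivAt z (q t * y t + H t) t) := by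
  obtain ⟨Y, hY0, hY⟩ := exists_linear_ode_solution (haa.trans hab).le hq.continuousOn
    hH.continuousOn
  have hsm : ContDiffOn ℝ (⊤ : ℕ∞) Y (Set.Icc a b) := by
    refine ODE.contDiffOn_enat_Icc_of_hasDerivWithinAt
      (f := fun t Y => (Y.2, q t * Y.1 + H t)) (u := Set.univ) ?_ hY (fun _ _ => trivial)
    have h1 : ContDiffOn ℝ (⊤ : ℕ∞) (fun p : ℝ × (ℝ × ℝ) => q p.1)
        (Set.Icc a b ×ˢ Set.univ) := hq.comp contDiff_fst.contDiffOn (fun p hp => hp.1)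
    have h2 : ContDiffOn ℝ (⊤ : ℕ∞) (fun p : ℝ × (ℝ × ℝ) => H p.1)
        (Set.Icc a b ×ˢ Set.univ) := hH.comp contDiff_fst.contDiffOn (fun p hp => hp.1)
    have h3 : ContDiff ℝ (⊤ : ℕ∞) (fun p : ℝ × (ℝ × ℝ) => p.2.1) := by fun_prop
    have h4 : ContDiff ℝ (⊤ : ℕ∞) (fun p : ℝ × (ℝ × ℝ) => p.2.2) := by fun_prop
    exact h4.contDiffOn.prodMk ((h1.mul h3.contDiffOn).add h2)
  -- uniqueness: the solution vanishes as long as the right-hand side does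
  have hzero : ∀ t ∈ Set.Icc a a', Y t = 0 := by
    have hsub : Set.Icc a a' ⊆ Set.Icc a b := Set.Icc_subset_Icc_right hab.le
    obtain ⟨Q, hQ⟩ := isCompact_Icc.exists_bound_of_continuousOn hq.continuousOn
    refine eq_zero_of_abs_deriv_le_mul_abs_self_of_eq_zero_right (K := Q + 1)
      (f' := fun t => ((Y t).2, q t * (Y t).1 + H t)) (hsm.continuousOn.mono hsub)
      (fun x hx => ?_) hY0 (fun x hx => ?_)
    · exact (hY x (hsub ⟨hx.1, hx.2.le⟩)).mono_of_mem_nhdsWithin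
        (Icc_mem_nhdsGE_of_mem ⟨hx.1, hx.2.trans hab⟩)
    · have h3 : |q x| ≤ Q := hQ x (hsub ⟨hx.1, hx.2.le⟩)
      have n1 : |(Y x).1| ≤ ‖Y x‖ := norm_fst_le (Y x)
      have n2 : |(Y x).2| ≤ ‖Y x‖ := norm_snd_le (Y x)
      have n0 := norm_nonneg (Y x)
      have hQ0 : 0 ≤ Q := (abs_nonneg _).trans h3
      rw [hH0 x ⟨hx.1, hx.2.le⟩, add_zero, Prod.norm_def]
      refine max_le ?_ ?_
      · simp only [Real.norm_eq_abs]; nlinarith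
      · simp only [Real.norm_eq_abs]
        rw [abs_mul]
        have := mul_le_mul h3 n1 (abs_nonneg _) hQ0
        nlinarith
  set Z : ℝ → ℝ × ℝ := fun t => if t ≤ a then 0 else Y t with hZ
  have hZY : ∀ t, a < t → Z t = Y t := fun t ht => by simp [hZ, not_le.2 ht]
  have hZ0 : ∀ t < a', Z t = 0 := fun t ht => by
    by_cases h : t ≤ a
    · simp [hZ, h]
    · rw [hZY t (not_le.1 h)]; exact hzero t ⟨(not_le.1 h).le, ht.le⟩
  have hnear : ∀ t, a < t → Z =ᶠ[𝓝 t] Y := fun t ht => by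
    filter_upwards [lt_mem_nhds ht] with s hs using hZY s hs
  have hnear0 : ∀ t < a', Z =ᶠ[𝓝 t] fun _ => 0 := fun t ht => by
    filter_upwards [gt_mem_nhds ht] with s hs using hZ0 s hs
  have hZsm : ∀ t < b, ContDiffAt ℝ (⊤ : ℕ∞) Z t := fun t ht => by
    by_cases h : t < a'
    · exact contDiffAt_const.congr_of_eventuallyEq (hnear0 t h)
    · have hat : a < t := haa.trans_le (not_lt.1 h)
      exact (hsm.contDiffAt (Icc_mem_nhds hat ht)).congr_of_eventuallyEq (hnear t hat)
  have hZd : ∀ t ∈ Set.Ioo a b, HasDerivAt Z ((Z t).2, q t * (Z t).1 + H t) t := fun t ht => by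
    rw [hZY t ht.1]
    exact ((hY t ⟨ht.1.le, ht.2.le⟩).hasDerivAt (Icc_mem_nhds ht.1 ht.2)).congr_of_eventuallyEq
      (hnear t ht.1)
  refine ⟨fun t => (Z t).1, fun t => (Z t).2, fun t ht => ?_, fun t ht => by simp [hZ0 t ht],
    fun t ht => by simp [hZ0 t ht], fun t ht => ?_, fun t ht => ?_⟩
  · exact (contDiffAt_fst.comp t (hZsm t ht)).contDiffWithinAt
  · change HasDerivAt (fun t => (Z t).1) (Z t).2 t
    by_cases h : t < a'
    · rw [show (Z t).2 = 0 by rw [hZ0 t h]; rfl]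
      exact (hasDerivAt_const t (0 : ℝ)).congr_of_eventuallyEq
        (by filter_upwards [hnear0 t h] with s hs; simp [hs])
    · exact (hZd t ⟨haa.trans_le (not_lt.1 h), ht⟩).fst
  · exact (hZd t ht).snd

/-- The energy `z ^ 2 + k ^ 2 * y ^ 2` of a solution of `y'' = (μ / t ^ 2 - k ^ 2) y + H` which
vanishes initially has a bound that does not depend on the right end point `b`, because
`1 / t ^ 2` is integrable at infinity. -/
theorem ode_energy_le {a a' b k μ C : ℝ} (ha : 0 < a) (haa : a < a') (hk : 0 < k)
    {H y z : ℝ → ℝ} (hH : ∀ t ∈ Set.Ioo a b, |H t| ≤ C / t ^ 2)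
    (hy0 : ∀ t < a', y t = 0) (hz0 : ∀ t < a', z t = 0)
    (hy : ∀ t < b, HasDerivAt y (z t) t)
    (hz : ∀ t ∈ Set.Ioo a b, HasDerivAt z ((μ / t ^ 2 - k ^ 2) * y t + H t) t) :
    ∀ t ∈ Set.Ioo a b, z t ^ 2 + k ^ 2 * y t ^ 2 ≤ Real.exp ((|μ| / k + C) / a) := by
  intro t ht
  rcases lt_or_ge t a' with hta | hta
  · rw [hy0 t hta, hz0 t hta]; simpa using (Real.exp_pos _).le
  have hC : 0 ≤ C := by
    have h := (abs_nonneg _).trans (hH t ht)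
    by_contra hcon
    have : C / t ^ 2 < 0 := div_neg_of_neg_of_pos (not_le.1 hcon)
      (by have := ha.trans ht.1; positivity)
    linarith
  set M := |μ| / k + C with hM
  have hM0 : 0 ≤ M := by positivity
  obtain ⟨s, hs1, hs2⟩ := exists_between haa
  -- `(E + 1) exp (M / t)` is nonincreasing, where `E = z ^ 2 + k ^ 2 y ^ 2`
  have hd : ∀ r ∈ Set.Ioo a b, HasDerivAt
      (fun t => (z t ^ 2 + k ^ 2 * y t ^ 2 + 1) * Real.exp (M / t))
      ((2 * z r * ((μ / r ^ 2 - k ^ 2) * y r + H r) + k ^ 2 * (2 * y r * z r)) *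
          Real.exp (M / r) +
        (z r ^ 2 + k ^ 2 * y r ^ 2 + 1) * (Real.exp (M / r) * (-M / r ^ 2))) r := by
    intro r hr
    have hr0 : r ≠ 0 := (ha.trans hr.1).ne'
    have h1 := (hz r hr).pow 2
    have h2 := ((hy r hr.2).pow 2).const_mul (k ^ 2)
    have h3 : HasDerivAt (fun t => M / t) (-M / r ^ 2) r := by
      simpa [neg_div, div_eq_mul_inv] using (hasDerivAt_inv hr0).const_mul M
    refine (((h1.add h2).add_const 1).mul h3.exp).congr_deriv ?_
    simp only [Pi.add_apply, Pi.pow_apply]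
    push_cast
    ring
  have hanti : AntitoneOn (fun t => (z t ^ 2 + k ^ 2 * y t ^ 2 + 1) * Real.exp (M / t))
      (Set.Ico s b) := by
    refine antitoneOn_of_deriv_nonpos (convex_Ico s b)
      (fun r hr => (hd r ⟨hs1.trans_le hr.1, hr.2⟩).continuousAt.continuousWithinAt)
      (fun r hr => ?_) (fun r hr => ?_)
    · rw [interior_Ico] at hr
      exact (hd r ⟨hs1.trans hr.1, hr.2⟩).differentiableAt.differentiableWithinAt
    · rw [interior_Ico] at hr
      have hrI : r ∈ Set.Ioo a b := ⟨hs1.trans hr.1, hr.2⟩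
      have hr0 : 0 < r := ha.trans hrI.1
      rw [(hd r hrI).deriv]
      have key : 2 * z r * (μ / r ^ 2 * y r + H r) ≤
          (z r ^ 2 + k ^ 2 * y r ^ 2 + 1) * (M / r ^ 2) := by
        have e1 : 2 * z r * (μ / r ^ 2 * y r) ≤
            (z r ^ 2 + k ^ 2 * y r ^ 2) * (|μ| / k / r ^ 2) := by
          have h1 : 2 * (z r * (k * y r)) ≤ z r ^ 2 + k ^ 2 * y r ^ 2 := by
            nlinarith [sq_nonneg (z r - k * y r)]
          have h2 : -(2 * (z r * (k * y r))) ≤ z r ^ 2 + k ^ 2 * y r ^ 2 := by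
            nlinarith [sq_nonneg (z r + k * y r)]
          have h3 : 2 * z r * (μ / r ^ 2 * y r) = (2 * (z r * (k * y r)) * μ) / k / r ^ 2 := by
            field_simp
          have h4 : (z r ^ 2 + k ^ 2 * y r ^ 2) * (|μ| / k / r ^ 2) =
              ((z r ^ 2 + k ^ 2 * y r ^ 2) * |μ|) / k / r ^ 2 := by ring
          rw [h3, h4]
          have h5 : 2 * (z r * (k * y r)) * μ ≤ (z r ^ 2 + k ^ 2 * y r ^ 2) * |μ| := by
            refine (le_abs_self _).trans ?_
            rw [abs_mul]
            exact mul_le_mul_of_nonneg_right (abs_le.2 ⟨by linarith, h1⟩) (abs_nonneg _)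
          exact div_le_div_of_nonneg_right (div_le_div_of_nonneg_right h5 hk.le) (by positivity)
        have e2 : 2 * z r * H r ≤ (z r ^ 2 + 1) * (C / r ^ 2) := by
          have h1 := hH r hrI
          have h2 : 2 * |z r| ≤ z r ^ 2 + 1 := by
            nlinarith [sq_nonneg (|z r| - 1), sq_abs (z r)]
          calc 2 * z r * H r ≤ |2 * z r * H r| := le_abs_self _
            _ = 2 * |z r| * |H r| := by rw [abs_mul, abs_mul, abs_two]
            _ ≤ _ := mul_le_mul h2 h1 (abs_nonneg _) (by positivity)
        have e3 : 0 ≤ k ^ 2 * y r ^ 2 * (C / r ^ 2) := by positivity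
        have e4 : 0 ≤ |μ| / k / r ^ 2 := by positivity
        have e5 : M / r ^ 2 = |μ| / k / r ^ 2 + C / r ^ 2 := by rw [hM]; ring
        rw [e5]
        nlinarith
      have : (2 * z r * ((μ / r ^ 2 - k ^ 2) * y r + H r) + k ^ 2 * (2 * y r * z r)) *
            Real.exp (M / r) +
          (z r ^ 2 + k ^ 2 * y r ^ 2 + 1) * (Real.exp (M / r) * (-M / r ^ 2)) =
          (2 * z r * (μ / r ^ 2 * y r + H r) -
            (z r ^ 2 + k ^ 2 * y r ^ 2 + 1) * (M / r ^ 2)) * Real.exp (M / r) := by ring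
      rw [this]
      exact mul_nonpos_of_nonpos_of_nonneg (by linarith) (Real.exp_pos _).le
  have h := hanti ⟨le_rfl, hs2.trans_le hta |>.trans ht.2⟩ ⟨hs2.le.trans hta, ht.2⟩
    (hs2.le.trans hta)
  simp only [hy0 s hs2, hz0 s hs2] at h
  have h1 : 1 ≤ Real.exp (M / t) := Real.one_le_exp (by have := ha.trans ht.1; positivity)
  have h2 : Real.exp (M / s) ≤ Real.exp (M / a) :=
    Real.exp_le_exp.2 (div_le_div_of_nonneg_left hM0 ha hs1.le)
  have h3 : 0 ≤ z t ^ 2 + k ^ 2 * y t ^ 2 := by positivity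
  nlinarith

/-! ### Partial derivatives and test functions -/

variable {m : ℕ}

theorem laplacian_eq_sum_partialDeriv {φ : Space m → ℂ} (hφ : ContDiff ℝ 2 φ) (x : Space m) :
    Laplacian.laplacian φ x = ∑ i, partialDeriv i (partialDeriv i φ) x := by
  rw [InnerProductSpace.laplacian_eq_iteratedFDeriv_orthonormalBasis φ
    (EuclideanSpace.basisFun (Fin m) ℝ)]
  refine Finset.sum_congr rfl fun i _ => ?_
  rw [iteratedFDeriv_two_apply]
  have h : DifferentiableAt ℝ (fderiv ℝ φ) x :=
    (hφ.fderiv_right (m := 1) (by norm_num)).differentiable (by norm_num) x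
  have := (h.hasFDerivAt.clm_apply
    (hasFDerivAt_const (EuclideanSpace.single i (1 : ℝ)) x)).fderiv
  change _ = fderiv ℝ (fun x => fderiv ℝ φ x (EuclideanSpace.single i 1)) x
    (EuclideanSpace.single i 1)
  rw [this]
  simp

theorem contDiff_partialDeriv {φ : Space m → ℂ} (hφ : ContDiff ℝ (⊤ : ℕ∞) φ) (i : Fin m) :
    ContDiff ℝ (⊤ : ℕ∞) (partialDeriv i φ) :=
  (hφ.fderiv_right (m := (⊤ : ℕ∞)) (by norm_cast)).clm_apply contDiff_const

theorem tsupport_partialDeriv_subset (φ : Space m → ℂ) (i : Fin m) :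
    tsupport (partialDeriv i φ) ⊆ tsupport φ := by
  refine closure_minimal (fun x hx => ?_) (isClosed_tsupport φ)
  refine support_fderiv_subset ℝ (f := φ) fun h => hx ?_
  simp [partialDeriv, h]

theorem partialDeriv_mul {φ ψ : Space m → ℂ} {x : Space m} (hφ : DifferentiableAt ℝ φ x)
    (hψ : DifferentiableAt ℝ ψ x) (i : Fin m) :
    partialDeriv i (fun y => φ y * ψ y) x =
      φ x * partialDeriv i ψ x + partialDeriv i φ x * ψ x := by
  simp only [partialDeriv]
  rw [(hφ.hasFDerivAt.fun_mul hψ.hasFDerivAt).fderiv]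
  simp [mul_comm]

theorem partialDeriv_add {φ ψ : Space m → ℂ} {x : Space m} (hφ : DifferentiableAt ℝ φ x)
    (hψ : DifferentiableAt ℝ ψ x) (i : Fin m) :
    partialDeriv i (fun y => φ y + ψ y) x = partialDeriv i φ x + partialDeriv i ψ x := by
  simp only [partialDeriv]
  rw [(hφ.hasFDerivAt.fun_add hψ.hasFDerivAt).fderiv]
  simp

theorem partialDeriv_sub {φ ψ : Space m → ℂ} {x : Space m} (hφ : DifferentiableAt ℝ φ x)
    (hψ : DifferentiableAt ℝ ψ x) (i : Fin m) :
    partialDeriv i (fun y => φ y - ψ y) x = partialDeriv i φ x - partialDeriv i ψ x := by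
  simp only [partialDeriv]
  rw [(hφ.hasFDerivAt.fun_sub hψ.hasFDerivAt).fderiv]
  simp

theorem partialDeriv_conj {φ : Space m → ℂ} {x : Space m} (hφ : DifferentiableAt ℝ φ x)
    (i : Fin m) :
    partialDeriv i (fun y => (starRingEnd ℂ) (φ y)) x = (starRingEnd ℂ) (partialDeriv i φ x) := by
  have := (Complex.conjCLE.toContinuousLinearMap.hasFDerivAt.comp x hφ.hasFDerivAt).fderiv
  simp only [partialDeriv]
  change fderiv ℝ (Complex.conjCLE.toContinuousLinearMap ∘ φ) x _ = _
  rw [this]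
  simp

theorem contDiff_laplacian {φ : Space m → ℂ} (hφ : ContDiff ℝ (⊤ : ℕ∞) φ) :
    ContDiff ℝ (⊤ : ℕ∞) (Laplacian.laplacian φ) := by
  have : Laplacian.laplacian φ = fun x => ∑ i, partialDeriv i (partialDeriv i φ) x :=
    funext (laplacian_eq_sum_partialDeriv (hφ.of_le (by norm_cast)))
  rw [this]
  exact ContDiff.sum fun i _ => contDiff_partialDeriv (contDiff_partialDeriv hφ i) i

theorem tsupport_laplacian_subset {φ : Space m → ℂ} (hφ : ContDiff ℝ 2 φ) :
    tsupport (Laplacian.laplacian φ) ⊆ tsupport φ := by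
  refine closure_minimal (fun x hx => ?_) (isClosed_tsupport φ)
  by_contra hcon
  refine hx ?_
  rw [laplacian_eq_sum_partialDeriv hφ]
  refine Finset.sum_eq_zero fun i _ => ?_
  refine image_eq_zero_of_notMem_tsupport fun h => hcon ?_
  exact tsupport_partialDeriv_subset _ _ (tsupport_partialDeriv_subset _ _ h)

namespace IsTestFunction

variable {D D' : Set (Space m)} {φ ψ χ : Space m → ℂ}

theorem mono (hφ : IsTestFunction D φ) (h : D ⊆ D') : IsTestFunction D' φ :=
  ⟨hφ.smooth, hφ.compact, hφ.support_subset.trans h⟩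

theorem of_tsupport (hφ : IsTestFunction D φ) (hs : ContDiff ℝ (⊤ : ℕ∞) ψ)
    (h : tsupport ψ ⊆ tsupport φ) : IsTestFunction D ψ :=
  ⟨hs, hφ.compact.of_isClosed_subset (isClosed_tsupport ψ) h, h.trans hφ.support_subset⟩

theorem partialDeriv (hφ : IsTestFunction D φ) (i : Fin m) :
    IsTestFunction D (partialDeriv i φ) :=
  hφ.of_tsupport (contDiff_partialDeriv hφ.smooth i) (tsupport_partialDeriv_subset φ i)

theorem laplacian (hφ : IsTestFunction D φ) : IsTestFunction D (Laplacian.laplacian φ) :=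
  hφ.of_tsupport (contDiff_laplacian hφ.smooth)
    (tsupport_laplacian_subset (hφ.smooth.of_le (by norm_cast)))

theorem smooth_mul (hφ : IsTestFunction D φ) (hχ : ContDiff ℝ (⊤ : ℕ∞) χ) :
    IsTestFunction (D ∩ tsupport χ) (fun x => χ x * φ x) :=
  ⟨hχ.mul hφ.smooth, hφ.compact.mul_left,
    fun _ hx => ⟨hφ.support_subset (tsupport_mul_subset_right hx), tsupport_mul_subset_left hx⟩⟩

theorem conj (hφ : IsTestFunction D φ) : IsTestFunction D (fun x => (starRingEnd ℂ) (φ x)) :=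
  hφ.of_tsupport (Complex.conjCLE.toContinuousLinearMap.contDiff.comp hφ.smooth)
    (closure_mono fun x hx h => hx (by simp [h]))

theorem differentiableAt (hφ : IsTestFunction D φ) (x : Space m) : DifferentiableAt ℝ φ x :=
  hφ.smooth.differentiable (by simp) x

theorem eq_zero (hφ : IsTestFunction D φ) {x : Space m} (hx : x ∉ D) : φ x = 0 :=
  image_eq_zero_of_notMem_tsupport fun h => hx (hφ.support_subset h)

theorem memLp (hφ : IsTestFunction D φ) (p : ENNReal) (μ : Measure (Space m))
    [IsFiniteMeasureOnCompacts μ] : MemLp φ p μ :=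
  hφ.smooth.continuous.memLp_of_hasCompactSupport hφ.compact

theorem setIntegral_eq (hφ : IsTestFunction D φ) (u : Space m → ℂ) :
    ∫ x in D, u x * φ x = ∫ x, u x * φ x :=
  setIntegral_eq_integral_of_forall_compl_eq_zero fun x hx => by rw [hφ.eq_zero hx, mul_zero]

/-- The product of a function which is square integrable on `D` with a test function on `D` is
integrable over the whole space; values off `D` do not matter. -/
theorem integrable_mul (hφ : IsTestFunction D φ) {u : Space m → ℂ}
    (hu : MemLp u 2 (volume.restrict D)) : Integrable (fun x => u x * φ x) := by
  have h : IntegrableOn (fun x => u x * φ x) D := hu.integrable_mul (hφ.memLp 2 _)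
  refine (integrableOn_iff_integrable_of_support_subset fun x hx => ?_).1 h
  by_contra hcon
  exact hx (by simp [hφ.eq_zero hcon])

end IsTestFunction

/-! ### The Laplacian of a power of a linear form times a radial function -/

/-- For a profile `F` vanishing near `0`, the profile `r ↦ F' r / r`. The gradient of `F ‖x‖` is
`radialDeriv F ‖x‖ • x`. -/
noncomputable def radialDeriv (F : ℝ → ℝ) (r : ℝ) : ℝ := deriv F r / r

theorem contDiff_of_zero_lt {a : ℝ} (ha : 0 < a) {F : ℝ → ℝ} (h0 : ∀ r < a, F r = 0)
    (h : ∀ r, 0 < r → ContDiffAt ℝ (⊤ : ℕ∞) F r) : ContDiff ℝ (⊤ : ℕ∞) F := by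
  rw [contDiff_iff_contDiffAt]
  intro r
  rcases lt_or_ge r a with hr | hr
  · refine contDiffAt_const.congr_of_eventuallyEq (?_ : F =ᶠ[𝓝 r] fun _ => 0)
    filter_upwards [gt_mem_nhds hr] with s hs using h0 s hs
  · exact h r (ha.trans_le hr)

theorem deriv_eq_zero_of_lt {a : ℝ} {F : ℝ → ℝ} (h0 : ∀ r < a, F r = 0) :
    ∀ r < a, deriv F r = 0 := fun r hr => by
  have : F =ᶠ[𝓝 r] fun _ => 0 := by
    filter_upwards [gt_mem_nhds hr] with s hs using h0 s hs
  rw [this.deriv_eq]; simp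

theorem radialDeriv_eq_zero {a : ℝ} {F : ℝ → ℝ} (h0 : ∀ r < a, F r = 0) :
    ∀ r < a, radialDeriv F r = 0 := fun r hr => by
  simp [radialDeriv, deriv_eq_zero_of_lt h0 r hr]

theorem contDiff_radialDeriv {a : ℝ} (ha : 0 < a) {F : ℝ → ℝ} (hF : ContDiff ℝ (⊤ : ℕ∞) F)
    (h0 : ∀ r < a, F r = 0) : ContDiff ℝ (⊤ : ℕ∞) (radialDeriv F) :=
  contDiff_of_zero_lt ha (radialDeriv_eq_zero h0) fun _ hr =>
    (((contDiff_infty_iff_deriv.1 hF).2).contDiffAt).div contDiffAt_id hr.ne'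

theorem hasFDerivAt_radial {a : ℝ} (ha : 0 < a) {F : ℝ → ℝ} (hF : ContDiff ℝ (⊤ : ℕ∞) F)
    (h0 : ∀ r < a, F r = 0) (x : Space m) :
    HasFDerivAt (fun x : Space m => F ‖x‖) (radialDeriv F ‖x‖ • innerSL ℝ x) x := by
  by_cases hx : x = 0
  · subst hx
    have h : (fun x : Space m => F ‖x‖) =ᶠ[𝓝 0] fun _ => 0 := by
      filter_upwards [Metric.ball_mem_nhds (0 : Space m) ha] with y hy
      exact h0 _ (by simpa using hy)
    simpa using (hasFDerivAt_const (0 : ℝ) (0 : Space m)).congr_of_eventuallyEq h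
  · have hx' : ‖x‖ ≠ 0 := norm_ne_zero_iff.2 hx
    have h1 : HasFDerivAt (fun x : Space m => ‖x‖) ((1 / ‖x‖) • innerSL ℝ x) x := by
      have := (hasStrictFDerivAt_norm_sq x).hasFDerivAt.sqrt (by positivity)
      simp only [Real.sqrt_sq (norm_nonneg _)] at this
      refine this.congr_fderiv ?_
      ext v
      simp only [smul_apply, innerSL_apply_apply, smul_eq_mul, nsmul_eq_mul]
      field_simp
      norm_num
    have h2 := ((hF.differentiable (by simp)) ‖x‖).hasDerivAt.comp_hasFDerivAt x h1
    refine h2.congr_fderiv ?_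
    rw [smul_smul, radialDeriv, mul_one_div]

theorem contDiff_radial {a : ℝ} (ha : 0 < a) {F : ℝ → ℝ} (hF : ContDiff ℝ (⊤ : ℕ∞) F)
    (h0 : ∀ r < a, F r = 0) : ContDiff ℝ (⊤ : ℕ∞) (fun x : Space m => F ‖x‖) := by
  rw [contDiff_iff_contDiffAt]
  intro x
  by_cases hx : x = 0
  · subst hx
    have h : (fun x : Space m => F ‖x‖) =ᶠ[𝓝 0] fun _ => 0 := by
      filter_upwards [Metric.ball_mem_nhds (0 : Space m) ha] with y hy
      exact h0 _ (by simpa using hy)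
    exact contDiffAt_const.congr_of_eventuallyEq h
  · exact hF.contDiffAt.comp x (contDiffAt_norm ℝ hx)

/-- The first term is `F ‖x‖ * Δ ⟪ξ, x⟫ ^ l`; for `l < 2` its coefficient `l * (l - 1)` is zero, so
the truncated subtraction in the exponent `l - 2` is harmless. The mixed terms contribute `2 * l` to the
coefficient `m - 1` of the radial Laplacian. -/
theorem laplacian_pow_inner_mul_radial {a : ℝ} (ha : 0 < a) {F : ℝ → ℝ}
    (hF : ContDiff ℝ (⊤ : ℕ∞) F) (h0 : ∀ r < a, F r = 0) (ξ : Space m) (l : ℕ) (x : Space m) :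
    Laplacian.laplacian (fun x : Space m => ((inner ℝ ξ x ^ l * F ‖x‖ : ℝ) : ℂ)) x =
      ((l * (l - 1 : ℕ) * ‖ξ‖ ^ 2 * inner ℝ ξ x ^ (l - 2) * F ‖x‖ +
        inner ℝ ξ x ^ l * (deriv (deriv F) ‖x‖ + (m - 1 + 2 * l) / ‖x‖ * deriv F ‖x‖) : ℝ) : ℂ) := by
  have hG := contDiff_radialDeriv ha hF h0
  have hG0 := radialDeriv_eq_zero h0
  have hin : ∀ x : Space m, HasFDerivAt (fun x : Space m => inner ℝ ξ x) (innerSL ℝ ξ) x :=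
    fun x => (innerSL ℝ ξ).hasFDerivAt
  have hpow : ∀ (p : ℕ) (x : Space m), HasFDerivAt (fun x : Space m => inner ℝ ξ x ^ p)
      ((p * inner ℝ ξ x ^ (p - 1) : ℝ) • innerSL ℝ ξ) x := fun p x =>
    (hasDerivAt_pow p (inner ℝ ξ x)).comp_hasFDerivAt x (hin x)
  have hD : ∀ (i : Fin m) (x : Space m),
      partialDeriv i (fun x : Space m => ((inner ℝ ξ x ^ l * F ‖x‖ : ℝ) : ℂ)) x =
        ((l * inner ℝ ξ x ^ (l - 1) * ξ i * F ‖x‖ +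
          inner ℝ ξ x ^ l * (radialDeriv F ‖x‖ * x i) : ℝ) : ℂ) := by
    intro i x
    have h := Complex.ofRealCLM.hasFDerivAt.comp x
      ((hpow l x).fun_mul (hasFDerivAt_radial ha hF h0 x))
    refine (congrArg (· (EuclideanSpace.single i 1)) h.fderiv).trans ?_
    simp [EuclideanSpace.inner_single_right]
    ring
  have hsm : ContDiff ℝ (⊤ : ℕ∞)
      (fun x : Space m => ((inner ℝ ξ x ^ l * F ‖x‖ : ℝ) : ℂ)) := by
    have h1 : ContDiff ℝ (⊤ : ℕ∞) (fun x : Space m => inner ℝ ξ x ^ l * F ‖x‖) :=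
      ((innerSL ℝ ξ).contDiff.pow l).mul (contDiff_radial ha hF h0)
    exact Complex.ofRealCLM.contDiff.comp h1
  rw [laplacian_eq_sum_partialDeriv (hsm.of_le (by norm_cast))]
  have hDD : ∀ i : Fin m, partialDeriv i (partialDeriv i
      (fun x : Space m => ((inner ℝ ξ x ^ l * F ‖x‖ : ℝ) : ℂ))) x =
      ((l * (l - 1 : ℕ) * inner ℝ ξ x ^ (l - 2) * F ‖x‖ * (ξ i) ^ 2 +
        2 * (l * inner ℝ ξ x ^ (l - 1) * radialDeriv F ‖x‖) * (ξ i * x i) +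
        inner ℝ ξ x ^ l * radialDeriv F ‖x‖ +
        inner ℝ ξ x ^ l * radialDeriv (radialDeriv F) ‖x‖ * (x i) ^ 2 : ℝ) : ℂ) := by
    intro i
    rw [show partialDeriv i (fun x : Space m => ((inner ℝ ξ x ^ l * F ‖x‖ : ℝ) : ℂ)) = _ from
      funext (hD i)]
    have hxi : HasFDerivAt (fun x : Space m => x i) (EuclideanSpace.proj i : Space m →L[ℝ] ℝ) x :=
      (EuclideanSpace.proj i : Space m →L[ℝ] ℝ).hasFDerivAt
    have h := Complex.ofRealCLM.hasFDerivAt.comp x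
      (((((hpow (l - 1) x).const_mul (l : ℝ)).mul_const (ξ i)).fun_mul
      (hasFDerivAt_radial ha hF h0 x)).fun_add
      ((hpow l x).fun_mul ((hasFDerivAt_radial ha hG hG0 x).fun_mul hxi)))
    refine (congrArg (· (EuclideanSpace.single i 1)) h.fderiv).trans ?_
    simp [EuclideanSpace.inner_single_right, Nat.sub_sub]
    ring
  simp only [hDD]
  rw [← Complex.ofReal_sum]
  congr 1
  simp only [Finset.sum_add_distrib, ← Finset.mul_sum]
  have e1 : ∑ i, (ξ i) ^ 2 = ‖ξ‖ ^ 2 := by rw [EuclideanSpace.real_norm_sq_eq]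
  have e2 : ∑ i, (x i) ^ 2 = ‖x‖ ^ 2 := by rw [EuclideanSpace.real_norm_sq_eq]
  have e3 : ∑ i, ξ i * x i = inner ℝ ξ x := by
    simp [PiLp.inner_apply, mul_comm]
  rw [e1, e2, e3]
  simp only [Finset.sum_const, Finset.card_univ, Fintype.card_fin, nsmul_eq_mul]
  have e4 : (l : ℝ) * inner ℝ ξ x ^ (l - 1) * inner ℝ ξ x = l * inner ℝ ξ x ^ l := by
    rcases l with _ | l
    · simp
    · simp; ring
  have e5 : radialDeriv (radialDeriv F) ‖x‖ * ‖x‖ ^ 2 =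
      deriv (deriv F) ‖x‖ - radialDeriv F ‖x‖ := by
    by_cases hr : ‖x‖ < a
    · rw [radialDeriv_eq_zero hG0 _ hr, hG0 _ hr,
        deriv_eq_zero_of_lt (deriv_eq_zero_of_lt h0) _ hr]
      simp
    · have hr0 : ‖x‖ ≠ 0 := (ha.trans_le (not_lt.1 hr)).ne'
      have hd : HasDerivAt (radialDeriv F)
          ((deriv (deriv F) ‖x‖ * ‖x‖ - deriv F ‖x‖ * 1) / ‖x‖ ^ 2) ‖x‖ :=
        ((((contDiff_infty_iff_deriv.1 hF).2).differentiable (by simp)) ‖x‖).hasDerivAt.div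
          (hasDerivAt_id _) hr0
      rw [show radialDeriv (radialDeriv F) ‖x‖ = deriv (radialDeriv F) ‖x‖ / ‖x‖ from rfl,
        hd.deriv, radialDeriv]
      field_simp
  have e6 : (m - 1 + 2 * l : ℝ) / ‖x‖ * deriv F ‖x‖ = (m - 1 + 2 * l) * radialDeriv F ‖x‖ := by
    rw [radialDeriv]; ring
  rw [e6]
  linear_combination (2 * radialDeriv F ‖x‖) * e4 + inner ℝ ξ x ^ l * e5

/-! ### Radial profiles and the radial Helmholtz operator -/

/-- `F` is a smooth function on `ℝ` with compact support in `I`. It serves as the profile of a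
radial test function `x ↦ F ‖x‖`; usually `I ⊆ (0, ∞)`. -/
structure IsProfile (I : Set ℝ) (F : ℝ → ℝ) : Prop where
  smooth : ContDiff ℝ (⊤ : ℕ∞) F
  compact : HasCompactSupport F
  support_subset : tsupport F ⊆ I

theorem IsProfile.of_eq_zero {F : ℝ → ℝ} {a b : ℝ} {I : Set ℝ} (hF : ContDiff ℝ (⊤ : ℕ∞) F)
    (hI : Set.Icc a b ⊆ I) (ha : ∀ r < a, F r = 0) (hb : ∀ r, b < r → F r = 0) :
    IsProfile I F := by
  have h : tsupport F ⊆ Set.Icc a b := by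
    refine closure_minimal (fun r hr => ?_) isClosed_Icc
    by_contra hcon
    rw [Set.mem_Icc, not_and_or, not_le, not_le] at hcon
    exact hr (hcon.elim (ha r) (hb r))
  exact ⟨hF, isCompact_Icc.of_isClosed_subset (isClosed_tsupport F) h, h.trans hI⟩

/-- A profile with support in an open interval `(a, b)` is supported in a smaller compact
interval. -/
theorem IsProfile.exists_Ioo {F : ℝ → ℝ} {a b : ℝ} (hab : a < b)
    (hF : IsProfile (Set.Ioo a b) F) :
    ∃ a₁ b₁, a < a₁ ∧ a₁ < b₁ ∧ b₁ < b ∧ (∀ r ≤ a₁, F r = 0) ∧ (∀ r, b₁ ≤ r → F r = 0) := by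
  have hz : ∀ r, r ∉ tsupport F → F r = 0 := fun r => image_eq_zero_of_notMem_tsupport
  rcases (tsupport F).eq_empty_or_nonempty with he | hne
  · obtain ⟨c, hc1, hc2⟩ := exists_between hab
    obtain ⟨e, he1, he2⟩ := exists_between hc2
    exact ⟨c, e, hc1, he1, he2, fun r _ => hz r (by simp [he]), fun r _ => hz r (by simp [he])⟩
  · obtain ⟨s, hs, hs'⟩ := hF.compact.exists_isLeast hne
    obtain ⟨t, ht, ht'⟩ := hF.compact.exists_isGreatest hne
    obtain ⟨c, hc1, hc2⟩ := exists_between (hF.support_subset hs).1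
    obtain ⟨e, he1, he2⟩ := exists_between (hF.support_subset ht).2
    refine ⟨c, e, hc1, hc2.trans_le ((hs' ht).trans he1.le), he2, fun r hr => hz r fun h => ?_,
      fun r hr => hz r fun h => ?_⟩
    · exact absurd (hs' h) (not_le.2 (hr.trans_lt hc2))
    · exact absurd (ht' h) (not_le.2 (he1.trans_le hr))

theorem IsProfile.mono {F : ℝ → ℝ} {I J : Set ℝ} (hF : IsProfile I F) (h : I ⊆ J) :
    IsProfile J F := ⟨hF.smooth, hF.compact, hF.support_subset.trans h⟩

theorem IsProfile.exists_Ioo_of_Ioi {F : ℝ → ℝ} {a : ℝ} (hF : IsProfile (Set.Ioi a) F) :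
    ∃ b, a < b ∧ IsProfile (Set.Ioo a b) F := by
  obtain ⟨b, hb⟩ := hF.compact.isBounded.bddAbove
  refine ⟨max (a + 1) (b + 1), by simp, hF.smooth, hF.compact, fun r hr =>
    ⟨hF.support_subset hr, lt_max_of_lt_right (by linarith [hb hr])⟩⟩

theorem IsProfile.exists_pos {F : ℝ → ℝ} {a : ℝ} (ha : 0 ≤ a) (hF : IsProfile (Set.Ioi a) F) :
    ∃ s, 0 < s ∧ ∀ r < s, F r = 0 := by
  obtain ⟨b, hab, hF'⟩ := hF.exists_Ioo_of_Ioi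
  obtain ⟨a₁, -, h1, -, -, h2, -⟩ := hF'.exists_Ioo hab
  exact ⟨a₁, ha.trans_lt h1, fun r hr => h2 r hr.le⟩

theorem IsProfile.rpow_mul {F : ℝ → ℝ} {a : ℝ} (ha : 0 ≤ a) {I : Set ℝ} (hI : I ⊆ Set.Ioi a)
    (hF : IsProfile I F) (s : ℝ) : IsProfile I (fun r => r ^ s * F r) := by
  have hsub : tsupport (fun r => r ^ s * F r) ⊆ tsupport F := tsupport_mul_subset_right
  refine ⟨?_, hF.compact.mul_left, hsub.trans hF.support_subset⟩
  obtain ⟨t, ht, h0⟩ := (hF.mono hI).exists_pos ha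
  exact contDiff_of_zero_lt ht (fun r hr => by simp [h0 r hr]) fun r hr =>
    (Real.contDiffAt_rpow_const_of_ne hr.ne').mul hF.smooth.contDiffAt

/-- The operator `B ↦ B'' + (k² - μ / r²) B`, to which the radial part of the Helmholtz operator
is conjugate. -/
noncomputable def radialOp (k μ : ℝ) (B : ℝ → ℝ) (r : ℝ) : ℝ :=
  deriv (deriv B) r + (k ^ 2 - μ / r ^ 2) * B r

theorem deriv_deriv_mul {χ y z : ℝ → ℝ} {t w : ℝ} (hχ : ContDiff ℝ (⊤ : ℕ∞) χ)
    (hy : ∀ᶠ s in 𝓝 t, HasDerivAt y (z s) s) (hz : HasDerivAt z w t) :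
    deriv (deriv fun s => χ s * y s) t =
      deriv (deriv χ) t * y t + 2 * deriv χ t * z t + χ t * w := by
  have hχ1 : ∀ s, HasDerivAt χ (deriv χ s) s := fun s =>
    (hχ.differentiable (by simp) s).hasDerivAt
  have hχ2 : HasDerivAt (deriv χ) (deriv (deriv χ) t) t :=
    ((((contDiff_infty_iff_deriv.1 hχ).2).differentiable (by simp)) t).hasDerivAt
  have h1 : deriv (fun s => χ s * y s) =ᶠ[𝓝 t] fun s => deriv χ s * y s + χ s * z s := by
    filter_upwards [hy] with s hs
    exact ((hχ1 s).fun_mul hs).deriv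
  rw [h1.deriv_eq, ((hχ2.fun_mul hy.self_of_nhds).fun_add ((hχ1 t).fun_mul hz)).deriv]
  ring

theorem eventually_hasDerivAt_of_lt {y z : ℝ → ℝ} {b : ℝ} (h : ∀ t < b, HasDerivAt y (z t) t)
    {t : ℝ} (ht : t < b) : ∀ᶠ s in 𝓝 t, HasDerivAt y (z s) s := by
  filter_upwards [gt_mem_nhds ht] with s hs using h s hs

theorem contDiff_mu_div_sq {k μ a b : ℝ} (h : 0 < a ∨ b < 0) :
    ContDiffOn ℝ (⊤ : ℕ∞) (fun r : ℝ => μ / r ^ 2 - k ^ 2) (Set.Icc a b) := by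
  intro r hr
  have hr0 : r ^ 2 ≠ 0 := by
    have : r ≠ 0 := by
      rcases h with h | h
      · exact (h.trans_le hr.1).ne'
      · exact (hr.2.trans_lt h).ne
    positivity
  exact ((contDiffAt_const.div (contDiffAt_id.pow 2 : ContDiffAt ℝ _ (fun r : ℝ => r ^ 2) r)
    hr0).sub contDiffAt_const).contDiffWithinAt

/-- A solution of the radial equation with right-hand side `H`, vanishing to the right of the
support of `H` and cut off below `δ`, away from the singular point `0` of the equation. -/
theorem exists_profile_backward (k μ : ℝ) {δ ρ : ℝ} (hδ : 0 < δ) {H : ℝ → ℝ}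
    (hρ : 0 < ρ) (hH : IsProfile (Set.Ioo 0 ρ) H) :
    ∃ B, IsProfile (Set.Ioo 0 ρ) B ∧ ∀ r, δ ≤ r → radialOp k μ B r = H r := by
  obtain ⟨a₁, b₁, ha₁, hab, hb₁, hl, hu⟩ := hH.exists_Ioo hρ
  obtain ⟨b₂, hb₁₂, hb₂⟩ := exists_between hb₁
  wlog hδa : δ < b₁ generalizing δ
  · obtain ⟨B, hB, h⟩ := this (δ := b₁ / 2) (by linarith) (by linarith)
    exact ⟨B, hB, fun r hr => h r (by linarith)⟩
  -- the equation is invariant under reflection, which turns the backward into a forward problem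
  have hHs : ContDiff ℝ (⊤ : ℕ∞) (fun s => H (-s)) := hH.smooth.comp contDiff_neg
  obtain ⟨y, z, hys, hy0, -, hyd, hzd⟩ := exists_smooth_ode_solution (a := -b₂) (a' := -b₁)
    (b := -(δ / 4)) (by linarith) (by linarith) (contDiff_mu_div_sq (k := k) (μ := μ)
      (Or.inr (by linarith))) (H := fun s => H (-s)) hHs.contDiffOn
      (fun t ht => hu _ (by linarith [ht.2]))
  set χ : ℝ → ℝ := fun r => Real.smoothTransition (2 * r / δ - 1) with hχdef
  have hχ : ContDiff ℝ (⊤ : ℕ∞) χ := Real.smoothTransition.contDiff.comp (by fun_prop)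
  have hχ0 : ∀ r ≤ δ / 2, χ r = 0 := fun r hr =>
    Real.smoothTransition.zero_of_nonpos (by
      rw [sub_nonpos, div_le_one hδ]; linarith)
  have hχ1 : ∀ r, δ ≤ r → χ r = 1 := fun r hr =>
    Real.smoothTransition.one_of_one_le (by
      rw [le_sub_iff_add_le, le_div_iff₀ hδ]; linarith)
  have hBs : ContDiff ℝ (⊤ : ℕ∞) (fun r => χ r * y (-r)) := by
    rw [contDiff_iff_contDiffAt]
    intro r
    rcases lt_or_ge r (δ / 2) with hr | hr
    · refine contDiffAt_const.congr_of_eventuallyEq (?_ : _ =ᶠ[𝓝 r] fun _ => (0 : ℝ))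
      filter_upwards [gt_mem_nhds hr] with s hs
      rw [hχ0 s (le_of_lt hs), zero_mul]
    · refine hχ.contDiffAt.mul (ContDiffAt.comp r (hys.contDiffAt (Iio_mem_nhds ?_))
        contDiff_neg.contDiffAt)
      linarith
  have hB0 : ∀ r, b₁ < r → χ r * y (-r) = 0 := fun r hr => by
    rw [hy0 (-r) (by linarith), mul_zero]
  refine ⟨fun r => χ r * y (-r), IsProfile.of_eq_zero hBs (a := δ / 2) (b := b₁)
    (fun r hr => ⟨by linarith [hr.1], by linarith [hr.2]⟩)
    (fun r hr => by rw [hχ0 r hr.le, zero_mul]) hB0, fun r hr => ?_⟩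
  rcases lt_or_ge b₁ r with hbr | hbr
  · have he : (fun r => χ r * y (-r)) =ᶠ[𝓝 r] fun _ => 0 := by
      filter_upwards [lt_mem_nhds hbr] with s hs using hB0 s hs
    have he' : deriv (fun r => χ r * y (-r)) =ᶠ[𝓝 r] fun _ => 0 := by
      simpa using he.deriv
    rw [radialOp, he'.deriv_eq, hB0 r hbr, hu r hbr.le]
    simp
  · have hd : ∀ s, δ / 4 < s → HasDerivAt (fun r => y (-r)) (-z (-s)) s := fun s hs => by
      exact ((hyd (-s) (by linarith)).comp s (hasDerivAt_neg s)).congr_deriv (by ring)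
    have hd2 : HasDerivAt (fun s => -z (-s)) ((μ / r ^ 2 - k ^ 2) * y (-r) + H r) r := by
      refine ((hzd (-r) ⟨by linarith, by linarith⟩).comp r (hasDerivAt_neg r)).neg.congr_deriv ?_
      rw [neg_neg, neg_sq]
      ring
    have hev : ∀ᶠ s in 𝓝 r, HasDerivAt (fun r => y (-r)) (-z (-s)) s := by
      filter_upwards [lt_mem_nhds (show δ / 4 < r by linarith)] with s hs using hd s hs
    have hc : ∀ s, δ ≤ s → deriv χ s = 0 := fun s hs => by
      have : χ =ᶠ[𝓝[≥] s] fun _ => 1 := by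
        filter_upwards [self_mem_nhdsWithin] with t ht using hχ1 t (hs.trans ht)
      have h1 : HasDerivWithinAt χ (deriv χ s) (Set.Ici s) s :=
        (hχ.differentiable (by simp) s).hasDerivAt.hasDerivWithinAt
      have h2 : HasDerivWithinAt χ 0 (Set.Ici s) s :=
        (hasDerivWithinAt_const s _ (1 : ℝ)).congr_of_eventuallyEq this (hχ1 s hs)
      exact (uniqueDiffOn_Ici s s (Set.self_mem_Ici)).eq_deriv _ h1 h2
    have hc2 : deriv (deriv χ) r = 0 := by
      have : deriv χ =ᶠ[𝓝[≥] r] fun _ => 0 := by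
        filter_upwards [self_mem_nhdsWithin] with t ht using hc t (hr.trans ht)
      have h1 : HasDerivWithinAt (deriv χ) (deriv (deriv χ) r) (Set.Ici r) r :=
        ((((contDiff_infty_iff_deriv.1 hχ).2).differentiable
          (by simp)) r).hasDerivAt.hasDerivWithinAt
      have h2 : HasDerivWithinAt (deriv χ) 0 (Set.Ici r) r :=
        (hasDerivWithinAt_const r _ (0 : ℝ)).congr_of_eventuallyEq this (hc r hr)
      exact (uniqueDiffOn_Ici r r (Set.self_mem_Ici)).eq_deriv _ h1 h2
    rw [radialOp, deriv_deriv_mul hχ hev hd2, hc r hr, hc2, hχ1 r hr]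
    ring

theorem deriv_eq_zero_of_gt {b : ℝ} {F : ℝ → ℝ} (h0 : ∀ r, b < r → F r = 0) :
    ∀ r, b < r → deriv F r = 0 := fun r hr => by
  have : F =ᶠ[𝓝 r] fun _ => 0 := by
    filter_upwards [lt_mem_nhds hr] with s hs using h0 s hs
  rw [this.deriv_eq]; simp

/-- A smooth function which is `1` on `(-∞, 0]` and `0` on `[1, ∞)` and has bounded derivatives;
its translates are the cutoffs at infinity. -/
theorem exists_cutoff : ∃ (σ : ℝ → ℝ) (C : ℝ), ContDiff ℝ (⊤ : ℕ∞) σ ∧ (∀ s ≤ 0, σ s = 1) ∧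
    (∀ s, 1 ≤ s → σ s = 0) ∧ (∀ s, |deriv σ s| ≤ C) ∧ (∀ s, |deriv (deriv σ) s| ≤ C) ∧
    (∀ s < 0, deriv σ s = 0) ∧ (∀ s < 0, deriv (deriv σ) s = 0) := by
  set σ : ℝ → ℝ := fun s => Real.smoothTransition (1 - s) with hσdef
  have hσ : ContDiff ℝ (⊤ : ℕ∞) σ := Real.smoothTransition.contDiff.comp (by fun_prop)
  have h1 : ∀ s ≤ 0, σ s = 1 := fun s hs =>
    Real.smoothTransition.one_of_one_le (by linarith)
  have h0 : ∀ s, 1 ≤ s → σ s = 0 := fun s hs =>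
    Real.smoothTransition.zero_of_nonpos (by linarith)
  have hl : ∀ s < 0, deriv σ s = 0 := fun s hs => by
    have : σ =ᶠ[𝓝 s] fun _ => 1 := by
      filter_upwards [gt_mem_nhds hs] with t ht using h1 t (le_of_lt ht)
    rw [this.deriv_eq]; simp
  have hr : ∀ s, 1 < s → deriv σ s = 0 := deriv_eq_zero_of_gt fun s hs => h0 s (le_of_lt hs)
  have hd1 : ContDiff ℝ (⊤ : ℕ∞) (deriv σ) := (contDiff_infty_iff_deriv.1 hσ).2
  have hd2 : ContDiff ℝ (⊤ : ℕ∞) (deriv (deriv σ)) := (contDiff_infty_iff_deriv.1 hd1).2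
  have hl2 := deriv_eq_zero_of_lt hl
  have p1 := IsProfile.of_eq_zero (I := Set.univ) hd1 (Set.subset_univ _) hl hr
  have p2 := IsProfile.of_eq_zero (I := Set.univ) hd2 (Set.subset_univ _) hl2
    (deriv_eq_zero_of_gt hr)
  obtain ⟨C1, hC1⟩ := hd1.continuous.bounded_above_of_compact_support p1.compact
  obtain ⟨C2, hC2⟩ := hd2.continuous.bounded_above_of_compact_support p2.compact
  exact ⟨σ, max C1 C2, hσ, h1, h0, fun s => (hC1 s).trans (le_max_left _ _),
    fun s => (hC2 s).trans (le_max_right _ _), hl, hl2⟩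

/-- A solution of the radial equation with right-hand side `H`, vanishing to the left of the
support of `H` and cut off in `[ρ, ρ + 1]`. The error is bounded uniformly in `ρ`, as the energy
of the solution is. -/
theorem exists_profile_forward {k : ℝ} (hk : 0 < k) (μ : ℝ) {α : ℝ} (hα : 0 ≤ α) {H : ℝ → ℝ}
    (hH : IsProfile (Set.Ioi α) H) :
    ∃ C, ∀ᶠ ρ in atTop, ∃ B, IsProfile (Set.Ioi α) B ∧
      ∀ r, |radialOp k μ B r - H r| ≤ (Set.Icc ρ (ρ + 1)).indicator (fun _ => C) r := by
  obtain ⟨b, hαb, hHb⟩ := hH.exists_Ioo_of_Ioi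
  obtain ⟨a₁, b₁, ha₁, hab, hb₁, hl, hu⟩ := hHb.exists_Ioo hαb
  obtain ⟨a, hαa, haa⟩ := exists_between ha₁
  have ha0 : 0 < a := hα.trans_lt hαa
  obtain ⟨σ, Cσ, hσ, hσ1, hσ0, hσd, hσdd, hσdl, hσddl⟩ := exists_cutoff
  obtain ⟨C0, hC0⟩ := ((continuous_pow 2).mul hH.smooth.continuous).bounded_above_of_compact_support
    (hH.compact.mul_left (f := fun r : ℝ => r ^ 2))
  have hCσ : 0 ≤ Cσ := (abs_nonneg _).trans (hσd 0)
  set E := Real.exp ((|μ| / k + C0) / a) with hE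
  have hE0 : 0 < E := Real.exp_pos _
  refine ⟨Cσ * (1 + E / k ^ 2) + 2 * Cσ * (1 + E), ?_⟩
  filter_upwards [eventually_ge_atTop (max b₁ a₁)] with ρ hρ
  have hρ1 : b₁ ≤ ρ := (le_max_left _ _).trans hρ
  have hρ2 : a₁ ≤ ρ := (le_max_right _ _).trans hρ
  obtain ⟨y, z, hys, hy0, hz0, hyd, hzd⟩ := exists_smooth_ode_solution (a := a) (a' := a₁)
    (b := ρ + 2) haa (by linarith) (contDiff_mu_div_sq (k := k) (μ := μ) (Or.inl ha0))
    hH.smooth.contDiffOn (fun t ht => hl _ ht.2)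
  have hen := ode_energy_le ha0 haa hk (C := C0) (fun t ht => by
      have ht0 : 0 < t := ha0.trans ht.1
      rw [le_div_iff₀ (by positivity)]
      have := hC0 t
      simp only [Pi.mul_apply, Real.norm_eq_abs] at this
      rw [abs_mul, abs_of_nonneg (by positivity)] at this
      linarith) hy0 hz0 hyd hzd
  set χ : ℝ → ℝ := fun r => σ (r - ρ) with hχdef
  have hχ : ContDiff ℝ (⊤ : ℕ∞) χ := hσ.comp (by fun_prop)
  have hχd : deriv χ = fun r => deriv σ (r - ρ) := funext fun r => deriv_comp_sub_const σ ρ r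
  have hχdd : deriv (deriv χ) = fun r => deriv (deriv σ) (r - ρ) := by
    rw [hχd]; exact funext fun r => deriv_comp_sub_const (deriv σ) ρ r
  have hBs : ContDiff ℝ (⊤ : ℕ∞) (fun r => χ r * y r) := by
    rw [contDiff_iff_contDiffAt]
    intro r
    rcases lt_or_ge r (ρ + 2) with hr | hr
    · exact hχ.contDiffAt.mul (hys.contDiffAt (Iio_mem_nhds hr))
    · refine contDiffAt_const.congr_of_eventuallyEq (?_ : _ =ᶠ[𝓝 r] fun _ => (0 : ℝ))
      filter_upwards [lt_mem_nhds (show ρ + 1 < r by linarith)] with s hs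
      rw [show χ s = 0 from hσ0 _ (by linarith), zero_mul]
  have hBl : ∀ r < a₁, χ r * y r = 0 := fun r hr => by rw [hy0 r hr, mul_zero]
  have hBr : ∀ r, ρ + 1 < r → χ r * y r = 0 := fun r hr => by
    rw [show χ r = 0 from hσ0 _ (by linarith), zero_mul]
  refine ⟨fun r => χ r * y r, IsProfile.of_eq_zero hBs (a := a₁) (b := ρ + 1)
    (fun r hr => ha₁.trans_le hr.1) hBl hBr, fun r => ?_⟩
  rcases lt_or_ge r a₁ with hr | hr
  · rw [radialOp, deriv_eq_zero_of_lt (deriv_eq_zero_of_lt hBl) r hr, hBl r hr, hl r hr.le]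
    rw [Set.indicator_of_notMem (fun h => by linarith [h.1])]
    simp
  rcases lt_or_ge (ρ + 1) r with hr' | hr'
  · rw [radialOp, deriv_eq_zero_of_gt (deriv_eq_zero_of_gt hBr) r hr', hBr r hr',
      hu r (by linarith), Set.indicator_of_notMem (fun h => by linarith [h.2])]
    simp
  have hrI : r ∈ Set.Ioo a (ρ + 2) := ⟨by linarith, by linarith⟩
  have hop : radialOp k μ (fun r => χ r * y r) r - H r =
      deriv (deriv χ) r * y r + 2 * deriv χ r * z r + (χ r - 1) * H r := by
    rw [radialOp, deriv_deriv_mul hχ (eventually_hasDerivAt_of_lt hyd hrI.2) (hzd r hrI)]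
    ring
  rw [hop, hχdd, hχd]
  rcases lt_or_ge r ρ with hrρ | hrρ
  · rw [Set.indicator_of_notMem (fun h => by linarith [h.1])]
    simp only
    rw [hσdl _ (by linarith), hσddl _ (by linarith), show χ r = 1 from hσ1 _ (by linarith)]
    simp
  · rw [Set.indicator_of_mem (show r ∈ Set.Icc ρ (ρ + 1) from ⟨hrρ, hr'⟩), hu r (hρ1.trans hrρ),
      mul_zero, add_zero]
    have h := hen r hrI
    have hy2 : |y r| ≤ 1 + E / k ^ 2 := by
      have h1 : y r ^ 2 ≤ E / k ^ 2 := by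
        rw [le_div_iff₀ (by positivity)]
        nlinarith [sq_nonneg (z r)]
      nlinarith [sq_abs (y r), sq_nonneg (|y r| - 1)]
    have hz2 : |z r| ≤ 1 + E := by
      have h1 : z r ^ 2 ≤ E := by nlinarith [sq_nonneg (k * y r)]
      nlinarith [sq_abs (z r), sq_nonneg (|z r| - 1)]
    refine (abs_add_le _ _).trans (add_le_add ?_ ?_)
    · rw [abs_mul]
      exact mul_le_mul (hσdd _) hy2 (abs_nonneg _) hCσ
    · rw [abs_mul, abs_mul, abs_two]
      exact mul_le_mul (by linarith [hσd (r - ρ)]) hz2 (abs_nonneg _) (by positivity)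

/-! ### Moments of Helmholtz solutions -/

/-- The substitution `F = r ^ (-c / 2) B` removes the first-order term of the radial operator. -/
theorem radial_conjugation (k c : ℝ) {a : ℝ} (ha : 0 < a) {B : ℝ → ℝ}
    (hB : ContDiff ℝ (⊤ : ℕ∞) B) (h0 : ∀ r < a, B r = 0) (r : ℝ) :
    deriv (deriv fun r => r ^ (-c / 2) * B r) r +
        c / r * deriv (fun r => r ^ (-c / 2) * B r) r + k ^ 2 * (r ^ (-c / 2) * B r) =
      r ^ (-c / 2) * radialOp k (c * (c - 2) / 4) B r := by
  rcases lt_or_ge r a with hr | hr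
  · have hF0 : ∀ r < a, r ^ (-c / 2) * B r = 0 := fun r hr => by rw [h0 r hr, mul_zero]
    rw [radialOp, deriv_eq_zero_of_lt hF0 r hr,
      deriv_eq_zero_of_lt (deriv_eq_zero_of_lt hF0) r hr,
      deriv_eq_zero_of_lt (deriv_eq_zero_of_lt h0) r hr, h0 r hr]
    simp
  have hr0 : 0 < r := ha.trans_le hr
  have hB1 : ∀ s, HasDerivAt B (deriv B s) s := fun s =>
    (hB.differentiable (by simp) s).hasDerivAt
  have hB2 : HasDerivAt (deriv B) (deriv (deriv B) r) r :=
    ((((contDiff_infty_iff_deriv.1 hB).2).differentiable (by simp)) r).hasDerivAt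
  have hp : ∀ (p s : ℝ), 0 < s → HasDerivAt (fun r : ℝ => r ^ p) (p * s ^ (p - 1)) s :=
    fun p s hs => Real.hasDerivAt_rpow_const (Or.inl hs.ne')
  set s := -c / 2 with hs
  have hd : ∀ t, 0 < t → deriv (fun r => r ^ s * B r) t =
      s * t ^ (s - 1) * B t + t ^ s * deriv B t := fun t ht =>
    ((hp s t ht).fun_mul (hB1 t)).deriv
  have hd' : deriv (fun r => r ^ s * B r) =ᶠ[𝓝 r] fun t =>
      s * t ^ (s - 1) * B t + t ^ s * deriv B t := by
    filter_upwards [lt_mem_nhds hr0] with t ht using hd t ht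
  rw [hd'.deriv_eq, hd r hr0,
    ((((hp (s - 1) r hr0).const_mul s).fun_mul (hB1 r)).fun_add ((hp s r hr0).fun_mul hB2)).deriv]
  have e1 : r ^ (s - 1) = r ^ s / r := Real.rpow_sub_one hr0.ne' s
  have e2 : r ^ (s - 1 - 1) = r ^ s / r ^ 2 := by
    rw [Real.rpow_sub_one hr0.ne' (s - 1), e1]; field_simp
  rw [e1, e2, radialOp, show c = -2 * s by rw [hs]; ring]
  field_simp
  ring

theorem isTestFunction_pow_inner_mul_radial {I : Set ℝ} (hI : I ⊆ Set.Ioi 0) {F : ℝ → ℝ}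
    (hF : IsProfile I F) {D : Set (Space m)} (hID : ∀ x : Space m, ‖x‖ ∈ I → x ∈ D)
    (ξ : Space m) (l : ℕ) :
    IsTestFunction D (fun x : Space m => ((inner ℝ ξ x ^ l * F ‖x‖ : ℝ) : ℂ)) := by
  obtain ⟨a, ha, h0⟩ := (hF.mono hI).exists_pos le_rfl
  have hsub : tsupport (fun x : Space m => ((inner ℝ ξ x ^ l * F ‖x‖ : ℝ) : ℂ)) ⊆
      norm ⁻¹' (tsupport F) := by
    refine closure_minimal (fun x hx => ?_) ((isClosed_tsupport F).preimage continuous_norm)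
    refine subset_tsupport F fun h => hx ?_
    simp [h]
  obtain ⟨R, hR⟩ := hF.compact.isBounded.bddAbove
  refine ⟨?_, ?_, fun x hx => hID x (hF.support_subset (hsub hx))⟩
  · have h1 : ContDiff ℝ (⊤ : ℕ∞) (fun x : Space m => inner ℝ ξ x ^ l * F ‖x‖) :=
      ((innerSL ℝ ξ).contDiff.pow l).mul (contDiff_radial ha hF.smooth h0)
    exact Complex.ofRealCLM.contDiff.comp h1
  · refine (isCompact_closedBall (0 : Space m) R).of_isClosed_subset (isClosed_tsupport _) ?_
    intro x hx
    simpa using hR (hsub hx)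

theorem IsProfile.radialOp {k μ : ℝ} {I : Set ℝ} (hI : I ⊆ Set.Ioi 0) {B : ℝ → ℝ}
    (hB : IsProfile I B) : IsProfile I (radialOp k μ B) := by
  obtain ⟨a, ha, h0⟩ := (hB.mono hI).exists_pos le_rfl
  have hB1 := (contDiff_infty_iff_deriv.1 hB.smooth).2
  have hB2 := (contDiff_infty_iff_deriv.1 hB1).2
  have hz : ∀ r < a, OverlapHelmholtz.radialOp k μ B r = 0 := fun r hr => by
    rw [OverlapHelmholtz.radialOp, deriv_eq_zero_of_lt (deriv_eq_zero_of_lt h0) r hr, h0 r hr]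
    simp
  have hsub : tsupport (OverlapHelmholtz.radialOp k μ B) ⊆ tsupport B := by
    refine closure_minimal (fun r hr => ?_) (isClosed_tsupport B)
    by_contra hcon
    refine hr ?_
    have h2 : deriv (deriv B) r = 0 := by
      by_contra h
      exact hcon (tsupport_deriv_subset (tsupport_deriv_subset (subset_tsupport _ h)))
    rw [OverlapHelmholtz.radialOp, h2, image_eq_zero_of_notMem_tsupport hcon]
    simp
  refine ⟨contDiff_of_zero_lt ha hz fun r hr => ?_,
    hB.compact.of_isClosed_subset (isClosed_tsupport _) hsub, hsub.trans hB.support_subset⟩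
  exact hB2.contDiffAt.add ((contDiffAt_const.sub (contDiffAt_const.div
    (contDiffAt_id.pow 2 : ContDiffAt ℝ _ (fun r : ℝ => r ^ 2) r)
    (by positivity))).mul hB.smooth.contDiffAt)

theorem LocallyIntegrable.integrable_mul_testFunction {d : Space m → ℂ}
    (hd : LocallyIntegrable d) {D : Set (Space m)} {φ : Space m → ℂ} (hφ : IsTestFunction D φ) :
    Integrable (fun x => d x * φ x) := by
  simpa [mul_comm] using hd.integrable_smul_left_of_hasCompactSupport
    hφ.smooth.continuous hφ.compact

/-- For a solution `d` of the Helmholtz equation, all moments `∫ d(x) ⟪ξ, x⟫ ^ l F ‖x‖` vanish if,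
for each `l`, the linear functional of `F` given by the moment is zero whenever it is zero on the
range of the radial operator. Since `Δ ⟪ξ, x⟫ ^ l = l (l - 1) ‖ξ‖² ⟪ξ, x⟫ ^ (l - 2)`, induction on
`l` reduces the Helmholtz equation for `d` to the radial equation. -/
theorem moments_eq_zero {k : ℝ} {d : Space m → ℂ} (hloc : LocallyIntegrable d)
    {D : Set (Space m)} (hd : SolvesHelmholtz k (fun _ => 1) D d) {I : Set ℝ}
    (hI : I ⊆ Set.Ioi 0) (hID : ∀ x : Space m, ‖x‖ ∈ I → x ∈ D) (ξ : Space m)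
    (hrange : ∀ (l : ℕ) (F : ℝ → ℝ) (c : ℝ), c = m - 1 + 2 * l → IsProfile I F →
      (∀ B, IsProfile I B → ∫ x, d x * ((inner ℝ ξ x ^ l * (‖x‖ ^ (-c / 2) *
        radialOp k (c * (c - 2) / 4) B ‖x‖) : ℝ) : ℂ) = 0) →
      ∫ x, d x * ((inner ℝ ξ x ^ l * F ‖x‖ : ℝ) : ℂ) = 0) (l : ℕ) :
    ∀ F, IsProfile I F → ∫ x, d x * ((inner ℝ ξ x ^ l * F ‖x‖ : ℝ) : ℂ) = 0 := by
  induction l using Nat.strong_induction_on with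
  | _ l ih =>
  intro F hF
  set c : ℝ := m - 1 + 2 * l with hc
  refine hrange l F c rfl hF fun B hB => ?_
  obtain ⟨a, ha, h0⟩ := (hB.mono hI).exists_pos le_rfl
  have hG : IsProfile I (fun r => r ^ (-c / 2) * B r) := hB.rpow_mul le_rfl hI _
  have hG0 : ∀ r < a, r ^ (-c / 2) * B r = 0 := fun r hr => by rw [h0 r hr, mul_zero]
  have hφ := isTestFunction_pow_inner_mul_radial hI hG hID ξ l
  have hφ2 := isTestFunction_pow_inner_mul_radial hI hG hID ξ (l - 2)
  have hφ3 := isTestFunction_pow_inner_mul_radial hI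
    ((hB.radialOp (k := k) (μ := c * (c - 2) / 4) hI).rpow_mul le_rfl hI (-c / 2)) hID ξ l
  have key := hd _ hφ
  have e : ∀ x : Space m, d x * (Laplacian.laplacian
      (fun x : Space m => ((inner ℝ ξ x ^ l * (‖x‖ ^ (-c / 2) * B ‖x‖) : ℝ) : ℂ)) x +
        ((k ^ 2 * (1 : ℝ) ^ 2 : ℝ) : ℂ) *
          ((inner ℝ ξ x ^ l * (‖x‖ ^ (-c / 2) * B ‖x‖) : ℝ) : ℂ)) =
      ((l * (l - 1 : ℕ) * ‖ξ‖ ^ 2 : ℝ) : ℂ) *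
        (d x * ((inner ℝ ξ x ^ (l - 2) * (‖x‖ ^ (-c / 2) * B ‖x‖) : ℝ) : ℂ)) +
      d x * ((inner ℝ ξ x ^ l * (‖x‖ ^ (-c / 2) *
        radialOp k (c * (c - 2) / 4) B ‖x‖) : ℝ) : ℂ) := by
    intro x
    rw [laplacian_pow_inner_mul_radial ha hG.smooth hG0, ← radial_conjugation k c ha hB.smooth h0,
      ← hc]
    push_cast
    ring
  have hsupp : ∀ x, x ∉ D → d x * (Laplacian.laplacian
      (fun x : Space m => ((inner ℝ ξ x ^ l * (‖x‖ ^ (-c / 2) * B ‖x‖) : ℝ) : ℂ)) x +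
        ((k ^ 2 * (1 : ℝ) ^ 2 : ℝ) : ℂ) *
          ((inner ℝ ξ x ^ l * (‖x‖ ^ (-c / 2) * B ‖x‖) : ℝ) : ℂ)) = 0 := fun x hx => by
    rw [hφ.laplacian.eq_zero hx, hφ.eq_zero hx]
    simp
  rw [setIntegral_eq_integral_of_forall_compl_eq_zero hsupp] at key
  simp only [e] at key
  rw [integral_add ((LocallyIntegrable.integrable_mul_testFunction hloc hφ2).const_mul _)
    (LocallyIntegrable.integrable_mul_testFunction hloc hφ3), integral_const_mul] at key
  rcases lt_or_ge l 2 with hl | hl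
  -- for `l < 2` the power of the linear form is harmonic
  · have : (l : ℝ) * (l - 1 : ℕ) = 0 := by interval_cases l <;> simp
    rw [this] at key
    simpa using key
  · rw [ih (l - 2) (by omega) _ hG] at key
    simpa using key

/-! ### Vanishing moments, Rellich's lemma and unique continuation -/

/-- A cutoff which is one in a whole neighborhood of `K`, so that its derivatives vanish there. -/
theorem exists_smooth_cutoff {E : Type*} [NormedAddCommGroup E] [NormedSpace ℝ E]
    [FiniteDimensional ℝ E] {K U : Set E} (hK : IsCompact K) (hU : IsOpen U) (hKU : K ⊆ U) :
    ∃ χ : E → ℝ, ContDiff ℝ (⊤ : ℕ∞) χ ∧ HasCompactSupport χ ∧ tsupport χ ⊆ U ∧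
      (∀ᶠ x in 𝓝ˢ K, χ x = 1) := by
  obtain ⟨L, hL, hKL, hLU⟩ := exists_compact_between hK hU hKU
  obtain ⟨f, h1, h0, -⟩ := exists_contMDiffMap_one_nhds_of_subset_interior
    (n := (⊤ : ℕ∞)) (modelWithCornersSelf ℝ E) hK.isClosed hKL
  have hsub : tsupport f ⊆ L := by
    refine closure_minimal (fun x hx => ?_) hL.isClosed
    by_contra h
    exact hx (h0 x h)
  exact ⟨f, f.contMDiff.contDiff, hL.of_isClosed_subset (isClosed_tsupport _) hsub,
    hsub.trans hLU, h1⟩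

open FourierTransform in
/-- An integrable function of compact support whose moments `∫ f ⟪ξ, x⟫ ^ l` all vanish has
vanishing Fourier transform, hence is orthogonal to all test functions. -/
theorem integral_mul_eq_zero_of_moments {f : Space m → ℂ} (hf : Integrable f) {R : ℝ}
    (hR : ∀ x, R < ‖x‖ → f x = 0)
    (h : ∀ (ξ : Space m) (l : ℕ), ∫ x, f x * ((inner ℝ ξ x ^ l : ℝ) : ℂ) = 0)
    {g : Space m → ℂ} (hg : ContDiff ℝ (⊤ : ℕ∞) g) (hgc : HasCompactSupport g) :
    ∫ x, f x * g x = 0 := by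
  have hR' : ∀ x, f x ≠ 0 → ‖x‖ ≤ R := fun x hx => by
    by_contra hcon; exact hx (hR x (not_le.1 hcon))
  -- the exponential series may be integrated termwise, since `f` has compact support
  have hFour : ∀ ξ, 𝓕 f ξ = 0 := by
    intro ξ
    rw [Real.fourier_eq']
    set F : ℕ → Space m → ℂ := fun l v =>
      (((-2 * Real.pi : ℝ) : ℂ) * Complex.I) ^ l / (l.factorial : ℂ) *
        (f v * ((inner ℝ ξ v ^ l : ℝ) : ℂ)) with hF
    have hint : ∀ l, Integrable (fun v => f v * ((inner ℝ ξ v ^ l : ℝ) : ℂ)) := by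
      intro l
      refine Integrable.mono' (hf.norm.mul_const ((‖ξ‖ * R) ^ l)) (hf.aestronglyMeasurable.mul
        (by fun_prop : Continuous fun v : Space m =>
          ((inner ℝ ξ v ^ l : ℝ) : ℂ)).aestronglyMeasurable) (Eventually.of_forall fun v => ?_)
      rw [norm_mul]
      by_cases hv : f v = 0
      · simp [hv]
      · refine mul_le_mul_of_nonneg_left ?_ (norm_nonneg _)
        rw [Complex.norm_real, norm_pow]
        refine pow_le_pow_left₀ (norm_nonneg _) ((norm_inner_le_norm ξ v).trans ?_) _
        exact mul_le_mul_of_nonneg_left (hR' v hv) (norm_nonneg _)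
    have hFint : ∀ l, Integrable (F l) := fun l => (hint l).const_mul _
    have hFnorm : ∀ l v, ‖F l v‖ ≤ (2 * Real.pi * (‖ξ‖ * |R|)) ^ l / l.factorial * ‖f v‖ := by
      intro l v
      by_cases hv : f v = 0
      · simp [hF, hv]
      have h1 : |inner ℝ ξ v| ≤ ‖ξ‖ * |R| := (abs_real_inner_le_norm ξ v).trans
        (mul_le_mul_of_nonneg_left ((hR' v hv).trans (le_abs_self R)) (norm_nonneg _))
      have e : ‖F l v‖ = (2 * Real.pi * |inner ℝ ξ v|) ^ l / l.factorial * ‖f v‖ := by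
        simp only [hF, norm_mul, norm_div, norm_pow, Complex.norm_real, Complex.norm_I,
          Complex.norm_natCast, Real.norm_eq_abs, abs_neg, abs_two, abs_of_pos Real.pi_pos]
        ring
      rw [e]
      have := Real.pi_pos
      gcongr
    have hsum : Summable fun l => ∫ v, ‖F l v‖ := by
      refine Summable.of_nonneg_of_le (fun l => integral_nonneg fun v => norm_nonneg _)
        (fun l => integral_mono (hFint l).norm (hf.norm.const_mul _) (hFnorm l)) ?_
      simp only [integral_const_mul]
      exact (Real.summable_pow_div_factorial _).mul_right _
    have key := hasSum_integral_of_summable_integral_norm hFint hsum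
    have hz : ∀ l, ∫ v, F l v = 0 := fun l => by
      simp only [hF]
      rw [integral_const_mul, h ξ l, mul_zero]
    simp only [hz] at key
    rw [← key.unique hasSum_zero]
    refine integral_congr_ae (Eventually.of_forall fun v => ?_)
    simp only [hF]
    have hexp := (NormedSpace.expSeries_div_hasSum_exp
      (((-2 * Real.pi * inner ℝ v ξ : ℝ) : ℂ) * Complex.I)).mul_right (f v)
    rw [← Complex.exp_eq_exp_ℂ] at hexp
    rw [smul_eq_mul, ← hexp.tsum_eq]
    refine tsum_congr fun l => ?_
    rw [real_inner_comm]
    push_cast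
    ring
  -- duality of the Fourier transform, with `g` the transform of a Schwartz function
  set ψ : SchwartzMap (Space m) ℂ := hgc.toSchwartzMap hg with hψ
  have h1 : ∫ ξ, (𝓕 f ξ) • (𝓕⁻ ψ) ξ = ∫ x, f x • (𝓕 (𝓕⁻ ψ : SchwartzMap (Space m) ℂ)) x := by
    simpa only [flip_innerₗ] using!
      (VectorFourier.integral_fourierIntegral_smul_eq_flip (L := innerₗ (Space m))
      Real.continuous_fourierChar continuous_inner hf
      ((𝓕⁻ ψ : SchwartzMap (Space m) ℂ).integrable (μ := volume)))
  rw [FourierTransform.fourier_fourierInv_eq] at h1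
  simp only [hFour, zero_smul, integral_zero] at h1
  exact h1.symm

/-- A cutoff `χ ‖x‖` turns the moments with radial weights into plain moments of the compactly
supported function `d(x) χ ‖x‖`. -/
theorem ae_eq_zero_of_moments {d : Space m → ℂ} (hloc : LocallyIntegrable d) {I : Set ℝ}
    (hIo : IsOpen I) (hI : I ⊆ Set.Ioi 0)
    (h : ∀ (ξ : Space m) (l : ℕ) (F : ℝ → ℝ), IsProfile I F →
      ∫ x, d x * ((inner ℝ ξ x ^ l * F ‖x‖ : ℝ) : ℂ) = 0) :
    ∀ᵐ x : Space m, ‖x‖ ∈ I → d x = 0 := by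
  refine (hIo.preimage continuous_norm).ae_eq_zero_of_integral_contDiff_smul_eq_zero
    (hloc.locallyIntegrableOn _) fun g hg hgc hgs => ?_
  obtain ⟨χ, hχ, hχc, hχs, hχ1⟩ := exists_smooth_cutoff (hgc.image continuous_norm) hIo
    (Set.image_subset_iff.2 hgs)
  have hP : IsProfile I χ := ⟨hχ, hχc, hχs⟩
  obtain ⟨R, hR⟩ := hχc.isBounded.bddAbove
  have hint : Integrable fun x => d x * ((χ ‖x‖ : ℝ) : ℂ) := by
    have := LocallyIntegrable.integrable_mul_testFunction hloc
      (isTestFunction_pow_inner_mul_radial hI hP (D := Set.univ) (fun _ _ => trivial) 0 0)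
    simpa using this
  have key := integral_mul_eq_zero_of_moments hint (R := R) (fun x hx => by
      have : χ ‖x‖ = 0 := image_eq_zero_of_notMem_tsupport fun hcon => by
        linarith [hR hcon]
      simp [this]) (fun ξ l => by
      rw [← h ξ l χ hP]
      congr 1
      ext x
      push_cast
      ring) (g := fun x => ((g x : ℝ) : ℂ)) (Complex.ofRealCLM.contDiff.comp hg)
      (hgc.comp_left (g := fun r : ℝ => (r : ℂ)) Complex.ofReal_zero)
  rw [← key]
  refine integral_congr_ae (Eventually.of_forall fun x => ?_)
  by_cases hx : x ∈ tsupport g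
  · have : χ ‖x‖ = 1 := hχ1.self_of_nhdsSet _ ⟨x, hx, rfl⟩
    simp [this, mul_comm]
  · simp [image_eq_zero_of_notMem_tsupport hx]

/-- A solution of the Helmholtz equation in a ball which vanishes near the center vanishes. -/
theorem ae_eq_zero_of_helmholtz_ball_zero {k : ℝ} {d : Space m → ℂ} (hloc : LocallyIntegrable d)
    {δ ρ : ℝ} (hδ : 0 < δ) (hρ : 0 < ρ)
    (hd : SolvesHelmholtz k (fun _ => 1) (Metric.ball 0 ρ) d)
    (h0 : ∀ᵐ x, ‖x‖ < δ → d x = 0) : ∀ᵐ x, ‖x‖ < ρ → d x = 0 := by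
  have hI : Set.Ioo 0 ρ ⊆ Set.Ioi (0 : ℝ) := fun r hr => hr.1
  have key := ae_eq_zero_of_moments hloc isOpen_Ioo hI fun ξ l =>
    moments_eq_zero hloc hd hI (fun x hx => by simpa using hx.2) ξ
    (fun l F c _ hF hB => by
      -- the radial equation holds for `r ≥ δ`, and `d` vanishes where it fails
      obtain ⟨B, hBp, hBe⟩ := exists_profile_backward k (c * (c - 2) / 4) hδ hρ
        (hF.rpow_mul le_rfl hI (c / 2))
      rw [← hB B hBp]
      refine integral_congr_ae ?_
      filter_upwards [h0] with x hx
      rcases lt_or_ge ‖x‖ δ with hxδ | hxδ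
      · simp [hx hxδ]
      · rw [hBe _ hxδ, ← mul_assoc (‖x‖ ^ (-c / 2)), ← Real.rpow_add (hδ.trans_le hxδ)]
        ring_nf
        simp) l
  filter_upwards [h0, key] with x hx hx' hxρ
  rcases lt_or_ge ‖x‖ δ with hxδ | hxδ
  · exact hx hxδ
  · exact hx' ⟨hδ.trans_le hxδ, hxρ⟩

/-- **Rellich's lemma**: a solution of the Helmholtz equation in the exterior of a ball, whose
averages over large spherical shells are `o(r ^ (-(m - 1) / 2))`, vanishes. -/
theorem ae_eq_zero_of_helmholtz_exterior {k : ℝ} (hk : 0 < k) (hm : 1 ≤ m) {d : Space m → ℂ}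
    (hloc : LocallyIntegrable d) {R : ℝ} (hR : 0 ≤ R)
    (hd : SolvesHelmholtz k (fun _ => 1) {x | R < ‖x‖} d)
    (hdecay : Tendsto (fun ρ : ℝ => ρ ^ (-((m : ℝ) - 1) / 2) *
      ∫ x in {x : Space m | ‖x‖ ∈ Set.Icc ρ (ρ + 1)}, ‖d x‖) atTop (𝓝 0)) :
    ∀ᵐ x, R < ‖x‖ → d x = 0 := by
  have hI : Set.Ioi R ⊆ Set.Ioi (0 : ℝ) := fun r hr => hR.trans_lt hr
  refine ae_eq_zero_of_moments hloc isOpen_Ioi hI fun ξ l =>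
    moments_eq_zero hloc hd hI (fun x hx => hx) ξ (fun l F c hc hF hB => ?_) l
  obtain ⟨C, hC⟩ := exists_profile_forward hk (c * (c - 2) / 4) hR
    (hF.rpow_mul hR subset_rfl (c / 2))
  have hbound : ∀ᶠ ρ : ℝ in atTop, ‖∫ x, d x * ((inner ℝ ξ x ^ l * F ‖x‖ : ℝ) : ℂ)‖ ≤
      (‖ξ‖ ^ l * C) * (ρ ^ (-((m : ℝ) - 1) / 2) *
      ∫ x in {x : Space m | ‖x‖ ∈ Set.Icc ρ (ρ + 1)}, ‖d x‖) := by
    filter_upwards [hC, eventually_gt_atTop 0] with ρ ⟨B, hBp, hBe⟩ hρ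
    have hC0 : 0 ≤ C := by
      have := (abs_nonneg _).trans (hBe ρ)
      rwa [Set.indicator_of_mem (by constructor <;> linarith)] at this
    set S : Set (Space m) := {x : Space m | ‖x‖ ∈ Set.Icc ρ (ρ + 1)} with hS
    have hSm : MeasurableSet S := measurable_norm measurableSet_Icc
    have hSi : IntegrableOn (fun x => ‖d x‖) S := by
      refine ((hloc.integrableOn_isCompact (isCompact_closedBall (0 : Space m) (ρ + 1))).mono_set
        fun x hx => ?_).norm
      simpa using hx.2
    have e1 : ∫ x, d x * ((inner ℝ ξ x ^ l * F ‖x‖ : ℝ) : ℂ) =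
        ∫ x, (d x * ((inner ℝ ξ x ^ l * F ‖x‖ : ℝ) : ℂ) - d x * ((inner ℝ ξ x ^ l *
          (‖x‖ ^ (-c / 2) * radialOp k (c * (c - 2) / 4) B ‖x‖) : ℝ) : ℂ)) := by
      rw [integral_sub (LocallyIntegrable.integrable_mul_testFunction hloc
          (isTestFunction_pow_inner_mul_radial hI hF (D := Set.univ) (fun _ _ => trivial) ξ l))
        (LocallyIntegrable.integrable_mul_testFunction hloc
          (isTestFunction_pow_inner_mul_radial hI ((hBp.radialOp hI).rpow_mul hR subset_rfl _)
          (D := Set.univ) (fun _ _ => trivial) ξ l)), hB B hBp, sub_zero]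
    rw [e1, ← mul_assoc, ← integral_const_mul, ← integral_indicator hSm]
    refine norm_integral_le_of_norm_le ((integrable_indicator_iff hSm).2 (hSi.const_mul _))
      (Eventually.of_forall fun x => ?_)
    rcases lt_or_ge R ‖x‖ with hx | hx
    swap
    · have h1 : F ‖x‖ = 0 := image_eq_zero_of_notMem_tsupport fun h =>
        absurd (hF.support_subset h) (not_lt.2 hx)
      have h2 : radialOp k (c * (c - 2) / 4) B ‖x‖ = 0 :=
        image_eq_zero_of_notMem_tsupport fun h =>
          absurd ((hBp.radialOp hI).support_subset h) (not_lt.2 hx)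
      rw [h1, h2]
      simp only [mul_zero, Complex.ofReal_zero, sub_zero, norm_zero]
      exact Set.indicator_nonneg (fun y _ => by positivity) x
    have hx0 : 0 < ‖x‖ := hR.trans_lt hx
    have e2 : d x * ((inner ℝ ξ x ^ l * F ‖x‖ : ℝ) : ℂ) - d x * ((inner ℝ ξ x ^ l *
          (‖x‖ ^ (-c / 2) * radialOp k (c * (c - 2) / 4) B ‖x‖) : ℝ) : ℂ) =
        -(d x * ((inner ℝ ξ x ^ l * ‖x‖ ^ (-c / 2) *
          (radialOp k (c * (c - 2) / 4) B ‖x‖ - ‖x‖ ^ (c / 2) * F ‖x‖) : ℝ) : ℂ)) := by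
      have : ‖x‖ ^ (-c / 2) * ‖x‖ ^ (c / 2) = 1 := by
        rw [← Real.rpow_add hx0]; ring_nf; simp
      have h2 : ((‖x‖ ^ (-c / 2) : ℝ) : ℂ) * ((‖x‖ ^ (c / 2) : ℝ) : ℂ) = 1 := by
        exact_mod_cast this
      push_cast
      linear_combination (-(d x * (inner ℝ ξ x : ℂ) ^ l * F ‖x‖)) * h2
    have hbe := hBe ‖x‖
    rw [e2, norm_neg, norm_mul, Complex.norm_real, norm_mul, norm_mul, norm_pow]
    simp only [Real.norm_eq_abs]
    by_cases hxS : x ∈ S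
    · rw [Set.indicator_of_mem hxS]
      rw [Set.indicator_of_mem (show ‖x‖ ∈ Set.Icc ρ (ρ + 1) from hxS)] at hbe
      have h1 : |inner ℝ ξ x| ^ l ≤ ‖ξ‖ ^ l * ‖x‖ ^ l := by
        rw [← mul_pow]
        exact pow_le_pow_left₀ (abs_nonneg _) (abs_real_inner_le_norm ξ x) l
      -- as `c = m - 1 + 2 l`, the weight on the shell does not depend on `l`
      have h2 : ‖x‖ ^ l * |‖x‖ ^ (-c / 2)| ≤ ρ ^ (-((m : ℝ) - 1) / 2) := by
        rw [abs_of_pos (Real.rpow_pos_of_pos hx0 _), ← Real.rpow_natCast, ← Real.rpow_add hx0,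
          show (l : ℝ) + -c / 2 = -((m : ℝ) - 1) / 2 by rw [hc]; ring]
        refine Real.rpow_le_rpow_of_nonpos hρ hxS.1 ?_
        have : (1 : ℝ) ≤ m := by exact_mod_cast hm
        linarith
      calc ‖d x‖ * (|inner ℝ ξ x| ^ l * |‖x‖ ^ (-c / 2)| *
            |radialOp k (c * (c - 2) / 4) B ‖x‖ - ‖x‖ ^ (c / 2) * F ‖x‖|)
          ≤ ‖d x‖ * (‖ξ‖ ^ l * ‖x‖ ^ l * |‖x‖ ^ (-c / 2)| * C) := by gcongr
        _ = ‖d x‖ * (‖ξ‖ ^ l * C) * (‖x‖ ^ l * |‖x‖ ^ (-c / 2)|) := by ring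
        _ ≤ ‖d x‖ * (‖ξ‖ ^ l * C) * ρ ^ (-((m : ℝ) - 1) / 2) := by gcongr
        _ = _ := by ring
    · rw [Set.indicator_of_notMem hxS]
      rw [Set.indicator_of_notMem (show ‖x‖ ∉ Set.Icc ρ (ρ + 1) from hxS)] at hbe
      rw [le_antisymm hbe (abs_nonneg _)]
      simp
  -- the left-hand side of the bound does not depend on `ρ`
  have hlim := hdecay.const_mul (‖ξ‖ ^ l * C)
  rw [mul_zero] at hlim
  exact norm_le_zero_iff.1 (ge_of_tendsto hlim hbound)

/-! ### Weak gradients -/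

theorem memLp_union {D D' : Set (Space m)} {u : Space m → ℂ}
    (h : MemLp u 2 (volume.restrict D)) (h' : MemLp u 2 (volume.restrict D')) :
    MemLp u 2 (volume.restrict (D ∪ D')) := by
  have hm : AEStronglyMeasurable u (volume.restrict (D ∪ D')) :=
    aestronglyMeasurable_union_iff.2 ⟨h.1, h'.1⟩
  refine ⟨hm, ?_⟩
  have h1 := lintegral_rpow_enorm_lt_top_of_eLpNorm_lt_top (by norm_num) (by norm_num) h.2
  have h2 := lintegral_rpow_enorm_lt_top_of_eLpNorm_lt_top (by norm_num) (by norm_num) h'.2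
  refine (eLpNorm_lt_top_iff_lintegral_rpow_enorm_lt_top (by norm_num) (by norm_num)).2 ?_
  exact (lintegral_union_le _ _ _).trans_lt (ENNReal.add_lt_top.2 ⟨h1, h2⟩)

theorem IsTestFunction.exists_ball {D : Set (Space m)} {φ : Space m → ℂ}
    (hφ : IsTestFunction D φ) : ∃ R : ℝ, IsTestFunction (D ∩ Metric.ball 0 R) φ := by
  obtain ⟨R, hR⟩ := hφ.compact.isBounded.subset_ball (0 : Space m)
  exact ⟨R, hφ.smooth, hφ.compact, fun x hx => ⟨hφ.support_subset hx, hR hx⟩⟩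

/-- A test function on a union of two open sets is the sum of a test function on each of them. -/
theorem IsTestFunction.exists_add {D D' : Set (Space m)} (hD : IsOpen D) (hD' : IsOpen D')
    {φ : Space m → ℂ} (hφ : IsTestFunction (D ∪ D') φ) :
    ∃ φ₁ φ₂, IsTestFunction D φ₁ ∧ IsTestFunction D' φ₂ ∧ φ = fun x => φ₁ x + φ₂ x := by
  have hK : IsCompact (tsupport φ \ D') := IsCompact.diff hφ.compact hD'
  obtain ⟨χ, hχ, -, hχs, hχ1⟩ := exists_smooth_cutoff hK hD fun x hx =>
    (hφ.support_subset hx.1).resolve_right hx.2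
  have hχC : ContDiff ℝ (⊤ : ℕ∞) (fun x => ((χ x : ℝ) : ℂ)) := Complex.ofRealCLM.contDiff.comp hχ
  have hs : tsupport (fun x => ((χ x : ℝ) : ℂ)) ⊆ tsupport χ :=
    closure_mono fun x hx h => hx (by simp [h])
  refine ⟨fun x => (χ x : ℂ) * φ x, fun x => (1 - (χ x : ℂ)) * φ x,
    (hφ.smooth_mul hχC).mono fun x hx => hχs (hs hx.2), ?_, funext fun x => by ring⟩
  have h1 := (hφ.smooth_mul ((contDiff_const (c := (1 : ℂ))).sub hχC))
  refine ⟨h1.smooth, h1.compact, fun x hx => ?_⟩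
  by_contra hxD'
  have hxφ : x ∈ tsupport φ := tsupport_mul_subset_right hx
  refine notMem_tsupport_iff_eventuallyEq.2 ?_ hx
  filter_upwards [(eventually_nhdsSet_iff_forall.1 hχ1) x ⟨hxφ, hxD'⟩] with y hy
  simp [hy]

/-- Test functions on `D` vanish off `D`, so the integrals in the definition of the weak gradient
may be taken over the whole space. -/
theorem hasWeakGradient_iff_integral {D : Set (Space m)} {u : Space m → ℂ}
    {G : Fin m → Space m → ℂ} (hu : MemLp u 2 (volume.restrict D))
    (hG : ∀ i, MemLp (G i) 2 (volume.restrict D)) :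
    HasWeakGradient D u G ↔ ∀ φ, IsTestFunction D φ → ∀ i,
      ∫ x, u x * partialDeriv i φ x = - ∫ x, G i x * φ x := by
  constructor
  · intro h φ hφ i
    rw [← (hφ.partialDeriv i).setIntegral_eq, ← hφ.setIntegral_eq]
    exact h.integral_eq φ hφ i
  · intro h
    refine ⟨hu, hG, fun φ hφ i => ?_⟩
    rw [(hφ.partialDeriv i).setIntegral_eq, hφ.setIntegral_eq]
    exact h φ hφ i

namespace HasWeakGradient

variable {D D' : Set (Space m)} {u v : Space m → ℂ} {G G' : Fin m → Space m → ℂ}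

theorem integral_eq' (h : HasWeakGradient D u G) {φ : Space m → ℂ} (hφ : IsTestFunction D φ)
    (i : Fin m) : ∫ x, u x * OverlapHelmholtz.partialDeriv i φ x = - ∫ x, G i x * φ x :=
  (hasWeakGradient_iff_integral h.memLp h.memLp_grad).1 h φ hφ i

theorem mono (h : HasWeakGradient D u G) (hD : D' ⊆ D) : HasWeakGradient D' u G :=
  (hasWeakGradient_iff_integral (h.memLp.mono_measure (Measure.restrict_mono hD le_rfl))
    fun i => (h.memLp_grad i).mono_measure (Measure.restrict_mono hD le_rfl)).2
    fun _ hφ i => h.integral_eq' (hφ.mono hD) i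

theorem congr (h : HasWeakGradient D u G) (huv : u =ᵐ[volume.restrict D] v) :
    HasWeakGradient D v G := by
  refine ⟨(memLp_congr_ae huv).1 h.memLp, h.memLp_grad, fun φ hφ i => ?_⟩
  rw [← h.integral_eq φ hφ i]
  refine integral_congr_ae ?_
  filter_upwards [huv] with x hx
  rw [hx]

theorem congr_grad (h : HasWeakGradient D u G)
    (hG : ∀ i, G i =ᵐ[volume.restrict D] G' i) : HasWeakGradient D u G' := by
  refine ⟨h.memLp, fun i => (memLp_congr_ae (hG i)).1 (h.memLp_grad i), fun φ hφ i => ?_⟩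
  rw [h.integral_eq φ hφ i]
  refine congrArg _ (integral_congr_ae ?_)
  filter_upwards [hG i] with x hx
  rw [hx]

theorem sub (h : HasWeakGradient D u G) (h' : HasWeakGradient D v G') :
    HasWeakGradient D (u - v) (fun i => G i - G' i) := by
  refine (hasWeakGradient_iff_integral (h.memLp.sub h'.memLp)
    fun i => (h.memLp_grad i).sub (h'.memLp_grad i)).2 fun φ hφ i => ?_
  simp only [Pi.sub_apply, sub_mul]
  rw [integral_sub ((hφ.partialDeriv i).integrable_mul h.memLp)
    ((hφ.partialDeriv i).integrable_mul h'.memLp), integral_sub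
    (hφ.integrable_mul (h.memLp_grad i)) (hφ.integrable_mul (h'.memLp_grad i)),
    h.integral_eq' hφ, h'.integral_eq' hφ]
  ring

theorem add (h : HasWeakGradient D u G) (h' : HasWeakGradient D v G') :
    HasWeakGradient D (u + v) (fun i => G i + G' i) := by
  refine (hasWeakGradient_iff_integral (h.memLp.add h'.memLp)
    fun i => (h.memLp_grad i).add (h'.memLp_grad i)).2 fun φ hφ i => ?_
  simp only [Pi.add_apply, add_mul]
  rw [integral_add ((hφ.partialDeriv i).integrable_mul h.memLp)
    ((hφ.partialDeriv i).integrable_mul h'.memLp), integral_add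
    (hφ.integrable_mul (h.memLp_grad i)) (hφ.integrable_mul (h'.memLp_grad i)),
    h.integral_eq' hφ, h'.integral_eq' hφ]
  ring

/-- Weak gradients are unique up to null sets. -/
theorem ae_eq (h : HasWeakGradient D u G) (h' : HasWeakGradient D u G') (hD : IsOpen D)
    (i : Fin m) : G i =ᵐ[volume.restrict D] G' i := by
  have hl : LocallyIntegrableOn (fun x => G i x - G' i x) D := by
    rw [locallyIntegrableOn_iff hD.isLocallyClosed]
    intro K hKD hK
    have hsub := ((h.memLp_grad i).sub (h'.memLp_grad i)).mono_measure
      (Measure.restrict_mono hKD le_rfl)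
    have : IsFiniteMeasure (volume.restrict K) := ⟨by simpa using hK.measure_lt_top⟩
    exact hsub.integrable (by norm_num)
  have key := hD.ae_eq_zero_of_integral_contDiff_smul_eq_zero hl fun g hg hgc hgs => by
    have hφ : IsTestFunction D (fun x => ((g x : ℝ) : ℂ)) :=
      ⟨Complex.ofRealCLM.contDiff.comp hg, hgc.comp_left (g := fun r : ℝ => (r : ℂ)) (by simp),
        (closure_mono (fun x hx h => hx (by simp [h]) : Function.support (fun x => ((g x : ℝ) : ℂ)) ⊆
          Function.support g)).trans hgs⟩
    have e : ∫ x, g x • (G i x - G' i x) =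
        (∫ x, G i x * ((g x : ℝ) : ℂ)) - ∫ x, G' i x * ((g x : ℝ) : ℂ) := by
      refine Eq.trans ?_ (integral_sub (hφ.integrable_mul (h.memLp_grad i))
        (hφ.integrable_mul (h'.memLp_grad i)))
      refine integral_congr_ae (Eventually.of_forall fun x => ?_)
      simp only [Complex.real_smul]
      ring
    rw [e]
    have e1 := h.integral_eq' hφ i
    have e2 := h'.integral_eq' hφ i
    linear_combination e1 - e2
  rw [Filter.EventuallyEq, ae_restrict_iff' hD.measurableSet]
  filter_upwards [key] with x hx hxD
  exact sub_eq_zero.1 (hx hxD)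

theorem conj (h : HasWeakGradient D u G) :
    HasWeakGradient D (fun x => (starRingEnd ℂ) (u x)) (fun i x => (starRingEnd ℂ) (G i x)) := by
  refine (hasWeakGradient_iff_integral h.memLp.star fun i => (h.memLp_grad i).star).2
    fun φ hφ i => ?_
  have key := congrArg (starRingEnd ℂ) (h.integral_eq' hφ.conj i)
  rw [map_neg, ← integral_conj, ← integral_conj] at key
  simpa [partialDeriv_conj (hφ.differentiableAt _)] using! key

/-- Weak gradients on two open sets glue to a weak gradient on their union. -/
theorem union (hD : IsOpen D) (hD' : IsOpen D') (h : HasWeakGradient D u G)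
    (h' : HasWeakGradient D' u G') : MemH1 (D ∪ D') u := by
  classical
  set F : Fin m → Space m → ℂ := fun i => D.piecewise (G i) (G' i) with hF
  have h1 : ∀ i, F i =ᵐ[volume.restrict D] G i := fun i => piecewise_ae_eq_restrict hD.measurableSet
  have hint := fun i => (h.mono Set.inter_subset_left).ae_eq
    (h'.mono (Set.inter_subset_right : D ∩ D' ⊆ D')) (hD.inter hD') i
  have h2 : ∀ i, F i =ᵐ[volume.restrict D'] G' i := fun i => by
    have := hint i
    rw [Filter.EventuallyEq, ae_restrict_iff' (hD.inter hD').measurableSet] at this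
    rw [Filter.EventuallyEq, ae_restrict_iff' hD'.measurableSet]
    filter_upwards [this] with x hx hxD'
    by_cases hxD : x ∈ D
    · rw [hF]; simp only [Set.piecewise_eq_of_mem _ _ _ hxD]; exact hx ⟨hxD, hxD'⟩
    · rw [hF]; simp only [Set.piecewise_eq_of_notMem _ _ _ hxD]
  have k := h.congr_grad fun i => (h1 i).symm
  have k' := h'.congr_grad fun i => (h2 i).symm
  refine ⟨F, (hasWeakGradient_iff_integral (memLp_union k.memLp k'.memLp)
    fun i => memLp_union (k.memLp_grad i) (k'.memLp_grad i)).2 fun φ hφ i => ?_⟩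
  obtain ⟨φ₁, φ₂, hφ₁, hφ₂, rfl⟩ := hφ.exists_add hD hD'
  have e : ∀ x, OverlapHelmholtz.partialDeriv i (fun x => φ₁ x + φ₂ x) x =
      OverlapHelmholtz.partialDeriv i φ₁ x + OverlapHelmholtz.partialDeriv i φ₂ x := fun x =>
    partialDeriv_add (hφ₁.differentiableAt x) (hφ₂.differentiableAt x) i
  simp only [e, mul_add]
  rw [integral_add ((hφ₁.partialDeriv i).integrable_mul k.memLp)
    ((hφ₂.partialDeriv i).integrable_mul k'.memLp), integral_add
    (hφ₁.integrable_mul (k.memLp_grad i)) (hφ₂.integrable_mul (k'.memLp_grad i)),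
    k.integral_eq' hφ₁, k'.integral_eq' hφ₂]
  ring

/-- The product rule for a test function `χ` on `D`; the product is extended by zero. -/
theorem testFunction_mul (hD : IsOpen D) (h : HasWeakGradient D u G) {χ : Space m → ℂ}
    (hχ : IsTestFunction D χ) :
    HasWeakGradient Set.univ (fun x => u x * χ x)
      (fun i x => G i x * χ x + u x * OverlapHelmholtz.partialDeriv i χ x) := by
  have hmul : ∀ {w ψ : Space m → ℂ}, MemLp w 2 (volume.restrict D) → IsTestFunction D ψ →
      MemLp (fun x => w x * ψ x) 2 (volume.restrict Set.univ) := by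
    intro w ψ hw hψ
    have h1 : MemLp (fun x => w x * ψ x) 2 (volume.restrict D) :=
      (hψ.memLp ⊤ _).mul hw
    rw [Measure.restrict_univ]
    have h2 := (memLp_indicator_iff_restrict hD.measurableSet).2 h1
    rwa [Set.indicator_eq_self.2 fun x hx => by
      by_contra hxD
      exact hx (by simp [hψ.eq_zero hxD])] at h2
  refine (hasWeakGradient_iff_integral (hmul h.memLp hχ)
    fun i => (hmul (h.memLp_grad i) hχ).add (hmul h.memLp (hχ.partialDeriv i))).2
    fun φ hφ i => ?_
  have hχφ : IsTestFunction D (fun x => φ x * χ x) :=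
    (hχ.smooth_mul hφ.smooth).mono Set.inter_subset_left
  have key := h.integral_eq' hχφ i
  have e : ∀ x, u x * OverlapHelmholtz.partialDeriv i (fun x => φ x * χ x) x =
      u x * (φ x * OverlapHelmholtz.partialDeriv i χ x) +
      u x * χ x * OverlapHelmholtz.partialDeriv i φ x := fun x => by
    rw [partialDeriv_mul (hφ.differentiableAt x) (hχ.differentiableAt x)]; ring
  have t1 : IsTestFunction D (fun x => φ x * OverlapHelmholtz.partialDeriv i χ x) :=
    ((hχ.partialDeriv i).smooth_mul hφ.smooth).mono Set.inter_subset_left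
  have t2 : IsTestFunction D (fun x => OverlapHelmholtz.partialDeriv i φ x * χ x) :=
    (hχ.smooth_mul (hφ.partialDeriv i).smooth).mono Set.inter_subset_left
  have i2 : Integrable (fun x => u x * χ x * OverlapHelmholtz.partialDeriv i φ x) := by
    refine (t2.integrable_mul h.memLp).congr (Eventually.of_forall fun x => ?_)
    simp only; ring
  simp only [e] at key
  rw [integral_add (t1.integrable_mul h.memLp) i2] at key
  have e2 : ∀ x, (G i x * χ x + u x * OverlapHelmholtz.partialDeriv i χ x) * φ x =
      G i x * (φ x * χ x) + u x * (φ x * OverlapHelmholtz.partialDeriv i χ x) := fun x => by ring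
  refine Eq.trans ?_ (congrArg Neg.neg (integral_congr_ae (Eventually.of_forall e2)).symm)
  rw [integral_add (hχφ.integrable_mul (h.memLp_grad i)) (t1.integrable_mul h.memLp)]
  linear_combination key

end HasWeakGradient

/-- Integration by parts against a test function, for a function which is continuously
differentiable near the support of the latter. -/
theorem integral_mul_partialDeriv {D : Set (Space m)} (hD : IsOpen D) {u : Space m → ℂ}
    (hu : ContDiffOn ℝ 1 u D) {φ : Space m → ℂ} (hφ : IsTestFunction D φ) (i : Fin m) :
    ∫ x, u x * partialDeriv i φ x = - ∫ x, partialDeriv i u x * φ x := by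
  have hint : ∀ {w ψ : Space m → ℂ}, ContinuousOn w D → IsTestFunction D ψ →
      Integrable (fun x => w x * ψ x) := by
    intro w ψ hw hψ
    have hc : Continuous (fun x => w x * ψ x) := by
      rw [continuous_iff_continuousAt]
      intro x
      by_cases hx : x ∈ tsupport ψ
      · exact ((hw.continuousAt (hD.mem_nhds (hψ.support_subset hx))).mul
          hψ.smooth.continuous.continuousAt)
      · have : (fun x => w x * ψ x) =ᶠ[𝓝 x] fun _ => 0 := by
          filter_upwards [(isClosed_tsupport ψ).isOpen_compl.mem_nhds hx] with y hy
          rw [image_eq_zero_of_notMem_tsupport hy, mul_zero]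
        exact continuousAt_const.congr this.symm
    exact hc.integrable_of_hasCompactSupport hψ.compact.mul_left
  have hdu : ContinuousOn (partialDeriv i u) D :=
    ((hu.continuousOn_fderiv_of_isOpen hD le_rfl).clm_apply continuousOn_const)
  exact integral_mul_fderiv_eq_neg_fderiv_mul_of_integrable (hint hdu hφ)
    (hint hu.continuousOn (hφ.partialDeriv i)) (hint hu.continuousOn hφ)
    (fun x hx => (hu.differentiableOn (by norm_num)).differentiableAt
      (hD.mem_nhds (hφ.support_subset hx)))
    (fun x _ => hφ.differentiableAt x)

theorem hasWeakGradient_of_contDiffOn {U D : Set (Space m)} (hU : IsOpen U) {u : Space m → ℂ}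
    (hu : ContDiffOn ℝ 1 u U) (hD : Bornology.IsBounded D) (hDU : closure D ⊆ U) :
    HasWeakGradient D u (fun i => partialDeriv i u) := by
  have hb : ∀ {w : Space m → ℂ}, ContinuousOn w U → MemLp w 2 (volume.restrict D) := by
    intro w hw
    have hK : IsCompact (closure D) := hD.isCompact_closure
    obtain ⟨C, hC⟩ := hK.exists_bound_of_continuousOn (hw.mono hDU)
    have : IsFiniteMeasure (volume.restrict (closure D)) := ⟨by simpa using hK.measure_lt_top⟩
    have : MemLp w 2 (volume.restrict (closure D)) :=
      MemLp.of_bound ((hw.mono hDU).aestronglyMeasurable isClosed_closure.measurableSet) C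
        ((ae_restrict_iff' isClosed_closure.measurableSet).2 (Eventually.of_forall hC))
    exact this.mono_measure (Measure.restrict_mono subset_closure le_rfl)
  refine (hasWeakGradient_iff_integral (hb hu.continuousOn) fun i =>
    hb ((hu.continuousOn_fderiv_of_isOpen hU le_rfl).clm_apply continuousOn_const)).2
    fun φ hφ i => ?_
  exact integral_mul_partialDeriv hU hu (hφ.mono (subset_closure.trans hDU)) i

theorem hasWeakGradient_of_contDiff {u : Space m → ℂ} (hu : ContDiff ℝ 1 u) {D : Set (Space m)}
    (hD : Bornology.IsBounded D) : HasWeakGradient D u (fun i => partialDeriv i u) :=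
  hasWeakGradient_of_contDiffOn isOpen_univ hu.contDiffOn hD (Set.subset_univ _)

/-! ### Mollification -/

/-- A bump function at the origin with support of radius `1 / (j + 1)`. -/
noncomputable def mollifierBump (m j : ℕ) : ContDiffBump (0 : Space m) where
  rIn := (1 / ((j : ℝ) + 1)) / 2
  rOut := 1 / ((j : ℝ) + 1)
  rIn_pos := by positivity
  rIn_lt_rOut := half_lt_self (by positivity)

/-- The mollification of `u` at scale `1 / (j + 1)`. -/
noncomputable def mollify (j : ℕ) (u : Space m → ℂ) : Space m → ℂ :=
  convolution ((mollifierBump m j).normed volume) u (ContinuousLinearMap.lsmul ℝ ℝ) volume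

theorem mollify_apply (j : ℕ) (u : Space m → ℂ) (x : Space m) :
    mollify j u x = ∫ t, (mollifierBump m j).normed volume t • u (x - t) := rfl

theorem mollify_congr (j : ℕ) {u v : Space m → ℂ} (h : u =ᵐ[volume] v) :
    mollify j u = mollify j v :=
  convolution_congr _ EventuallyEq.rfl h

theorem contDiff_mollify (j : ℕ) {u : Space m → ℂ} (hu : LocallyIntegrable u) :
    ContDiff ℝ (⊤ : ℕ∞) (mollify j u) :=
  (mollifierBump m j).hasCompactSupport_normed.contDiff_convolution_left _
    (mollifierBump m j).contDiff_normed hu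

theorem mollify_sub (j : ℕ) {u v : Space m → ℂ} (hu : LocallyIntegrable u)
    (hv : LocallyIntegrable v) : mollify j (u - v) = mollify j u - mollify j v := by
  have e : ∀ {w : Space m → ℂ}, LocallyIntegrable w →
      ConvolutionExists ((mollifierBump m j).normed volume) w (ContinuousLinearMap.lsmul ℝ ℝ) :=
    fun hw => (mollifierBump m j).hasCompactSupport_normed.convolutionExists_left _
      (mollifierBump m j).continuous_normed hw
  ext x
  simp only [mollify_apply, Pi.sub_apply, smul_sub]
  exact integral_sub (e hu x) (e hv x)

theorem mollify_eq_zero (j : ℕ) {K : Set (Space m)} {u : Space m → ℂ} (hu : ∀ x ∉ K, u x = 0)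
    {x : Space m} (hx : x ∉ Metric.thickening (1 / ((j : ℝ) + 1)) K) : mollify j u x = 0 := by
  rw [mollify_apply]
  refine integral_eq_zero_of_ae (Eventually.of_forall fun t => ?_)
  by_cases ht : t ∈ Metric.ball (0 : Space m) (1 / ((j : ℝ) + 1))
  · have : x - t ∉ K := fun hK => hx (Metric.mem_thickening_iff.2 ⟨x - t, hK, by
      simpa [dist_eq_norm] using ht⟩)
    simp [hu _ this]
  · have : (mollifierBump m j).normed volume t = 0 := by
      rw [← Function.notMem_support, (mollifierBump m j).support_normed_eq]
      exact ht
    simp [this]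

theorem dist_mollify_le (j : ℕ) {u : Space m → ℂ} (hu : AEStronglyMeasurable u) {x : Space m}
    {ε : ℝ} (h : ∀ y, dist y x < 1 / ((j : ℝ) + 1) → dist (u y) (u x) ≤ ε) :
    dist (mollify j u x) (u x) ≤ ε :=
  (mollifierBump m j).dist_normed_convolution_le hu h

theorem eventually_dist_mollify_le {u : Space m → ℂ} (hu : Continuous u)
    (hc : HasCompactSupport u) {ε : ℝ} (hε : 0 < ε) :
    ∀ᶠ j in atTop, ∀ x, dist (mollify j u x) (u x) ≤ ε := by
  obtain ⟨δ, hδ, h⟩ := Metric.uniformContinuous_iff.1 (hc.uniformContinuous_of_continuous hu) ε hε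
  filter_upwards [tendsto_one_div_add_atTop_nhds_zero_nat.eventually (gt_mem_nhds hδ)] with j hj x
  exact dist_mollify_le j hu.aestronglyMeasurable fun y hy => (h (hy.trans hj)).le

/-- Mollification commutes with weak differentiation. -/
theorem partialDeriv_mollify (j : ℕ) {u : Space m → ℂ} {G : Fin m → Space m → ℂ}
    (h : HasWeakGradient Set.univ u G) (i : Fin m) :
    partialDeriv i (mollify j u) = mollify j (G i) := by
  have hu : LocallyIntegrable u := by
    have := h.memLp
    rw [Measure.restrict_univ] at this
    exact this.locallyIntegrable (by norm_num)
  set ρ := (mollifierBump m j).normed volume with hρ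
  have hρs : ContDiff ℝ (⊤ : ℕ∞) ρ := (mollifierBump m j).contDiff_normed
  have hρc : HasCompactSupport ρ := (mollifierBump m j).hasCompactSupport_normed
  have hρd : Differentiable ℝ ρ := hρs.differentiable (by simp)
  ext x
  have hex := (hρc.fderiv ℝ).convolutionExists_left
    ((ContinuousLinearMap.lsmul ℝ ℝ (E := ℂ)).precompL (Space m))
    (hρs.continuous_fderiv (by simp)) hu x
  have h1 : partialDeriv i (mollify j u) x =
      ∫ t, fderiv ℝ ρ t (EuclideanSpace.single i 1) • u (x - t) := by
    rw [partialDeriv, mollify, (hρc.hasFDerivAt_convolution_left _ (hρs.of_le (by norm_cast)) hu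
      x).fderiv, convolution, ContinuousLinearMap.integral_apply hex]
    rfl
  have hφ : IsTestFunction Set.univ (fun t => ((ρ (x - t) : ℝ) : ℂ)) := by
    refine ⟨Complex.ofRealCLM.contDiff.comp (hρs.comp (contDiff_const.sub contDiff_id)), ?_,
      Set.subset_univ _⟩
    exact (hρc.comp_homeomorph (Homeomorph.subLeft x)).comp_left (g := fun r : ℝ => (r : ℂ))
      (by simp)
  have hd : ∀ t, partialDeriv i (fun t => ((ρ (x - t) : ℝ) : ℂ)) t =
      -((fderiv ℝ ρ (x - t) (EuclideanSpace.single i 1) : ℝ) : ℂ) := fun t => by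
    have h2 : HasFDerivAt (fun t => ((ρ (x - t) : ℝ) : ℂ))
        (Complex.ofRealCLM.comp ((fderiv ℝ ρ (x - t)).comp (-ContinuousLinearMap.id ℝ (Space m))))
        t :=
      Complex.ofRealCLM.hasFDerivAt.comp t ((hρd (x - t)).hasFDerivAt.comp t
        ((hasFDerivAt_id t).const_sub x))
    rw [partialDeriv, h2.fderiv]
    simp
  have key := h.integral_eq' hφ i
  simp only [hd, mul_neg, integral_neg, neg_inj] at key
  simp only [mul_comm (u _), mul_comm (G i _)] at key
  rw [← integral_sub_left_eq_self (fun t => _ * u t) volume x,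
    ← integral_sub_left_eq_self (fun t => _ * G i t) volume x] at key
  simp only [sub_sub_cancel] at key
  rw [h1, mollify_apply]
  simp only [Complex.real_smul]
  exact key

/-- Young's inequality for mollifications. -/
theorem eLpNorm_mollify_le (j : ℕ) {u : Space m → ℂ} (hu : AEStronglyMeasurable u) :
    eLpNorm (mollify j u) 2 volume ≤ eLpNorm u 2 volume := by
  rw [mollify_congr j hu.ae_eq_mk, eLpNorm_congr_ae hu.ae_eq_mk]
  have hv := hu.stronglyMeasurable_mk
  set v := hu.mk u
  -- the mollification is the mean of translates of `v` with respect to a probability measure `ν`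
  set ρ := (mollifierBump m j).normed volume with hρ
  have hρ0 : ∀ t, 0 ≤ ρ t := (mollifierBump m j).nonneg_normed
  have hρm : Measurable fun t => (ρ t).toNNReal :=
    ((mollifierBump m j).continuous_normed.measurable).real_toNNReal
  set ν : Measure (Space m) := volume.withDensity fun t => ((ρ t).toNNReal : ENNReal) with hν
  have hprob : IsProbabilityMeasure ν := by
    refine ⟨?_⟩
    rw [hν, withDensity_apply _ MeasurableSet.univ, Measure.restrict_univ]
    have := ofReal_integral_eq_lintegral_ofReal (mollifierBump m j).integrable_normed
      (Eventually.of_forall hρ0)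
    rw [(mollifierBump m j).integral_normed] at this
    rw [ENNReal.ofReal_one] at this
    exact this.symm
  have hmean : ∀ x, mollify j v x = ∫ t, v (x - t) ∂ν := fun x => by
    rw [hν, integral_withDensity_eq_integral_smul hρm, mollify_apply]
    refine integral_congr_ae (Eventually.of_forall fun t => ?_)
    simp only [NNReal.smul_def, Real.coe_toNNReal _ (hρ0 t)]
    rfl
  have hpow : ∀ {μ : Measure (Space m)} (f : Space m → ℂ),
      eLpNorm f 2 μ ^ (2 : ℝ) = ∫⁻ x, ‖f x‖ₑ ^ (2 : ℝ) ∂μ := fun f => by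
    have := eLpNorm_nnreal_pow_eq_lintegral (μ := ‹_›) (f := f) (p := 2) (by norm_num)
    simpa using this
  have hpt : ∀ x, ‖mollify j v x‖ₑ ^ (2 : ℝ) ≤ ∫⁻ t, ‖v (x - t)‖ₑ ^ (2 : ℝ) ∂ν := fun x => by
    rw [← hpow]
    refine ENNReal.rpow_le_rpow ?_ (by norm_num)
    rw [hmean x]
    refine (enorm_integral_le_lintegral_enorm _).trans ?_
    rw [← eLpNorm_one_eq_lintegral_enorm]
    exact eLpNorm_le_eLpNorm_of_exponent_le (by norm_num)
      (hv.comp_measurable (measurable_const.sub measurable_id)).aestronglyMeasurable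
  rw [← ENNReal.rpow_le_rpow_iff (z := 2) (by norm_num), hpow, hpow]
  calc ∫⁻ x, ‖mollify j v x‖ₑ ^ (2 : ℝ) ≤ ∫⁻ x, ∫⁻ t, ‖v (x - t)‖ₑ ^ (2 : ℝ) ∂ν :=
        lintegral_mono hpt
    _ = ∫⁻ t, (∫⁻ x, ‖v (x - t)‖ₑ ^ (2 : ℝ)) ∂ν := by
        refine lintegral_lintegral_swap (f := fun x t => ‖v (x - t)‖ₑ ^ (2 : ℝ)) ?_
        exact ((hv.comp_measurable (measurable_fst.sub measurable_snd)).measurable.enorm.pow_const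
          _).aemeasurable
    _ = ∫⁻ x, ‖v x‖ₑ ^ (2 : ℝ) := by
        rw [lintegral_congr fun t => lintegral_sub_right_eq_self (fun x => ‖v x‖ₑ ^ (2 : ℝ)) t,
          lintegral_const, measure_univ, mul_one]

theorem tendsto_eLpNorm_of_uniform {μ : Measure (Space m)} [IsFiniteMeasure μ]
    {f : ℕ → Space m → ℂ} (h : ∀ ε : ℝ, 0 < ε → ∀ᶠ j in atTop, ∀ x, ‖f j x‖ ≤ ε) :
    Tendsto (fun j => eLpNorm (f j) 2 μ) atTop (𝓝 0) := by
  rw [ENNReal.tendsto_nhds_zero]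
  intro ε hε
  have h0 : Tendsto (fun δ : ℝ => μ Set.univ ^ ((2 : ENNReal).toReal⁻¹) * ENNReal.ofReal δ)
      (𝓝[>] 0) (𝓝 0) := by
    have h1 : Tendsto (fun δ : ℝ => ENNReal.ofReal δ) (𝓝[>] 0) (𝓝 0) := by
      simpa using (ENNReal.continuous_ofReal.tendsto 0).mono_left nhdsWithin_le_nhds
    simpa using ENNReal.Tendsto.const_mul h1
      (Or.inr (ENNReal.rpow_ne_top_of_nonneg (by positivity) (measure_ne_top μ _)))
  obtain ⟨δ, h1, h2⟩ := ((ENNReal.tendsto_nhds_zero.1 h0 _ hε).and self_mem_nhdsWithin).exists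
  filter_upwards [h δ h2] with j hj
  exact (eLpNorm_le_of_ae_bound (Eventually.of_forall hj)).trans h1

theorem tendsto_eLpNorm_mollify_sub {u : Space m → ℂ} (hu : MemLp u 2 volume) :
    Tendsto (fun j => eLpNorm (mollify j u - u) 2 volume) atTop (𝓝 0) := by
  rw [ENNReal.tendsto_nhds_zero]
  intro ε hε
  have hε4 : ε / 4 ≠ 0 := (ENNReal.div_pos hε.ne' (by norm_num)).ne'
  obtain ⟨g, hgc, hg, hgcont, hgm⟩ := hu.exists_hasCompactSupport_eLpNorm_sub_le
    (by norm_num) hε4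
  -- for continuous `g` of compact support, the convergence is uniform
  set K := Metric.cthickening 1 (tsupport g) with hK
  have hKc : IsCompact K := IsCompact.cthickening hgc
  have hg1 : ∀ᶠ j in atTop, eLpNorm (mollify j g - g) 2 volume ≤ ε / 4 := by
    have : IsFiniteMeasure (volume.restrict K) := ⟨by simpa using hKc.measure_lt_top⟩
    have hunif := tendsto_eLpNorm_of_uniform (μ := volume.restrict K)
      (f := fun j => mollify j g - g) fun δ hδ => by
        simpa [dist_eq_norm] using eventually_dist_mollify_le hgcont hgc hδ
    filter_upwards [ENNReal.tendsto_nhds_zero.1 hunif _ (pos_iff_ne_zero.2 hε4)] with j hj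
    have hs : ∀ x ∉ K, (mollify j g - g) x = 0 := by
      intro x hx
      have h1 : mollify j g x = 0 := by
        refine mollify_eq_zero j (K := tsupport g)
          (fun y hy => image_eq_zero_of_notMem_tsupport hy) fun h => hx ?_
        refine Metric.thickening_subset_cthickening _ _ (Metric.thickening_mono ?_ _ h)
        rw [div_le_one (by positivity)]
        linarith [(Nat.cast_nonneg j : (0 : ℝ) ≤ j)]
      have h2 : g x = 0 :=
        image_eq_zero_of_notMem_tsupport fun h => hx (Metric.self_subset_cthickening _ h)
      simp [h1, h2]
    rw [← Set.indicator_eq_self.2 (fun x hx => by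
      by_contra h; exact hx (hs x h) : Function.support (mollify j g - g) ⊆ K),
      eLpNorm_indicator_eq_eLpNorm_restrict hKc.measurableSet]
    exact hj
  have hlu := hu.locallyIntegrable (by norm_num)
  have hlg := hgm.locallyIntegrable (by norm_num)
  filter_upwards [hg1] with j hj
  have e : mollify j u - u = mollify j (u - g) + ((mollify j g - g) - (u - g)) := by
    rw [mollify_sub j hlu hlg]; abel
  have m1 : AEStronglyMeasurable (mollify j (u - g)) :=
    (contDiff_mollify j (hlu.sub hlg)).continuous.aestronglyMeasurable
  have m2 : AEStronglyMeasurable (mollify j g - g) :=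
    ((contDiff_mollify j hlg).continuous.sub hgcont).aestronglyMeasurable
  rw [e]
  calc _ ≤ ε / 4 + (ε / 4 + ε / 4) := by
        refine (eLpNorm_add_le m1 (m2.sub (hu.1.sub hgm.1)) (by norm_num)).trans ?_
        refine add_le_add ((eLpNorm_mollify_le j (hu.1.sub hgm.1)).trans hg) ?_
        exact (eLpNorm_sub_le m2 (hu.1.sub hgm.1) (by norm_num)).trans (add_le_add hj hg)
    _ ≤ ε / 2 + ε / 2 := by
        have h4 : ε / 4 + ε / 4 = ε / 2 := by
          rw [← two_mul, ENNReal.div_eq_inv_mul, ENNReal.div_eq_inv_mul, ← mul_assoc]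
          congr 1
          rw [show (4 : ENNReal) = 2 * 2 by norm_num, ENNReal.mul_inv (by simp) (by simp),
            ← mul_assoc, ENNReal.mul_inv_cancel (by simp) (by simp), one_mul]
        rw [h4]
        gcongr
        norm_num
    _ = ε := ENNReal.add_halves ε

/-- The mollifications of an `H¹` function on the full space converge to it in `H¹`. -/
theorem tendstoH1_mollify {u : Space m → ℂ} {G : Fin m → Space m → ℂ}
    (h : HasWeakGradient Set.univ u G) :
    TendstoH1 Set.univ (fun j => mollify j u) u := by
  refine ⟨G, h, ?_, fun i => ?_⟩
  · rw [Measure.restrict_univ]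
    exact tendsto_eLpNorm_mollify_sub (by simpa using h.memLp)
  · rw [Measure.restrict_univ]
    simp only [partialDeriv_mollify _ h]
    exact tendsto_eLpNorm_mollify_sub (by simpa using h.memLp_grad i)

/-! ### The energy identity -/

/-- Convergence in `L²` can be tested against `L²` functions. -/
theorem tendsto_integral_mul_of_eLpNorm {μ : Measure (Space m)} {f g : Space m → ℂ}
    {h : ℕ → Space m → ℂ} (hf : MemLp f 2 μ) (hg : MemLp g 2 μ) (hh : ∀ j, MemLp (h j) 2 μ)
    (hlim : Tendsto (fun j => eLpNorm (h j - g) 2 μ) atTop (𝓝 0)) :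
    Tendsto (fun j => ∫ x, f x * h j x ∂μ) atTop (𝓝 (∫ x, f x * g x ∂μ)) := by
  have h0 : Tendsto (fun j => eLpNorm f 2 μ * eLpNorm (h j - g) 2 μ) atTop (𝓝 0) := by
    simpa using ENNReal.Tendsto.const_mul hlim (Or.inr hf.eLpNorm_ne_top)
  have hle : ∀ j, eLpNorm ((fun x => f x * h j x) - fun x => f x * g x) 1 μ ≤
      eLpNorm f 2 μ * eLpNorm (h j - g) 2 μ := fun j => by
    have e : ((fun x => f x * h j x) - fun x => f x * g x) = f • (h j - g) := by
      ext x; simp [mul_sub]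
    rw [e]
    exact eLpNorm_smul_le_mul_eLpNorm ((hh j).1.sub hg.1) hf.1
  have hm : AEStronglyMeasurable (fun x => f x * g x) μ := hf.1.mul hg.1
  have hi : ∀ j, Integrable (fun x => f x * h j x) μ := fun j => hf.integrable_mul (hh j)
  exact tendsto_integral_of_L1' _ hm (Eventually.of_forall hi)
    (tendsto_of_tendsto_of_tendsto_of_le_of_le tendsto_const_nhds h0 (fun _ => zero_le) hle)

theorem helmholtz_integrand_eq_zero {D : Set (Space m)} {φ : Space m → ℂ}
    (hφ : IsTestFunction D φ) (c : ℂ) {x : Space m} (hx : x ∉ D) :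
    Laplacian.laplacian φ x + c * φ x = 0 := by
  rw [hφ.laplacian.eq_zero hx, hφ.eq_zero hx, mul_zero, add_zero]

theorem solvesHelmholtz_iff_integral {k : ℝ} {n : Space m → ℝ} {D : Set (Space m)}
    {u : Space m → ℂ} : SolvesHelmholtz k n D u ↔ ∀ φ, IsTestFunction D φ →
      ∫ x, u x * (Laplacian.laplacian φ x + ((k ^ 2 * n x ^ 2 : ℝ) : ℂ) * φ x) = 0 := by
  refine forall₂_congr fun φ hφ => ?_
  rw [setIntegral_eq_integral_of_forall_compl_eq_zero fun x hx => by
    rw [helmholtz_integrand_eq_zero hφ _ hx, mul_zero]]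

theorem SolvesHelmholtz.mono {k : ℝ} {n : Space m → ℝ} {D D' : Set (Space m)} {u : Space m → ℂ}
    (h : SolvesHelmholtz k n D u) (hD : D' ⊆ D) : SolvesHelmholtz k n D' u :=
  solvesHelmholtz_iff_integral.2 fun φ hφ => solvesHelmholtz_iff_integral.1 h φ (hφ.mono hD)

theorem memLp_index_mul {k : ℝ} {n : Space m → ℝ} (hn : Measurable n) (hnb : ∃ C, ∀ x, |n x| ≤ C)
    {μ : Measure (Space m)} {d : Space m → ℂ} (hd : MemLp d 2 μ) :
    MemLp (fun x => ((k ^ 2 * n x ^ 2 : ℝ) : ℂ) * d x) 2 μ := by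
  obtain ⟨C, hC⟩ := hnb
  refine hd.mul (r := 2) (memLp_top_of_bound (f := fun x => ((k ^ 2 * n x ^ 2 : ℝ) : ℂ))
    ?_ (k ^ 2 * C ^ 2) ?_)
  · exact (Complex.measurable_ofReal.comp ((hn.pow_const 2).const_mul _)).aestronglyMeasurable
  · refine Eventually.of_forall fun x => ?_
    rw [Complex.norm_real, Real.norm_eq_abs, abs_mul, abs_of_nonneg (sq_nonneg k), abs_pow]
    gcongr
    exact hC x

/-- The variational form of the Helmholtz equation, for test functions. -/
theorem SolvesHelmholtz.sum_integral_grad {k : ℝ} {n : Space m → ℝ} (hn : Measurable n)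
    (hnb : ∃ C, ∀ x, |n x| ≤ C) {D : Set (Space m)} {d : Space m → ℂ}
    (h : SolvesHelmholtz k n D d) {G : Fin m → Space m → ℂ} (hd : HasWeakGradient D d G)
    {φ : Space m → ℂ} (hφ : IsTestFunction D φ) :
    ∑ i, ∫ x in D, G i x * partialDeriv i φ x =
      ∫ x in D, ((k ^ 2 * n x ^ 2 : ℝ) : ℂ) * d x * φ x := by
  have key := h φ hφ
  have e : ∀ x, d x * (Laplacian.laplacian φ x + ((k ^ 2 * n x ^ 2 : ℝ) : ℂ) * φ x) =
      ∑ i, d x * partialDeriv i (partialDeriv i φ) x +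
        ((k ^ 2 * n x ^ 2 : ℝ) : ℂ) * d x * φ x := fun x => by
    rw [laplacian_eq_sum_partialDeriv (hφ.smooth.of_le (by norm_cast)), ← Finset.mul_sum]
    ring
  have hi : ∀ i ∈ Finset.univ,
      Integrable (fun x => d x * partialDeriv i (partialDeriv i φ) x) (volume.restrict D) :=
    fun i _ => (((hφ.partialDeriv i).partialDeriv i).integrable_mul hd.memLp).integrableOn
  have hi' : Integrable (fun x => ((k ^ 2 * n x ^ 2 : ℝ) : ℂ) * d x * φ x) (volume.restrict D) :=
    (hφ.integrable_mul (memLp_index_mul hn hnb hd.memLp)).integrableOn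
  simp only [e] at key
  rw [integral_add (integrable_finsetSum _ hi) hi', integral_finsetSum _ hi] at key
  simp only [hd.integral_eq _ (hφ.partialDeriv _), Finset.sum_neg_distrib] at key
  linear_combination -key

/-- The variational form of the Helmholtz equation, for `H¹` functions of compact support. -/
theorem SolvesHelmholtz.sum_integral_grad_mul_grad {k : ℝ} {n : Space m → ℝ} (hn : Measurable n)
    (hnb : ∃ C, ∀ x, |n x| ≤ C) {r R : ℝ} (hrR : r < R) {d : Space m → ℂ}
    (h : SolvesHelmholtz k n (Metric.ball 0 R) d) {G : Fin m → Space m → ℂ}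
    (hd : HasWeakGradient (Metric.ball 0 R) d G) {ψ : Space m → ℂ} {H : Fin m → Space m → ℂ}
    (hψ : HasWeakGradient Set.univ ψ H) (hψ0 : ∀ x, r < ‖x‖ → ψ x = 0) :
    ∑ i, ∫ x in Metric.ball 0 R, G i x * H i x =
      ∫ x in Metric.ball 0 R, ((k ^ 2 * n x ^ 2 : ℝ) : ℂ) * d x * ψ x := by
  obtain ⟨G', h1, h2, h3⟩ := tendstoH1_mollify hψ
  have hψm : MemLp ψ 2 volume := by simpa using hψ.memLp
  have hHm : ∀ i, MemLp (H i) 2 volume := fun i => by simpa using hψ.memLp_grad i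
  have hmoll : ∀ {u : Space m → ℂ}, MemLp u 2 volume → ∀ j, MemLp (mollify j u) 2 volume :=
    fun hu j =>
    ⟨(contDiff_mollify j (hu.locallyIntegrable (by norm_num))).continuous.aestronglyMeasurable,
      (eLpNorm_mollify_le j hu.1).trans_lt hu.2⟩
  have hres : ∀ {u : Space m → ℂ}, MemLp u 2 volume →
      Tendsto (fun j => eLpNorm (mollify j u - u) 2 (volume.restrict (Metric.ball 0 R))) atTop
        (𝓝 0) := fun hu =>
    tendsto_of_tendsto_of_tendsto_of_le_of_le tendsto_const_nhds (tendsto_eLpNorm_mollify_sub hu)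
      (fun _ => zero_le) fun _ => eLpNorm_mono_measure _ Measure.restrict_le_self
  have t1 : Tendsto (fun j => ∑ i, ∫ x in Metric.ball 0 R, G i x * mollify j (H i) x) atTop
      (𝓝 (∑ i, ∫ x in Metric.ball 0 R, G i x * H i x)) :=
    tendsto_finsetSum _ fun i _ => tendsto_integral_mul_of_eLpNorm (hd.memLp_grad i)
      ((hHm i).restrict _) (fun j => (hmoll (hHm i) j).restrict _) (hres (hHm i))
  have t2 := tendsto_integral_mul_of_eLpNorm (memLp_index_mul (k := k) hn hnb hd.memLp)
      (hψm.restrict _) (fun j => (hmoll hψm j).restrict _) (hres hψm)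
  refine tendsto_nhds_unique (t1.congr' ?_) t2
  filter_upwards [tendsto_one_div_add_atTop_nhds_zero_nat.eventually
    (gt_mem_nhds (sub_pos.2 hrR))] with j hj
  have hs : Function.support (mollify j ψ) ⊆ Metric.closedBall 0 (r + 1 / ((j : ℝ) + 1)) := by
    intro x hx
    by_contra hcon
    refine hx (mollify_eq_zero j (K := Metric.closedBall 0 r)
      (fun y hy => hψ0 y (by simpa using hy)) fun hmem => hcon ?_)
    obtain ⟨y, hy, hxy⟩ := Metric.mem_thickening_iff.1 hmem
    have := dist_triangle x y 0
    simp only [Metric.mem_closedBall] at hy ⊢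
    linarith
  have hts := closure_minimal hs Metric.isClosed_closedBall
  have hφ : IsTestFunction (Metric.ball 0 R) (mollify j ψ) :=
    ⟨contDiff_mollify j (hψm.locallyIntegrable (by norm_num)),
      (isCompact_closedBall _ _).of_isClosed_subset (isClosed_tsupport _) hts,
      hts.trans (Metric.closedBall_subset_ball (by linarith))⟩
  rw [← h.sum_integral_grad hn hnb hd hφ]
  simp only [partialDeriv_mollify j hψ]

/-! ### Energy flux and decay of radiating solutions -/

theorem sum_partialDeriv_mul (v : Space m → ℂ) (x y : Space m) :
    ∑ i, partialDeriv i v x * ((y i : ℝ) : ℂ) = fderiv ℝ v x y := by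
  have hy : y = ∑ i, y i • EuclideanSpace.single i (1 : ℝ) := by
    simpa using ((EuclideanSpace.basisFun (Fin m) ℝ).sum_repr y).symm
  conv_rhs => rw [hy]
  rw [map_sum]
  refine Finset.sum_congr rfl fun i _ => ?_
  rw [map_smul, partialDeriv, Complex.real_smul, mul_comm]

/-- A solution of the Helmholtz equation with real coefficients in the full space transports no
energy through spheres; here the flux is averaged over the radius with the weight `F'`. -/
theorem integral_flux_eq_zero {k : ℝ} {n : Space m → ℝ} (hn : Measurable n)
    (hnb : ∃ C, ∀ x, |n x| ≤ C) {d : Space m → ℂ} (hd : MemH1loc Set.univ d)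
    (h : SolvesHelmholtz k n Set.univ d) {R : ℝ} (hR : 0 ≤ R) {v : Space m → ℂ}
    (hv : ContDiffOn ℝ 1 v {x | R < ‖x‖})
    (hdv : ∀ᵐ x ∂(volume.restrict {x : Space m | R < ‖x‖}), d x = v x)
    {a b c : ℝ} (hRa : R < a) {F : ℝ → ℝ} (hF : ContDiff ℝ (⊤ : ℕ∞) F)
    (h0 : ∀ r < a, F r = 0) (hb : ∀ r, b < r → F r = c) :
    ∫ x : Space m, deriv F ‖x‖ *
      ((starRingEnd ℂ) (v x) * fderiv ℝ v x (‖x‖⁻¹ • x)).im = 0 := by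
  have ha : 0 < a := hR.trans_lt hRa
  set B : Set (Space m) := Metric.ball 0 (b + 2) with hB
  have hBo : IsOpen B := Metric.isOpen_ball
  obtain ⟨G, hG⟩ : MemH1 B d := by simpa using hd (b + 2)
  -- subtracting the constant `c` from the radial function `F` yields a test function
  set χ : Space m → ℂ := fun x => ((F ‖x‖ - c : ℝ) : ℂ) with hχdef
  have hχs : ContDiff ℝ (⊤ : ℕ∞) χ :=
    Complex.ofRealCLM.contDiff.comp ((contDiff_radial ha hF h0).sub contDiff_const)
  have hχ0 : ∀ x, b < ‖x‖ → χ x = 0 := fun x hx => by simp [hχdef, hb _ hx]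
  have hts : tsupport χ ⊆ Metric.closedBall 0 b := by
    refine closure_minimal (fun x hx => ?_) Metric.isClosed_closedBall
    by_contra hcon
    exact hx (hχ0 x (by simpa using hcon))
  have hχ : IsTestFunction B χ :=
    ⟨hχs, (isCompact_closedBall _ _).of_isClosed_subset (isClosed_tsupport _) hts,
      hts.trans (Metric.closedBall_subset_ball (by linarith))⟩
  have hχd : ∀ i x, partialDeriv i χ x = ((radialDeriv F ‖x‖ * x i : ℝ) : ℂ) := fun i x => by
    have h1 := Complex.ofRealCLM.hasFDerivAt.comp x
      ((hasFDerivAt_radial ha hF h0 x).sub_const c)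
    rw [partialDeriv]
    change fderiv ℝ (Complex.ofRealCLM ∘ fun x : Space m => F ‖x‖ - c) x _ = _
    rw [h1.fderiv]
    simp [EuclideanSpace.inner_single_right]
  -- the energy identity for `conj d * χ`
  have hψ := hG.conj.testFunction_mul hBo hχ
  have key := (h.mono (Set.subset_univ B)).sum_integral_grad_mul_grad hn hnb
    (show b < b + 2 by linarith) hG hψ (fun x hx => by simp [hχ0 x hx])
  rw [← hB] at key
  have hint : ∀ i, Integrable (fun x => G i x * ((starRingEnd ℂ) (G i x) * χ x +
      (starRingEnd ℂ) (d x) * partialDeriv i χ x)) (volume.restrict B) := fun i =>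
    (hG.memLp_grad i).integrable_mul ((hψ.memLp_grad i).mono_measure
      (Measure.restrict_mono (Set.subset_univ _) le_rfl))
  have him := congrArg Complex.im key
  -- the zeroth-order term is real, as `k` and `n` are
  have hrhs : (∫ x in B, ((k ^ 2 * n x ^ 2 : ℝ) : ℂ) * d x *
      ((starRingEnd ℂ) (d x) * χ x)).im = 0 := by
    have e : ∀ x, ((k ^ 2 * n x ^ 2 : ℝ) : ℂ) * d x * ((starRingEnd ℂ) (d x) * χ x) =
        ((k ^ 2 * n x ^ 2 * Complex.normSq (d x) * (F ‖x‖ - c) : ℝ) : ℂ) := fun x => by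
      simp only [hχdef]
      push_cast
      rw [← Complex.mul_conj]
      ring
    simp only [e]
    exact (congrArg Complex.im (integral_ofReal (𝕜 := ℂ) (μ := volume.restrict B)
      (f := fun x => k ^ 2 * n x ^ 2 * Complex.normSq (d x) * (F ‖x‖ - c)))).trans
      (Complex.ofReal_im _)
  rw [hrhs, Complex.im_sum] at him
  have e1 : ∀ i, (∫ x in B, G i x * ((starRingEnd ℂ) (G i x) * χ x +
      (starRingEnd ℂ) (d x) * partialDeriv i χ x)).im =
      ∫ x in B, (G i x * ((starRingEnd ℂ) (G i x) * χ x +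
      (starRingEnd ℂ) (d x) * partialDeriv i χ x)).im := fun i =>
    (integral_im (𝕜 := ℂ) (hint i)).symm
  simp only [e1] at him
  have hint' : ∀ i ∈ Finset.univ, Integrable (fun x => (G i x * ((starRingEnd ℂ) (G i x) * χ x +
      (starRingEnd ℂ) (d x) * partialDeriv i χ x)).im) (volume.restrict B) :=
    fun i _ => (hint i).im
  rw [← integral_finsetSum _ hint'] at him
  -- off the ball of radius `R₀`, the weak gradient is the classical gradient of `v`
  obtain ⟨R₀, hR₀, hR₀a⟩ := exists_between hRa
  have hU : IsOpen {x : Space m | R < ‖x‖} := isOpen_lt continuous_const continuous_norm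
  set D : Set (Space m) := B ∩ {x | R₀ < ‖x‖} with hD
  have hDo : IsOpen D := hBo.inter (isOpen_lt continuous_const continuous_norm)
  have hDU : D ⊆ {x | R < ‖x‖} := fun x hx => hR₀.trans hx.2
  have hcl : closure D ⊆ {x | R < ‖x‖} := by
    have : closure D ⊆ {x : Space m | R₀ ≤ ‖x‖} :=
      closure_minimal (fun x hx => (le_of_lt hx.2 : R₀ ≤ ‖x‖))
        (isClosed_le continuous_const continuous_norm)
    exact fun x hx => hR₀.trans_le (this hx)
  have hdvD : d =ᵐ[volume.restrict D] v := ae_restrict_of_ae_restrict_of_subset hDU hdv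
  have hvG := hasWeakGradient_of_contDiffOn hU hv
    (Metric.isBounded_ball.subset (Set.inter_subset_left : D ⊆ B)) hcl
  have hGv : ∀ i, G i =ᵐ[volume.restrict D] partialDeriv i v := fun i =>
    ((hG.mono Set.inter_subset_left).congr hdvD).ae_eq hvG hDo i
  rw [ae_restrict_iff' hU.measurableSet] at hdv
  have hGv' : ∀ᵐ x, ∀ i, x ∈ D → G i x = partialDeriv i v x :=
    ae_all_iff.2 fun i => (ae_restrict_iff' hDo.measurableSet).1 (hGv i)
  rw [← him, ← setIntegral_eq_integral_of_forall_compl_eq_zero (s := B)]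
  · refine setIntegral_congr_ae hBo.measurableSet ?_
    filter_upwards [hdv, hGv'] with x hx hGx hxB
    have e2 : ∀ i, (G i x * ((starRingEnd ℂ) (G i x) * χ x +
        (starRingEnd ℂ) (d x) * partialDeriv i χ x)).im =
        radialDeriv F ‖x‖ * (G i x * (starRingEnd ℂ) (d x) * ((x i : ℝ) : ℂ)).im := fun i => by
      rw [hχd, mul_add, ← mul_assoc, Complex.mul_conj, hχdef, ← Complex.ofReal_mul, Complex.add_im,
        Complex.ofReal_im, zero_add, ← Complex.im_ofReal_mul]
      congr 1
      push_cast
      ring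
    change _ = ∑ i, _
    rcases lt_or_ge ‖x‖ a with hxa | hxa
    · rw [deriv_eq_zero_of_lt h0 _ hxa, zero_mul, Finset.sum_eq_zero]
      intro i _
      exact (e2 i).trans (by rw [radialDeriv_eq_zero h0 _ hxa, zero_mul])
    · have hxD : x ∈ D := ⟨hxB, hR₀a.trans_le hxa⟩
      refine Eq.trans ?_ (Finset.sum_congr rfl fun i _ => (e2 i).symm)
      simp only [hGx _ hxD, hx (hDU hxD)]
      rw [← Finset.mul_sum, ← Complex.im_sum]
      have e3 : ∀ i, partialDeriv i v x * (starRingEnd ℂ) (v x) * ((x i : ℝ) : ℂ) =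
          (starRingEnd ℂ) (v x) * (partialDeriv i v x * ((x i : ℝ) : ℂ)) := fun i => by ring
      simp only [e3]
      rw [← Finset.mul_sum, sum_partialDeriv_mul, map_smul, Complex.real_smul, mul_left_comm,
        Complex.im_ofReal_mul, radialDeriv, div_eq_mul_inv, mul_assoc]
  · intro x hx
    have hbx : b < ‖x‖ := by
      have : ¬ ‖x‖ < b + 2 := by simpa [hB] using hx
      linarith
    have : deriv F ‖x‖ = 0 := by
      have h1 : F =ᶠ[𝓝 ‖x‖] fun _ => c := by
        filter_upwards [lt_mem_nhds hbx] with s hs using hb s hs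
      rw [h1.deriv_eq]; simp
    rw [this, zero_mul]

/-- A crude bound: the shell is enlarged to the difference of the closed balls of radii `b` and
`a - 1`, whence the summand `1`. -/
theorem volume_shell_le {a b : ℝ} (ha : 1 ≤ a) (hab : a ≤ b) :
    volume.real {x : Space m | ‖x‖ ∈ Set.Icc a b} ≤
      (b - a + 1) * m * b ^ (m - 1) * volume.real (Metric.ball (0 : Space m) 1) := by
  have hsub : {x : Space m | ‖x‖ ∈ Set.Icc a b} ⊆
      Metric.closedBall 0 b \ Metric.closedBall 0 (a - 1) := fun x hx =>
    ⟨by simpa using hx.2, by simpa using (sub_one_lt a).trans_le hx.1⟩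
  have hfin : ∀ r, volume (Metric.closedBall (0 : Space m) r) ≠ ⊤ := fun r =>
    (isCompact_closedBall _ _).measure_lt_top.ne
  refine (measureReal_mono hsub (measure_ne_top_of_subset Set.sdiff_subset (hfin b))).trans ?_
  rw [measureReal_sdiff (Metric.closedBall_subset_closedBall (by linarith))
    Metric.isClosed_closedBall.measurableSet (hfin b),
    Measure.addHaar_real_closedBall _ _ (by linarith),
    Measure.addHaar_real_closedBall _ _ (by linarith), ← sub_mul, finrank_euclideanSpace_fin]
  refine mul_le_mul_of_nonneg_right ?_ measureReal_nonneg
  refine (le_abs_self _).trans ((abs_pow_sub_pow_le b (a - 1) m).trans_eq ?_)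
  rw [abs_of_nonneg (by linarith), abs_of_nonneg (by linarith : (0 : ℝ) ≤ b),
    abs_of_nonneg (by linarith : (0 : ℝ) ≤ a - 1), max_eq_left (by linarith)]
  ring

/-- Applied to `p = ∂ᵣv` and `q = v`, this bounds `k² |v|²` by the square of the Sommerfeld defect
`∂ᵣv - i k v` plus a multiple of the energy flux. -/
theorem norm_sub_I_mul_sq (k : ℝ) (p q : ℂ) :
    ‖p - Complex.I * k * q‖ ^ 2 =
      ‖p‖ ^ 2 + k ^ 2 * ‖q‖ ^ 2 - 2 * k * ((starRingEnd ℂ) q * p).im := by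
  simp only [Complex.sq_norm, Complex.normSq_apply, Complex.sub_re, Complex.sub_im, Complex.mul_re,
    Complex.mul_im, Complex.I_re, Complex.I_im, Complex.ofReal_re, Complex.ofReal_im,
    Complex.conj_re, Complex.conj_im]
  ring

/-- A radiating solution of the Helmholtz equation with real coefficients in the full space has
asymptotically no mass in the shells of thickness one. -/
theorem tendsto_integral_shell_sq {k : ℝ} (hk : 0 < k) (hm : 1 ≤ m) {n : Space m → ℝ}
    (hn : Measurable n) (hnb : ∃ C, ∀ x, |n x| ≤ C) {d : Space m → ℂ}
    (hd : MemH1loc Set.univ d) (h : SolvesHelmholtz k n Set.univ d) (hrad : IsRadiating k d) :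
    Tendsto (fun ρ : ℝ => ∫ x in {x : Space m | ‖x‖ ∈ Set.Icc ρ (ρ + 1)}, ‖d x‖ ^ 2)
      atTop (𝓝 0) := by
  obtain ⟨R', v, hv', hdv', ho⟩ := hrad
  -- the flux identity asks for a nonnegative radius
  set R := max R' 0 with hR
  have hsubR : {x : Space m | R < ‖x‖} ⊆ {x | R' < ‖x‖} := fun x hx =>
    (le_max_left R' 0).trans_lt hx
  have hv := hv'.mono hsubR
  have hdv := ae_restrict_of_ae_restrict_of_subset hsubR hdv'
  have hU : IsOpen {x : Space m | R < ‖x‖} := isOpen_lt continuous_const continuous_norm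
  have hdv2 := (ae_restrict_iff' hU.measurableSet).1 hdv
  set e : Space m → ℂ := fun x => fderiv ℝ v x (‖x‖⁻¹ • x) - Complex.I * k * v x with he
  -- `M * r ^ (m - 1)` bounds the volume of the shell `[r, r + 3]` for `r ≥ 3`
  set M : ℝ := 4 * m * 2 ^ (m - 1) * volume.real (Metric.ball (0 : Space m) 1) with hM
  have hM0 : 0 ≤ M := by positivity
  have main : ∀ ε : ℝ, 0 < ε → ∀ᶠ ρ : ℝ in atTop,
      k ^ 2 * ∫ x in {x : Space m | ‖x‖ ∈ Set.Icc ρ (ρ + 1)}, ‖d x‖ ^ 2 ≤ ε ^ 2 * M := by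
    intro ε hε
    obtain ⟨R₁, -, hR₁⟩ := Filter.hasBasis_cobounded_norm.eventually_iff.1 (ho.def hε)
    filter_upwards [eventually_ge_atTop (max (max R R₁ + 2) 4)] with ρ hρ
    have hρ4 : 4 ≤ ρ := (le_max_right _ _).trans hρ
    have hρR : R < ρ - 1 := by
      have := (le_max_left (max R R₁ + 2) 4).trans hρ
      linarith [le_max_left R R₁]
    have hρR₁ : R₁ ≤ ρ - 1 := by
      have := (le_max_left (max R R₁ + 2) 4).trans hρ
      linarith [le_max_right R R₁]
    -- a weight which is one on `[ρ, ρ + 1]` and vanishes off `(ρ - 1, ρ + 2)`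
    set W : ContDiffBump (ρ + 1 / 2 : ℝ) := ⟨1 / 2, 3 / 2, by norm_num, by norm_num⟩ with hW
    have hWs : ContDiff ℝ (⊤ : ℕ∞) W := W.contDiff
    have hW1 : ∀ s ∈ Set.Icc ρ (ρ + 1), W s = 1 := fun s hs => W.one_of_mem_closedBall (by
      rw [Metric.mem_closedBall, Real.dist_eq, abs_le]
      constructor <;> simp only [hW] <;> linarith [hs.1, hs.2])
    have hW0 : ∀ s, s ∉ Set.Ioo (ρ - 1) (ρ + 2) → W s = 0 := fun s hs => W.zero_of_le_dist (by
      rw [Real.dist_eq, le_abs]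
      by_contra hcon
      push Not at hcon
      simp only [hW] at hcon
      exact hs ⟨by linarith [hcon.2], by linarith [hcon.1]⟩)
    -- `F` is the primitive of the weight `W`
    set F : ℝ → ℝ := fun r => ∫ s in (ρ - 1)..r, W s with hFdef
    have hFd : ∀ r, HasDerivAt F (W r) r := fun r =>
      (hWs.continuous.integral_hasStrictDerivAt (ρ - 1) r).hasDerivAt
    have hFd' : deriv F = W := funext fun r => (hFd r).deriv
    have hF : ContDiff ℝ (⊤ : ℕ∞) F :=
      contDiff_infty_iff_deriv.2 ⟨fun r => (hFd r).differentiableAt, hFd' ▸ hWs⟩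
    have hF0 : ∀ r < ρ - 1, F r = 0 := fun r hr => by
      refine (intervalIntegral.integral_congr fun s hs => ?_).trans
        intervalIntegral.integral_zero
      rw [Set.uIcc_of_ge hr.le] at hs
      exact hW0 s fun h => by linarith [h.1, hs.2]
    have hFb : ∀ r, ρ + 2 < r → F r = F (ρ + 2) := fun r hr => by
      have hi : ∀ x y, IntervalIntegrable W volume x y := fun x y =>
        hWs.continuous.intervalIntegrable x y
      have h1 : ∫ s in (ρ + 2)..r, W s = 0 := by
        refine (intervalIntegral.integral_congr fun s hs => ?_).trans
          intervalIntegral.integral_zero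
        rw [Set.uIcc_of_le hr.le] at hs
        exact hW0 s fun h => by linarith [h.2, hs.1]
      have := intervalIntegral.integral_add_adjacent_intervals (hi (ρ - 1) (ρ + 2)) (hi (ρ + 2) r)
      rw [h1, add_zero] at this
      exact this.symm
    have hflux := integral_flux_eq_zero hn hnb hd h (le_max_right _ _) hv hdv hρR hF hF0 hFb
    rw [hFd'] at hflux
    set A : Set (Space m) := {x | ‖x‖ ∈ Set.Icc (ρ - 1) (ρ + 2)} with hA
    set S : Set (Space m) := {x | ‖x‖ ∈ Set.Icc ρ (ρ + 1)} with hS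
    have hAc : IsCompact A := by
      refine (isCompact_closedBall (0 : Space m) (ρ + 2)).of_isClosed_subset
        (isClosed_Icc.preimage continuous_norm) fun x hx => ?_
      simpa using hx.2
    have hSA : S ⊆ A := fun x hx => ⟨by linarith [hx.1], by linarith [hx.2]⟩
    have hSm : MeasurableSet S := measurable_norm measurableSet_Icc
    have hAU : A ⊆ {x | R < ‖x‖} := fun x hx => hρR.trans_le hx.1
    have hvc : ContinuousOn v A := hv.continuousOn.mono hAU
    have hpc : ContinuousOn (fun x => fderiv ℝ v x (‖x‖⁻¹ • x)) A :=
      ((hv.continuousOn_fderiv_of_isOpen hU le_rfl).mono hAU).clm_apply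
        ((continuous_norm.continuousOn.inv₀ fun x hx => by
          have : ρ - 1 ≤ ‖x‖ := hx.1
          linarith).smul continuousOn_id)
    have hec : ContinuousOn e A := hpc.sub (continuousOn_const.mul hvc)
    have hWc : ContinuousOn (fun x : Space m => W ‖x‖) A :=
      (hWs.continuous.comp continuous_norm).continuousOn
    have i1 : IntegrableOn (fun x => W ‖x‖ * ‖e x‖ ^ 2) A :=
      (hWc.mul (hec.norm.pow 2)).integrableOn_compact hAc
    have i2 : IntegrableOn (fun x => W ‖x‖ *
        ((starRingEnd ℂ) (v x) * fderiv ℝ v x (‖x‖⁻¹ • x)).im) A :=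
      (hWc.mul (Complex.continuous_im.comp_continuousOn
        ((Complex.continuous_conj.comp_continuousOn hvc).mul hpc))).integrableOn_compact hAc
    have i3 : IntegrableOn (fun x => k ^ 2 * (W ‖x‖ * ‖v x‖ ^ 2)) A :=
      (continuousOn_const.mul (hWc.mul (hvc.norm.pow 2))).integrableOn_compact hAc
    have hflux' : ∫ x in A, W ‖x‖ *
        ((starRingEnd ℂ) (v x) * fderiv ℝ v x (‖x‖⁻¹ • x)).im = 0 := by
      rw [setIntegral_eq_integral_of_forall_compl_eq_zero fun x hx => ?_, hflux]
      rw [hW0 _ fun h => hx ⟨h.1.le, h.2.le⟩, zero_mul]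
    calc k ^ 2 * ∫ x in S, ‖d x‖ ^ 2
        = ∫ x in S, k ^ 2 * (W ‖x‖ * ‖v x‖ ^ 2) := by
          rw [← integral_const_mul]
          refine setIntegral_congr_ae hSm ?_
          filter_upwards [hdv2] with x hx hxS
          rw [hx (hAU (hSA hxS)), hW1 _ hxS, one_mul]
      _ ≤ ∫ x in A, k ^ 2 * (W ‖x‖ * ‖v x‖ ^ 2) := by
          refine setIntegral_mono_set i3 (Eventually.of_forall fun x => ?_)
            (Eventually.of_forall hSA)
          have := W.nonneg (x := ‖x‖)
          simp only [Pi.zero_apply]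
          positivity
      _ ≤ ∫ x in A, (W ‖x‖ * ‖e x‖ ^ 2 + 2 * k * (W ‖x‖ *
          ((starRingEnd ℂ) (v x) * fderiv ℝ v x (‖x‖⁻¹ • x)).im)) := by
          refine setIntegral_mono i3 (i1.add (i2.const_mul _)) fun x => ?_
          simp only [he, norm_sub_I_mul_sq]
          have h1 := W.nonneg (x := ‖x‖)
          have h2 := mul_nonneg h1 (sq_nonneg ‖fderiv ℝ v x (‖x‖⁻¹ • x)‖)
          linarith
      _ = ∫ x in A, W ‖x‖ * ‖e x‖ ^ 2 := by
          rw [integral_add i1 (i2.const_mul _), integral_const_mul, hflux', mul_zero, add_zero]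
      _ ≤ (ε ^ 2 * (ρ - 1) ^ (-((m : ℝ) - 1))) * volume.real A := by
          refine (Real.le_norm_self _).trans (norm_setIntegral_le_of_norm_le_const hAc.measure_lt_top
            fun x hx => ?_)
          have hx1 : 0 < ρ - 1 := by linarith
          have hx2 : ρ - 1 ≤ ‖x‖ := hx.1
          have h1 : ‖e x‖ ≤ ε * ‖x‖ ^ (-((m : ℝ) - 1) / 2) := by
            have := hR₁ (hρR₁.trans hx2 : R₁ ≤ ‖x‖)
            rwa [Real.norm_of_nonneg (by positivity)] at this
          have h2 : (‖x‖ ^ (-((m : ℝ) - 1) / 2)) ^ 2 ≤ (ρ - 1) ^ (-((m : ℝ) - 1)) := by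
            rw [← Real.rpow_natCast, ← Real.rpow_mul (norm_nonneg _)]
            have : -((m : ℝ) - 1) / 2 * ((2 : ℕ) : ℝ) = -((m : ℝ) - 1) := by push_cast; ring
            rw [this]
            refine Real.rpow_le_rpow_of_nonpos hx1 hx2 ?_
            have : (1 : ℝ) ≤ m := by exact_mod_cast hm
            linarith
          rw [Real.norm_of_nonneg (mul_nonneg W.nonneg (sq_nonneg _))]
          calc W ‖x‖ * ‖e x‖ ^ 2 ≤ 1 * (ε * ‖x‖ ^ (-((m : ℝ) - 1) / 2)) ^ 2 := by
                gcongr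
                exact W.le_one
            _ ≤ _ := by
                rw [one_mul, mul_pow]
                gcongr
      _ ≤ (ε ^ 2 * (ρ - 1) ^ (-((m : ℝ) - 1))) * (4 * m * (ρ + 2) ^ (m - 1) *
          volume.real (Metric.ball (0 : Space m) 1)) := by
          refine mul_le_mul_of_nonneg_left ?_ (by
            have : 0 < ρ - 1 := by linarith
            positivity)
          have := volume_shell_le (m := m) (a := ρ - 1) (b := ρ + 2) (by linarith) (by linarith)
          rwa [show ρ + 2 - (ρ - 1) + 1 = 4 by ring] at this
      _ ≤ ε ^ 2 * M := by
          have hx1 : 0 < ρ - 1 := by linarith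
          have h3 : (ρ - 1) ^ (-((m : ℝ) - 1)) * (ρ + 2) ^ (m - 1) ≤ 2 ^ (m - 1) := by
            have : ((m : ℝ) - 1) = ((m - 1 : ℕ) : ℝ) := by
              rw [Nat.cast_sub hm]; simp
            rw [this, Real.rpow_neg hx1.le, Real.rpow_natCast, inv_mul_le_iff₀ (by positivity),
              ← mul_pow]
            gcongr
            linarith
          calc _ = ε ^ 2 * (4 * m * ((ρ - 1) ^ (-((m : ℝ) - 1)) * (ρ + 2) ^ (m - 1)) *
                volume.real (Metric.ball (0 : Space m) 1)) := by ring
            _ ≤ _ := by rw [hM]; gcongr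
  rw [Metric.tendsto_nhds]
  intro δ hδ
  obtain ⟨ε, hε, hεδ⟩ : ∃ ε : ℝ, 0 < ε ∧ ε ^ 2 * M < k ^ 2 * δ := by
    have h1 : Tendsto (fun ε : ℝ => ε ^ 2 * M) (𝓝[>] 0) (𝓝 0) := by
      have : Tendsto (fun ε : ℝ => ε ^ 2 * M) (𝓝 0) (𝓝 (0 ^ 2 * M)) :=
        Continuous.tendsto (by fun_prop) 0
      simpa using this.mono_left nhdsWithin_le_nhds
    obtain ⟨ε, h2, h3⟩ := ((h1.eventually (gt_mem_nhds (by positivity : 0 < k ^ 2 * δ))).and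
      self_mem_nhdsWithin).exists
    exact ⟨ε, h3, h2⟩
  filter_upwards [main ε hε] with ρ hρ
  rw [Real.dist_eq, sub_zero, abs_of_nonneg (integral_nonneg fun x => sq_nonneg _)]
  exact lt_of_mul_lt_mul_left (hρ.trans_lt hεδ) (by positivity)

theorem MemH1loc.memLp {d : Space m → ℂ} (hd : MemH1loc Set.univ d) (R : ℝ) :
    MemLp d 2 (volume.restrict (Metric.ball 0 R)) := by
  obtain ⟨G, hG⟩ := hd R
  simpa using hG.memLp

/-- The mass of a function controls its integral by the Cauchy-Schwarz inequality, since the volume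
of the shell is `O(ρ ^ (m - 1))`. -/
theorem tendsto_integral_shell {d : Space m → ℂ} (hm : 1 ≤ m) (hd : MemH1loc Set.univ d)
    (h : Tendsto (fun ρ : ℝ => ∫ x in {x : Space m | ‖x‖ ∈ Set.Icc ρ (ρ + 1)}, ‖d x‖ ^ 2)
      atTop (𝓝 0)) :
    Tendsto (fun ρ : ℝ => ρ ^ (-((m : ℝ) - 1) / 2) *
      ∫ x in {x : Space m | ‖x‖ ∈ Set.Icc ρ (ρ + 1)}, ‖d x‖) atTop (𝓝 0) := by
  set M : ℝ := 2 * m * 2 ^ (m - 1) * volume.real (Metric.ball (0 : Space m) 1) with hM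
  have hM0 : 0 ≤ M := by positivity
  -- the Cauchy-Schwarz inequality in the form `t |d| ≤ δ t² + |d|² / δ` with `t = ρ ^ (-(m-1)/2)`
  have main : ∀ δ : ℝ, 0 < δ → ∀ ρ : ℝ, 1 ≤ ρ → ρ ^ (-((m : ℝ) - 1) / 2) *
      ∫ x in {x : Space m | ‖x‖ ∈ Set.Icc ρ (ρ + 1)}, ‖d x‖ ≤ δ * M +
        δ⁻¹ * ∫ x in {x : Space m | ‖x‖ ∈ Set.Icc ρ (ρ + 1)}, ‖d x‖ ^ 2 := by
    intro δ hδ ρ hρ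
    set S : Set (Space m) := {x | ‖x‖ ∈ Set.Icc ρ (ρ + 1)} with hS
    have hρ0 : 0 < ρ := by linarith
    have hSB : S ⊆ Metric.ball 0 (ρ + 2) := fun x hx => by
      have : ‖x‖ ≤ ρ + 1 := hx.2
      rw [mem_ball_zero_iff]
      linarith
    have hSm : MeasurableSet S := measurable_norm measurableSet_Icc
    have hdS : MemLp d 2 (volume.restrict S) :=
      (hd.memLp (ρ + 2)).mono_measure (Measure.restrict_mono hSB le_rfl)
    have hfin : volume S < ⊤ := (measure_mono hSB).trans_lt Metric.isBounded_ball.measure_lt_top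
    have : IsFiniteMeasure (volume.restrict S) := ⟨by simpa using hfin⟩
    have i1 : IntegrableOn (fun x => ‖d x‖) S := (hdS.integrable (by norm_num)).norm
    have i2 : IntegrableOn (fun x => ‖d x‖ ^ 2) S := hdS.integrable_norm_pow (by norm_num)
    set t : ℝ := ρ ^ (-((m : ℝ) - 1) / 2) with ht
    have ht0 : 0 < t := by positivity
    have ht2 : t ^ 2 * ρ ^ (m - 1) = 1 := by
      have hc : ((m - 1 : ℕ) : ℝ) = (m : ℝ) - 1 := by rw [Nat.cast_sub hm]; simp
      rw [ht, ← Real.rpow_natCast, ← Real.rpow_mul hρ0.le, ← Real.rpow_natCast,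
        ← Real.rpow_add hρ0, hc]
      rw [show -((m : ℝ) - 1) / 2 * ((2 : ℕ) : ℝ) + ((m : ℝ) - 1) = 0 by push_cast; ring,
        Real.rpow_zero]
    have hvol : volume.real S ≤ M * ρ ^ (m - 1) := by
      refine (volume_shell_le hρ (by linarith)).trans ?_
      rw [show ρ + 1 - ρ + 1 = 2 by ring, hM]
      calc _ ≤ 2 * m * (2 * ρ) ^ (m - 1) * volume.real (Metric.ball (0 : Space m) 1) := by
            gcongr
            linarith
        _ = _ := by rw [mul_pow]; ring
    calc t * ∫ x in S, ‖d x‖ = ∫ x in S, t * ‖d x‖ := (integral_const_mul _ _).symm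
      _ ≤ ∫ x in S, (δ * t ^ 2 + δ⁻¹ * ‖d x‖ ^ 2) := by
          refine setIntegral_mono (i1.const_mul t)
            ((integrable_const _).add (i2.const_mul _)) fun x => ?_
          have h1 := sq_nonneg (δ * t - ‖d x‖)
          have h2 := mul_pos hδ ht0
          have h3 : δ * (δ * t ^ 2 + δ⁻¹ * ‖d x‖ ^ 2) = (δ * t) ^ 2 + ‖d x‖ ^ 2 := by
            field_simp
          refine le_of_mul_le_mul_left ?_ hδ
          rw [h3]
          nlinarith [mul_nonneg h2.le (norm_nonneg (d x))]
      _ = δ * (t ^ 2 * volume.real S) + δ⁻¹ * ∫ x in S, ‖d x‖ ^ 2 := by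
          rw [integral_add (integrable_const _) (i2.const_mul _), setIntegral_const,
            integral_const_mul, smul_eq_mul]
          ring
      _ ≤ δ * M + δ⁻¹ * ∫ x in S, ‖d x‖ ^ 2 := by
          gcongr
          calc t ^ 2 * volume.real S ≤ t ^ 2 * (M * ρ ^ (m - 1)) := by gcongr
            _ = M * (t ^ 2 * ρ ^ (m - 1)) := by ring
            _ = M := by rw [ht2, mul_one]
  rw [Metric.tendsto_nhds]
  intro ε hε
  set δ : ℝ := ε / (2 * (M + 1)) with hδdef
  have hδ : 0 < δ := by positivity
  have hδM : δ * M < ε / 2 := by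
    have : δ * (M + 1) = ε / 2 := by rw [hδdef]; field_simp
    linarith
  have h' : Tendsto (fun ρ : ℝ => δ⁻¹ *
      ∫ x in {x : Space m | ‖x‖ ∈ Set.Icc ρ (ρ + 1)}, ‖d x‖ ^ 2) atTop (𝓝 0) := by
    simpa using h.const_mul δ⁻¹
  filter_upwards [h'.eventually (gt_mem_nhds (half_pos hε)), eventually_ge_atTop 1] with ρ h1 h2
  have hpos : 0 ≤ ρ ^ (-((m : ℝ) - 1) / 2) *
      ∫ x in {x : Space m | ‖x‖ ∈ Set.Icc ρ (ρ + 1)}, ‖d x‖ :=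
    mul_nonneg (Real.rpow_nonneg (by linarith) _) (integral_nonneg fun x => norm_nonneg _)
  rw [Real.dist_eq, sub_zero, abs_of_nonneg hpos]
  linarith [main δ hδ ρ h2]

/-! ### Finiteness of the surface measure -/

/-- Where `Ω` is the region below the graph of a continuous function, its frontier lies on the
graph. -/
theorem IsLocalHypograph.inner_eq {Ω : Set (Space m)} {e : Space m} {φ : Space m → ℝ}
    (hφ : Continuous φ) {U : Set (Space m)} (hU : IsOpen U)
    (h : ∀ y ∈ U, y ∈ Ω ↔ inner ℝ e y < φ (y - (inner ℝ e y : ℝ) • e)) {y : Space m}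
    (hy : y ∈ frontier Ω) (hyU : y ∈ U) :
    inner ℝ e y = φ (y - (inner ℝ e y : ℝ) • e) := by
  have hc : Continuous fun y : Space m => φ (y - (inner ℝ e y : ℝ) • e) :=
    hφ.comp (by fun_prop)
  have hi : Continuous fun y : Space m => (inner ℝ e y : ℝ) := by fun_prop
  rcases lt_trichotomy (inner ℝ e y : ℝ) (φ (y - (inner ℝ e y : ℝ) • e)) with hlt | heq | hgt
  · refine absurd ?_ hy.2
    rw [mem_interior_iff_mem_nhds]
    filter_upwards [(isOpen_lt hi hc).mem_nhds hlt, hU.mem_nhds hyU] with z hz hzU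
    exact (h z hzU).2 hz
  · exact heq
  · have : Ωᶜ ∈ 𝓝 y := by
      filter_upwards [(isOpen_lt hc hi).mem_nhds hgt, hU.mem_nhds hyU] with z hz hzU hzΩ
      exact lt_asymm hz ((h z hzU).1 hzΩ)
    obtain ⟨z, hz, hzΩ⟩ := mem_closure_iff_nhds.1 hy.1 _ this
    exact absurd hzΩ hz

/-- Locally the boundary is contained in a Lipschitz image of a ball of a hyperplane, whose
Hausdorff measure of dimension `m - 1` is finite; compactness does the rest. -/
theorem IsLocalHypograph.isFiniteMeasure_surfaceMeasure (hm : 1 ≤ m)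
    {P : (Space m → ℝ) → Prop} (hP : ∀ φ, P φ → LocallyLipschitz φ) {Ω : Set (Space m)}
    (hΩ : Bornology.IsBounded Ω) (h : IsLocalHypograph P Ω) :
    IsFiniteMeasure (surfaceMeasure (frontier Ω)) := by
  have hS : IsCompact (frontier Ω) :=
    Metric.isCompact_of_isClosed_isBounded isClosed_frontier
      (hΩ.closure.subset frontier_subset_closure)
  suffices hlt : Measure.hausdorffMeasure ((m : ℝ) - 1) (frontier Ω) < ⊤ from
    ⟨by rw [surfaceMeasure, Measure.restrict_apply_univ]; exact hlt⟩
  refine hS.measure_lt_top_of_nhdsWithin fun x hx => ?_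
  obtain ⟨e, he, φ, hPφ, hev⟩ := h x hx
  have hφ := hP φ hPφ
  set π : Space m → Space m := fun y => y - (inner ℝ e y : ℝ) • e with hπ
  have hπc : Continuous π := by fun_prop
  obtain ⟨U, hUx, hUo, hU⟩ : ∃ U : Set (Space m), x ∈ U ∧ IsOpen U ∧
      ∀ y ∈ U, y ∈ Ω ↔ inner ℝ e y < φ (y - (inner ℝ e y : ℝ) • e) := by
    obtain ⟨U, h1, h2, h3⟩ := eventually_nhds_iff.1 hev
    exact ⟨U, h3, h2, h1⟩
  obtain ⟨L, T, hT, hL⟩ := hφ (π x)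
  obtain ⟨δ, hδ, hδT⟩ := Metric.mem_nhds_iff.1 hT
  set K : Submodule ℝ (Space m) := (Submodule.span ℝ {e})ᗮ with hK
  have hmem : ∀ y, π y ∈ K := fun y => by
    rw [hK, Submodule.mem_orthogonal_singleton_iff_inner_right]
    simp only [hπ]
    rw [inner_sub_right, inner_smul_right, real_inner_self_eq_norm_sq, he]
    ring
  have hfr : Module.finrank ℝ K = m - 1 := by
    have : Fact (Module.finrank ℝ (Space m) = (m - 1) + 1) :=
      ⟨by rw [finrank_euclideanSpace_fin]; omega⟩
    exact Submodule.finrank_orthogonal_span_singleton (by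
      rintro rfl; simp at he)
  have hd : ((m : ℝ) - 1) = (Module.finrank ℝ K : ℝ) := by
    rw [hfr, Nat.cast_sub hm]; simp
  -- near `x`, the boundary is the image of a ball in the hyperplane under the graph map
  set s : Set K := Metric.ball ⟨π x, hmem x⟩ δ with hs
  set g : K → Space m := fun z => (z : Space m) + φ z • e with hg
  have hgL : LipschitzOnWith (1 + L) g s := by
    refine LipschitzOnWith.of_dist_le_mul fun z hz z' hz' => ?_
    have h1 : dist (φ z) (φ z') ≤ L * dist z z' :=
      hL.dist_le_mul _ (hδT hz) _ (hδT hz')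
    calc dist (g z) (g z') ≤ dist (z : Space m) z' + dist (φ z • e) (φ z' • e) :=
          dist_add_add_le _ _ _ _
      _ = dist z z' + dist (φ z) (φ z') := by
          rw [dist_eq_norm (φ z • e), ← sub_smul, norm_smul, he, mul_one, ← dist_eq_norm]
          rfl
      _ ≤ _ := by push_cast; linarith
  refine ⟨frontier Ω ∩ (U ∩ π ⁻¹' Metric.ball (π x) δ), inter_mem self_mem_nhdsWithin
    (mem_nhdsWithin_of_mem_nhds (inter_mem (hUo.mem_nhds hUx)
      (hπc.continuousAt.preimage_mem_nhds (Metric.ball_mem_nhds _ hδ)))), ?_⟩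
  have hsub : frontier Ω ∩ (U ∩ π ⁻¹' Metric.ball (π x) δ) ⊆ g '' s := by
    rintro y ⟨hy, hyU, hyπ⟩
    refine ⟨⟨π y, hmem y⟩, hyπ, ?_⟩
    have := IsLocalHypograph.inner_eq hφ.continuous hUo hU hy hyU
    simp only [hg, hπ]
    rw [← this, sub_add_cancel]
  refine (measure_mono hsub).trans_lt ?_
  refine (hgL.hausdorffMeasure_image_le (by rw [hd]; positivity)).trans_lt ?_
  refine ENNReal.mul_lt_top (ENNReal.rpow_lt_top_of_nonneg (by rw [hd]; positivity)
    ENNReal.coe_ne_top) ?_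
  rw [hd]
  exact Metric.isBounded_ball.measure_lt_top

theorem HasSmoothBoundary.isFiniteMeasure_surfaceMeasure (hm : 1 ≤ m) {Ω : Set (Space m)}
    (hΩ : Bornology.IsBounded Ω) (h : HasSmoothBoundary Ω) :
    IsFiniteMeasure (surfaceMeasure (frontier Ω)) :=
  IsLocalHypograph.isFiniteMeasure_surfaceMeasure hm
    (fun _ hφ => ContDiff.locallyLipschitz (hφ.of_le (by norm_cast))) hΩ h

theorem HasLipschitzBoundary.isFiniteMeasure_surfaceMeasure (hm : 1 ≤ m) {Ω : Set (Space m)}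
    (hΩ : Bornology.IsBounded Ω) (h : HasLipschitzBoundary Ω) :
    IsFiniteMeasure (surfaceMeasure (frontier Ω)) :=
  IsLocalHypograph.isFiniteMeasure_surfaceMeasure hm
    (fun _ hφ => hφ.choose_spec.locallyLipschitz) hΩ h

/-! ### Traces -/

theorem TendstoH1.mono {D D' : Set (Space m)} {φ : ℕ → Space m → ℂ} {u : Space m → ℂ}
    (h : TendstoH1 D φ u) (hD : D' ⊆ D) : TendstoH1 D' φ u := by
  obtain ⟨G, hG, h1, h2⟩ := h
  have hle := Measure.restrict_mono hD (le_refl (volume : Measure (Space m)))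
  exact ⟨G, hG.mono hD, tendsto_of_tendsto_of_tendsto_of_le_of_le tendsto_const_nhds h1
    (fun _ => zero_le) fun _ => eLpNorm_mono_measure _ hle,
    fun i => tendsto_of_tendsto_of_tendsto_of_le_of_le tendsto_const_nhds (h2 i)
      (fun _ => zero_le) fun _ => eLpNorm_mono_measure _ hle⟩

theorem TendstoH1.congr {D : Set (Space m)} {φ : ℕ → Space m → ℂ} {u v : Space m → ℂ}
    (h : TendstoH1 D φ u) (huv : u =ᵐ[volume.restrict D] v) : TendstoH1 D φ v := by
  obtain ⟨G, hG, h1, h2⟩ := h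
  refine ⟨G, hG.congr huv, h1.congr fun j => eLpNorm_congr_ae ?_, h2⟩
  filter_upwards [huv] with x hx
  simp [hx]

theorem tendsto_eLpNorm_sub {μ : Measure (Space m)} {f g : ℕ → Space m → ℂ} {u v : Space m → ℂ}
    (hf : ∀ j, AEStronglyMeasurable (f j - u) μ) (hg : ∀ j, AEStronglyMeasurable (g j - v) μ)
    (h : Tendsto (fun j => eLpNorm (f j - u) 2 μ) atTop (𝓝 0))
    (h' : Tendsto (fun j => eLpNorm (g j - v) 2 μ) atTop (𝓝 0)) :
    Tendsto (fun j => eLpNorm ((f j - g j) - (u - v)) 2 μ) atTop (𝓝 0) := by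
  have h0 := h.add h'
  rw [add_zero] at h0
  refine tendsto_of_tendsto_of_tendsto_of_le_of_le tendsto_const_nhds h0 (fun _ => zero_le)
    fun j => ?_
  have e : (f j - g j) - (u - v) = (f j - u) - (g j - v) := by abel
  simp only [e]
  exact eLpNorm_sub_le (hf j) (hg j) (by norm_num)

theorem TendstoH1.sub {D : Set (Space m)} {φ ψ : ℕ → Space m → ℂ} {u v : Space m → ℂ}
    (hφ : ∀ j, ContDiff ℝ (⊤ : ℕ∞) (φ j)) (hψ : ∀ j, ContDiff ℝ (⊤ : ℕ∞) (ψ j))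
    (h : TendstoH1 D φ u) (h' : TendstoH1 D ψ v) : TendstoH1 D (fun j => φ j - ψ j) (u - v) := by
  obtain ⟨G, hG, h1, h2⟩ := h
  obtain ⟨G', hG', h1', h2'⟩ := h'
  refine ⟨_, hG.sub hG', tendsto_eLpNorm_sub
    (fun j => (hφ j).continuous.aestronglyMeasurable.sub hG.memLp.1)
    (fun j => (hψ j).continuous.aestronglyMeasurable.sub hG'.memLp.1) h1 h1', fun i => ?_⟩
  have e : ∀ j, partialDeriv i (φ j - ψ j) = partialDeriv i (φ j) - partialDeriv i (ψ j) :=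
    fun j => funext fun x => partialDeriv_sub ((hφ j).differentiable (by simp) x)
      ((hψ j).differentiable (by simp) x) i
  simp only [e]
  exact tendsto_eLpNorm_sub
    (fun j => (contDiff_partialDeriv (hφ j) i).continuous.aestronglyMeasurable.sub
      (hG.memLp_grad i).1)
    (fun j => (contDiff_partialDeriv (hψ j) i).continuous.aestronglyMeasurable.sub
      (hG'.memLp_grad i).1) (h2 i) (h2' i)

theorem IsTrace.mono {D D' S : Set (Space m)} {u f : Space m → ℂ} (h : IsTrace D S u f)
    (hD : D' ⊆ D) : IsTrace D' S u f := by
  obtain ⟨hf, φ, hφ, h1, h2⟩ := h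
  exact ⟨hf, φ, hφ, fun R => (h1 R).mono (Set.inter_subset_inter_left _ hD), h2⟩

theorem IsTrace.sub {D S : Set (Space m)} {u v f g : Space m → ℂ} (h : IsTrace D S u f)
    (h' : IsTrace D S v g) : IsTrace D S (u - v) (f - g) := by
  obtain ⟨hf, φ, hφ, h1, h2⟩ := h
  obtain ⟨hg, ψ, hψ, h1', h2'⟩ := h'
  exact ⟨hf.sub hg, fun j => φ j - ψ j, fun j => (hφ j).sub (hψ j),
    fun R => (h1 R).sub hφ hψ (h1' R), tendsto_eLpNorm_sub
      (fun j => (hφ j).continuous.aestronglyMeasurable.sub hf.1)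
      (fun j => (hψ j).continuous.aestronglyMeasurable.sub hg.1) h2 h2'⟩

theorem IsTrace.congr_trace {D S : Set (Space m)} {u f g : Space m → ℂ} (h : IsTrace D S u f)
    (hfg : f =ᵐ[surfaceMeasure S] g) : IsTrace D S u g := by
  obtain ⟨hf, φ, hφ, h1, h2⟩ := h
  refine ⟨(memLp_congr_ae hfg).1 hf, φ, hφ, h1, h2.congr fun j => eLpNorm_congr_ae ?_⟩
  filter_upwards [hfg] with x hx
  simp [hx]

/-- The trace of a continuously differentiable function is its restriction: its mollifications
converge in `H¹` and uniformly, and uniform convergence implies convergence in `L²` as the surface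
measure is finite. -/
theorem isTrace_of_contDiff {D S : Set (Space m)} (hD : Bornology.IsBounded D)
    (hS : Bornology.IsBounded S) (hSm : MeasurableSet S) (hfin : IsFiniteMeasure (surfaceMeasure S))
    {u : Space m → ℂ} (hu : ContDiff ℝ 1 u) : IsTrace D S u u := by
  obtain ⟨R, hR⟩ := (hD.union hS).subset_closedBall (0 : Space m)
  obtain ⟨χ, hχ, hχc, hχs, hχ1⟩ := exists_smooth_cutoff
    (isCompact_closedBall (0 : Space m) R) Metric.isOpen_ball
    (Metric.closedBall_subset_ball (lt_add_one R))
  have hχT : IsTestFunction (Metric.ball 0 (R + 1)) (fun x => ((χ x : ℝ) : ℂ)) :=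
    ⟨Complex.ofRealCLM.contDiff.comp hχ, hχc.comp_left (g := fun r : ℝ => (r : ℂ)) (by simp),
      (closure_mono (fun x hx h => hx (by simp [h]) :
        Function.support (fun x => ((χ x : ℝ) : ℂ)) ⊆ Function.support χ)).trans hχs⟩
  have hχ1' : ∀ x ∈ D ∪ S, χ x = 1 := fun x hx =>
    ((eventually_nhdsSet_iff_forall.1 hχ1) x (hR hx)).self_of_nhds
  set v : Space m → ℂ := fun x => u x * ((χ x : ℝ) : ℂ) with hv
  have hvu : ∀ x ∈ D ∪ S, v x = u x := fun x hx => by simp [hv, hχ1' x hx]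
  have hvG := (hasWeakGradient_of_contDiff hu Metric.isBounded_ball).testFunction_mul
    Metric.isOpen_ball hχT
  have hvc : Continuous v := hu.continuous.mul hχT.smooth.continuous
  have hvs : HasCompactSupport v := hχT.compact.mul_left
  have hvl : LocallyIntegrable v := hvc.locallyIntegrable
  have hvS : v =ᵐ[surfaceMeasure S] u := by
    rw [surfaceMeasure, Filter.EventuallyEq, ae_restrict_iff' hSm]
    exact Eventually.of_forall fun x hx => hvu x (Or.inr hx)
  have hT : IsTrace D S u v := by
    refine ⟨?_, fun j => mollify j v, fun j => contDiff_mollify j hvl, fun r => ?_, ?_⟩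
    · obtain ⟨C, hC⟩ := hvc.bounded_above_of_compact_support hvs
      exact MemLp.of_bound hvc.aestronglyMeasurable C (Eventually.of_forall hC)
    · refine ((tendstoH1_mollify hvG).mono (Set.subset_univ _)).congr ?_
      exact (ae_restrict_iff (isClosed_eq hvc hu.continuous).measurableSet).2
        (Eventually.of_forall fun x hx => hvu x (Or.inl hx.1))
    · refine tendsto_eLpNorm_of_uniform fun ε hε => ?_
      simpa [dist_eq_norm] using eventually_dist_mollify_le hvc hvs hε
  exact hT.congr_trace hvS

/-- A function of `H¹` on the full space which vanishes near the surface has trace zero. -/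
theorem isTrace_zero {D S K : Set (Space m)} (hK : IsCompact K) (hS : IsClosed S)
    (hKS : Disjoint K S) {u : Space m → ℂ} {G : Fin m → Space m → ℂ}
    (h : HasWeakGradient Set.univ u G) (hu : ∀ x ∉ K, u x = 0) : IsTrace D S u 0 := by
  have hul : LocallyIntegrable u := by
    have := h.memLp
    rw [Measure.restrict_univ] at this
    exact this.locallyIntegrable (by norm_num)
  obtain ⟨δ, hδ, hdisj⟩ := hKS.exists_thickenings hK hS
  obtain ⟨N, hN⟩ := exists_nat_one_div_lt hδ
  have hz : ∀ j, ∀ x ∈ S, mollify (N + j) u x = 0 := fun j x hx => by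
    refine mollify_eq_zero _ hu fun hxK => ?_
    have hle : 1 / (((N + j : ℕ) : ℝ) + 1) ≤ δ := by
      refine le_trans ?_ hN.le
      gcongr
      linarith [(Nat.cast_nonneg j : (0 : ℝ) ≤ j)]
    exact Set.disjoint_left.1 hdisj (Metric.thickening_mono hle _ hxK)
      (Metric.self_subset_thickening hδ _ hx)
  obtain ⟨G', hG', h1, h2⟩ := tendstoH1_mollify h
  have hs : Tendsto (fun j : ℕ => N + j) atTop atTop := by
    simpa [add_comm] using tendsto_add_atTop_nat N
  refine ⟨MemLp.zero, fun j => mollify (N + j) u, fun j => contDiff_mollify _ hul, fun R => ?_, ?_⟩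
  · exact TendstoH1.mono (D := Set.univ) ⟨G', hG', h1.comp hs, fun i => (h2 i).comp hs⟩
      (Set.subset_univ _)
  · refine tendsto_const_nhds.congr fun j => ?_
    rw [sub_zero, ← eLpNorm_zero (p := 2) (μ := surfaceMeasure S) (ε := ℂ)]
    refine eLpNorm_congr_ae ?_
    rw [surfaceMeasure, Filter.EventuallyEq, ae_restrict_iff' hS.measurableSet]
    exact Eventually.of_forall fun x hx => (hz j x hx).symm

/-! ### Distributional solutions of the Helmholtz equation -/

section Helmholtz

variable {k : ℝ} {n n' : Space m → ℝ} {D D' : Set (Space m)} {u v : Space m → ℂ}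

theorem IsTestFunction.integrable_helmholtz (hn : Measurable n) (hnb : ∃ C, ∀ x, |n x| ≤ C)
    (hu : ∀ R, MemLp u 2 (volume.restrict (D ∩ Metric.ball 0 R))) {φ : Space m → ℂ}
    (hφ : IsTestFunction D φ) : Integrable fun x =>
      u x * (Laplacian.laplacian φ x + ((k ^ 2 * n x ^ 2 : ℝ) : ℂ) * φ x) := by
  obtain ⟨R, hφR⟩ := hφ.exists_ball
  refine ((hφR.laplacian.integrable_mul (hu R)).add
    (hφR.integrable_mul (memLp_index_mul (k := k) hn hnb (hu R)))).congr
    (Eventually.of_forall fun x => ?_)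
  simp only [Pi.add_apply]
  ring

theorem SolvesHelmholtz.sub (hn : Measurable n) (hnb : ∃ C, ∀ x, |n x| ≤ C)
    (hu : ∀ R, MemLp u 2 (volume.restrict (D ∩ Metric.ball 0 R)))
    (hv : ∀ R, MemLp v 2 (volume.restrict (D ∩ Metric.ball 0 R)))
    (h : SolvesHelmholtz k n D u) (h' : SolvesHelmholtz k n D v) :
    SolvesHelmholtz k n D (u - v) := by
  refine solvesHelmholtz_iff_integral.2 fun φ hφ => ?_
  simp only [Pi.sub_apply, sub_mul]
  rw [integral_sub (hφ.integrable_helmholtz hn hnb hu) (hφ.integrable_helmholtz hn hnb hv),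
    solvesHelmholtz_iff_integral.1 h φ hφ, solvesHelmholtz_iff_integral.1 h' φ hφ, sub_zero]

theorem SolvesHelmholtz.add (hn : Measurable n) (hnb : ∃ C, ∀ x, |n x| ≤ C)
    (hu : ∀ R, MemLp u 2 (volume.restrict (D ∩ Metric.ball 0 R)))
    (hv : ∀ R, MemLp v 2 (volume.restrict (D ∩ Metric.ball 0 R)))
    (h : SolvesHelmholtz k n D u) (h' : SolvesHelmholtz k n D v) :
    SolvesHelmholtz k n D (u + v) := by
  refine solvesHelmholtz_iff_integral.2 fun φ hφ => ?_
  simp only [Pi.add_apply, add_mul]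
  rw [integral_add (hφ.integrable_helmholtz hn hnb hu) (hφ.integrable_helmholtz hn hnb hv),
    solvesHelmholtz_iff_integral.1 h φ hφ, solvesHelmholtz_iff_integral.1 h' φ hφ, add_zero]

theorem SolvesHelmholtz.congr (h : SolvesHelmholtz k n D u)
    (huv : u =ᵐ[volume.restrict D] v) : SolvesHelmholtz k n D v := fun φ hφ => by
  rw [← h φ hφ]
  refine integral_congr_ae ?_
  filter_upwards [huv] with x hx
  rw [hx]

theorem SolvesHelmholtz.congr_index (h : SolvesHelmholtz k n D u) (hnn : ∀ x ∈ D, n x = n' x) :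
    SolvesHelmholtz k n' D u := by
  refine solvesHelmholtz_iff_integral.2 fun φ hφ => ?_
  rw [← solvesHelmholtz_iff_integral.1 h φ hφ]
  refine integral_congr_ae (Eventually.of_forall fun x => ?_)
  by_cases hx : x ∈ D
  · simp only [hnn x hx]
  · simp only [hφ.eq_zero hx, mul_zero]

/-- Being a distributional solution is a local property. -/
theorem SolvesHelmholtz.union (hn : Measurable n) (hnb : ∃ C, ∀ x, |n x| ≤ C) (hD : IsOpen D)
    (hD' : IsOpen D') (hu : ∀ R, MemLp u 2 (volume.restrict (D ∩ Metric.ball 0 R)))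
    (hu' : ∀ R, MemLp u 2 (volume.restrict (D' ∩ Metric.ball 0 R)))
    (h : SolvesHelmholtz k n D u) (h' : SolvesHelmholtz k n D' u) :
    SolvesHelmholtz k n (D ∪ D') u := by
  refine solvesHelmholtz_iff_integral.2 fun φ hφ => ?_
  obtain ⟨φ₁, φ₂, hφ₁, hφ₂, rfl⟩ := hφ.exists_add hD hD'
  have hp : ∀ {f : Space m → ℂ}, IsTestFunction D f ∨ IsTestFunction D' f →
      ContDiff ℝ (⊤ : ℕ∞) f := fun hf => hf.elim (·.smooth) (·.smooth)
  have e : ∀ x, Laplacian.laplacian (fun x => φ₁ x + φ₂ x) x =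
      Laplacian.laplacian φ₁ x + Laplacian.laplacian φ₂ x := fun x => by
    have h1 : ContDiffAt ℝ 2 φ₁ x := (hφ₁.smooth.of_le (by norm_cast)).contDiffAt
    have h2 : ContDiffAt ℝ 2 φ₂ x := (hφ₂.smooth.of_le (by norm_cast)).contDiffAt
    exact h1.laplacian_add h2
  have e' : ∀ x, u x * (Laplacian.laplacian (fun x => φ₁ x + φ₂ x) x +
      ((k ^ 2 * n x ^ 2 : ℝ) : ℂ) * (φ₁ x + φ₂ x)) =
      u x * (Laplacian.laplacian φ₁ x + ((k ^ 2 * n x ^ 2 : ℝ) : ℂ) * φ₁ x) +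
      u x * (Laplacian.laplacian φ₂ x + ((k ^ 2 * n x ^ 2 : ℝ) : ℂ) * φ₂ x) := fun x => by
    rw [e]; ring
  rw [integral_congr_ae (Eventually.of_forall e'),
    integral_add (hφ₁.integrable_helmholtz hn hnb hu) (hφ₂.integrable_helmholtz hn hnb hu'),
    solvesHelmholtz_iff_integral.1 h φ₁ hφ₁, solvesHelmholtz_iff_integral.1 h' φ₂ hφ₂, add_zero]

end Helmholtz

/-- A classical solution is a distributional solution, by Green's second identity. -/
theorem IsIncidentWave.solvesHelmholtz {k : ℝ} {uinc : Space m → ℂ} (h : IsIncidentWave k uinc)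
    (D : Set (Space m)) : SolvesHelmholtz k (fun _ => 1) D uinc := by
  refine solvesHelmholtz_iff_integral.2 fun φ hφD => ?_
  have hφ := hφD.mono (Set.subset_univ D)
  have hu1 : ContDiffOn ℝ 1 uinc Set.univ := (h.contDiff.of_le (by norm_num)).contDiffOn
  have hd1 : ∀ i, ContDiff ℝ 1 (partialDeriv i uinc) := fun i =>
    (h.contDiff.fderiv_right (m := 1) (by norm_num)).clm_apply contDiff_const
  have hint : ∀ {w ψ : Space m → ℂ}, Continuous w → IsTestFunction Set.univ ψ →
      Integrable (fun x => w x * ψ x) := fun hw hψ =>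
    (hw.mul hψ.smooth.continuous).integrable_of_hasCompactSupport hψ.compact.mul_left
  have hdd : ∀ i, Continuous (partialDeriv i (partialDeriv i uinc)) := fun i =>
    ((hd1 i).continuous_fderiv one_ne_zero).clm_apply continuous_const
  have h1 : ∀ i, ∫ x, uinc x * partialDeriv i (partialDeriv i φ) x =
      ∫ x, partialDeriv i (partialDeriv i uinc) x * φ x := fun i => by
    rw [integral_mul_partialDeriv isOpen_univ hu1 (hφ.partialDeriv i),
      integral_mul_partialDeriv isOpen_univ (hd1 i).contDiffOn hφ, neg_neg]
  have e1 : ∫ x, uinc x * Laplacian.laplacian φ x = ∫ x, Laplacian.laplacian uinc x * φ x := by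
    simp only [laplacian_eq_sum_partialDeriv (hφ.smooth.of_le (by norm_cast)),
      laplacian_eq_sum_partialDeriv h.contDiff, Finset.mul_sum, Finset.sum_mul]
    rw [integral_finsetSum _ fun i _ => hint h.contDiff.continuous
      ((hφ.partialDeriv i).partialDeriv i), integral_finsetSum _ fun i _ => hint (hdd i) hφ]
    exact Finset.sum_congr rfl fun i _ => h1 i
  have e2 : ∀ x, Laplacian.laplacian uinc x * φ x = - (((k ^ 2 : ℝ) : ℂ) * (uinc x * φ x)) :=
    fun x => by linear_combination (h.helmholtz x) * φ x
  have e3 : ∀ x, uinc x * (Laplacian.laplacian φ x + ((k ^ 2 * (1 : ℝ) ^ 2 : ℝ) : ℂ) * φ x) =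
      uinc x * Laplacian.laplacian φ x + ((k ^ 2 : ℝ) : ℂ) * (uinc x * φ x) := fun x => by
    rw [one_pow, mul_one]; ring
  rw [integral_congr_ae (Eventually.of_forall e3), integral_add
    (hint h.contDiff.continuous hφ.laplacian) ((hint h.contDiff.continuous hφ).const_mul _), e1,
    integral_congr_ae (Eventually.of_forall e2), integral_neg]
  ring

/-! ### Unique continuation in connected open sets -/

theorem laplacian_comp_sub {φ : Space m → ℂ} (hφ : ContDiff ℝ 2 φ) (y x : Space m) :
    Laplacian.laplacian (fun x => φ (x - y)) x = Laplacian.laplacian φ (x - y) := by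
  have h1 : ∀ (ψ : Space m → ℂ) (i : Fin m),
      partialDeriv i (fun x => ψ (x - y)) = fun x => partialDeriv i ψ (x - y) := fun ψ i => by
    ext x
    rw [partialDeriv, fderiv_comp_sub, partialDeriv]
  have h2 : ContDiff ℝ 2 (fun x => φ (x - y)) := hφ.comp (contDiff_id.sub contDiff_const)
  rw [laplacian_eq_sum_partialDeriv hφ, laplacian_eq_sum_partialDeriv h2]
  simp only [h1]

theorem SolvesHelmholtz.translate {k ρ : ℝ} {y : Space m} {d : Space m → ℂ}
    (h : SolvesHelmholtz k (fun _ => 1) (Metric.ball y ρ) d) :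
    SolvesHelmholtz k (fun _ => 1) (Metric.ball 0 ρ) (fun x => d (x + y)) := by
  refine solvesHelmholtz_iff_integral.2 fun φ hφ => ?_
  have hts : tsupport (fun x => φ (x - y)) ⊆ (fun x => x - y) ⁻¹' tsupport φ :=
    closure_minimal (fun x hx => subset_tsupport φ hx)
      ((isClosed_tsupport φ).preimage (continuous_id.sub continuous_const))
  have hφ' : IsTestFunction (Metric.ball y ρ) (fun x => φ (x - y)) :=
    ⟨hφ.smooth.comp (contDiff_id.sub contDiff_const),
      hφ.compact.comp_homeomorph (Homeomorph.subRight y), fun x hx => by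
        simpa [dist_eq_norm] using hφ.support_subset (hts hx)⟩
  have key := solvesHelmholtz_iff_integral.1 h _ hφ'
  simp only [laplacian_comp_sub (hφ.smooth.of_le (by norm_cast))] at key
  rw [← integral_add_right_eq_self (fun x => d x * _) y] at key
  simpa only [add_sub_cancel_right] using key

theorem LocallyIntegrable.comp_add_right {d : Space m → ℂ} (hd : LocallyIntegrable d)
    (y : Space m) : LocallyIntegrable (fun x => d (x + y)) := fun x => by
  obtain ⟨s, hs, hds⟩ := hd (x + y)
  refine ⟨(fun x => x + y) ⁻¹' s,
    (continuous_id.add continuous_const).continuousAt.preimage_mem_nhds hs, ?_⟩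
  exact ((measurePreserving_add_right volume y).integrableOn_comp_preimage
    (MeasurableEquiv.addRight y).measurableEmbedding).2 hds

theorem ae_eq_zero_of_helmholtz_ball {k : ℝ} {d : Space m → ℂ} (hloc : LocallyIntegrable d)
    {y : Space m} {δ ρ : ℝ} (hδ : 0 < δ) (hρ : 0 < ρ)
    (hd : SolvesHelmholtz k (fun _ => 1) (Metric.ball y ρ) d)
    (h0 : ∀ᵐ x, x ∈ Metric.ball y δ → d x = 0) : ∀ᵐ x, x ∈ Metric.ball y ρ → d x = 0 := by
  have h1 := ae_eq_zero_of_helmholtz_ball_zero (LocallyIntegrable.comp_add_right hloc y) hδ hρ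
    hd.translate (by
      filter_upwards [(measurePreserving_add_right volume y).quasiMeasurePreserving.ae h0]
        with x hx hxδ
      exact hx (by simpa [dist_eq_norm] using hxδ))
  have h2 := (measurePreserving_sub_right volume y).quasiMeasurePreserving.ae h1
  filter_upwards [h2] with x hx hxρ
  simpa using hx (by simpa [dist_eq_norm] using hxρ)

/-- Unique continuation: the set of the points near which `d` vanishes is open, and by unique
continuation in balls it is relatively closed in `U`. -/
theorem ae_eq_zero_of_helmholtz_preconnected {k : ℝ} {d : Space m → ℂ}
    (hloc : LocallyIntegrable d) {U : Set (Space m)} (hU : IsOpen U) (hconn : IsPreconnected U)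
    (hd : SolvesHelmholtz k (fun _ => 1) U d) {y : Space m} (hy : y ∈ U) {δ : ℝ} (hδ : 0 < δ)
    (h0 : ∀ᵐ x, x ∈ Metric.ball y δ → d x = 0) : ∀ᵐ x, x ∈ U → d x = 0 := by
  -- the set of the points near which `d` vanishes
  set A : Set (Space m) := {z | ∃ δ > 0, ∀ᵐ x, x ∈ Metric.ball z δ → d x = 0} with hA
  have hstep : ∀ {z z' : Space m} {r : ℝ}, (∀ᵐ x, x ∈ Metric.ball z r → d x = 0) →
      z' ∈ Metric.ball z r → z' ∈ A := fun h hz' => by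
    obtain ⟨ε, hε, hsub⟩ := Metric.isOpen_iff.1 Metric.isOpen_ball _ hz'
    exact ⟨ε, hε, h.mono fun x hx hxε => hx (hsub hxε)⟩
  have hAo : IsOpen A := Metric.isOpen_iff.2 fun z hz => by
    obtain ⟨r, hr, h⟩ := hz
    exact ⟨r, hr, fun z' hz' => hstep h hz'⟩
  have hUA : U ⊆ A := by
    refine hconn.subset_of_closure_inter_subset hAo ⟨y, hy, δ, hδ, h0⟩ fun z hz => ?_
    obtain ⟨ρ, hρ, hρU⟩ := Metric.isOpen_iff.1 hU z hz.2
    obtain ⟨a, ⟨r, hr, har⟩, haz⟩ := Metric.mem_closure_iff.1 hz.1 (ρ / 2) (half_pos hρ)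
    have hsub : Metric.ball a (ρ / 2) ⊆ U := fun x hx => hρU (by
      have := dist_triangle x a z
      rw [dist_comm a z] at this
      rw [Metric.mem_ball] at hx ⊢
      linarith)
    exact hstep (ae_eq_zero_of_helmholtz_ball hloc hr (half_pos hρ) (hd.mono hsub) har) haz
  have hnull : volume {x | ¬ (x ∈ U → d x = 0)} = 0 := by
    refine measure_null_of_locally_null _ fun z hz => ?_
    have hzU : z ∈ U := by
      by_contra hcon
      exact hz fun h => absurd h hcon
    obtain ⟨r, hr, h⟩ := hUA hzU
    refine ⟨{x | ¬ (x ∈ U → d x = 0)} ∩ Metric.ball z r,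
      inter_mem self_mem_nhdsWithin (mem_nhdsWithin_of_mem_nhds (Metric.ball_mem_nhds z hr)), ?_⟩
    refine measure_mono_null (?_ : _ ⊆ {x | ¬ (x ∈ Metric.ball z r → d x = 0)}) (ae_iff.1 h)
    exact fun x hx hcon => hx.1 fun _ => hcon hx.2
  exact ae_iff.2 hnull

/-! ### Uniqueness for the scattering problem in the full space -/

theorem MemH1loc.locallyIntegrable {d : Space m → ℂ} (hd : MemH1loc Set.univ d) :
    LocallyIntegrable d := fun x => by
  refine ⟨Metric.ball 0 (‖x‖ + 1), Metric.isOpen_ball.mem_nhds (by simp), ?_⟩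
  have : IsFiniteMeasure (volume.restrict (Metric.ball (0 : Space m) (‖x‖ + 1))) :=
    ⟨by simpa using Metric.isBounded_ball.measure_lt_top⟩
  exact (hd.memLp (‖x‖ + 1)).integrable (by norm_num)

theorem MemH1loc.sub {D : Set (Space m)} {u v : Space m → ℂ} (hu : MemH1loc D u)
    (hv : MemH1loc D v) : MemH1loc D (u - v) := fun R => by
  obtain ⟨G, hG⟩ := hu R
  obtain ⟨G', hG'⟩ := hv R
  exact ⟨_, hG.sub hG'⟩

theorem IsRadiating.sub {k : ℝ} {u u' : Space m → ℂ} (h : IsRadiating k u)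
    (h' : IsRadiating k u') : IsRadiating k (u - u') := by
  obtain ⟨R, v, hv, huv, ho⟩ := h
  obtain ⟨R', v', hv', huv', ho'⟩ := h'
  have hs : {x : Space m | max R R' < ‖x‖} ⊆ {x | R < ‖x‖} :=
    fun x hx => (le_max_left R R').trans_lt hx
  have hs' : {x : Space m | max R R' < ‖x‖} ⊆ {x | R' < ‖x‖} :=
    fun x hx => (le_max_right R R').trans_lt hx
  refine ⟨max R R', v - v', (hv.mono hs).sub (hv'.mono hs'), ?_, ?_⟩
  · filter_upwards [ae_restrict_of_ae_restrict_of_subset hs huv,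
      ae_restrict_of_ae_restrict_of_subset hs' huv'] with x hx hx'
    simp [hx, hx']
  · refine (ho.sub ho').congr' ?_ EventuallyEq.rfl
    refine Filter.hasBasis_cobounded_norm.eventually_iff.2 ⟨max R R' + 1, trivial, fun x hx => ?_⟩
    have hx' : max R R' < ‖x‖ := by
      have : max R R' + 1 ≤ ‖x‖ := hx
      linarith
    have d1 : DifferentiableAt ℝ v x := (hv.differentiableOn one_ne_zero).differentiableAt
      ((isOpen_lt continuous_const continuous_norm).mem_nhds (hs hx'))
    have d2 : DifferentiableAt ℝ v' x := (hv'.differentiableOn one_ne_zero).differentiableAt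
      ((isOpen_lt continuous_const continuous_norm).mem_nhds (hs' hx'))
    simp only [fderiv_sub d1 d2, _root_.sub_apply, Pi.sub_apply]
    ring

theorem IsRadiating.congr {k : ℝ} {u u' : Space m → ℂ} (h : IsRadiating k u) {R : ℝ}
    (hu : ∀ᵐ x ∂(volume.restrict {x : Space m | R < ‖x‖}), u x = u' x) : IsRadiating k u' := by
  obtain ⟨R', v, hv, huv, ho⟩ := h
  have hs : {x : Space m | max R R' < ‖x‖} ⊆ {x | R < ‖x‖} :=
    fun x hx => (le_max_left R R').trans_lt hx
  have hs' : {x : Space m | max R R' < ‖x‖} ⊆ {x | R' < ‖x‖} :=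
    fun x hx => (le_max_right R R').trans_lt hx
  refine ⟨max R R', v, hv.mono hs', ?_, ho⟩
  filter_upwards [ae_restrict_of_ae_restrict_of_subset hs hu,
    ae_restrict_of_ae_restrict_of_subset hs' huv] with x hx hx'
  rw [← hx, hx']

/-- A function of `H¹` on the full space which solves the Helmholtz equation and vanishes off a
compact subset of `Ω₂` is a solution of the homogeneous Dirichlet problem in `Ω₂`. -/
theorem InteriorUniquelySolvable.ae_eq_zero {k : ℝ} {n : Space m → ℝ} {Ω₂ K : Set (Space m)}
    (hint : InteriorUniquelySolvable k n Ω₂) (hΩ₂ : IsOpen Ω₂) (hK : IsCompact K) (hKΩ : K ⊆ Ω₂)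
    {d : Space m → ℂ} {G : Fin m → Space m → ℂ} (hG : HasWeakGradient Set.univ d G)
    (hd : SolvesHelmholtz k n Ω₂ d) (h0 : ∀ x ∉ K, d x = 0) :
    ∀ᵐ x ∂(volume.restrict Ω₂), d x = 0 := by
  have hdisj : Disjoint K (frontier Ω₂) :=
    Set.disjoint_left.2 fun x hx hxf => by
      rw [hΩ₂.frontier_eq] at hxf
      exact hxf.2 (hKΩ hx)
  have hGΩ := hG.mono (Set.subset_univ Ω₂)
  have htr : IsTrace Ω₂ (frontier Ω₂) d 0 := isTrace_zero hK isClosed_frontier hdisj hG h0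
  -- the zero function is the other solution of the same problem
  have htr0 : IsTrace Ω₂ (frontier Ω₂) 0 0 := by simpa using htr.sub htr
  have hH0 : MemH1 Ω₂ (0 : Space m → ℂ) := ⟨_, by simpa using hGΩ.sub hGΩ⟩
  exact (hint 0 ⟨d, ⟨G, hGΩ⟩, htr⟩).2 d 0 ⟨⟨G, hGΩ⟩, hd, htr⟩
    ⟨hH0, fun φ _ => by simp, htr0⟩

/-- Uniqueness of the total field. The difference of two total fields vanishes far out by Rellich's
lemma, in the exterior of `Ω₁` by unique continuation, and in `Ω₂` by the unique solvability of the
interior problem. -/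
theorem IsTotalField.ae_eq {k : ℝ} (hk : 0 < k) (hm : 1 ≤ m) {n : Space m → ℝ} (hn : Measurable n)
    (hnb : ∃ C, ∀ x, |n x| ≤ C) {Ω₁ Ω₂ : Set (Space m)} (hΩ₂ : IsOpen Ω₂)
    (hΩ₂b : Bornology.IsBounded Ω₂) (h12 : closure Ω₁ ⊆ Ω₂) (hconn : IsConnected (exterior Ω₁))
    (hn1 : ∀ x ∈ exterior Ω₁, n x = 1) (hint : InteriorUniquelySolvable k n Ω₂)
    {uinc u u' : Space m → ℂ} (hu : IsTotalField k n uinc u) (hu' : IsTotalField k n uinc u') :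
    ∀ᵐ x, u' x = u x := by
  set d : Space m → ℂ := u' - u with hddef
  have hd1 : MemH1loc Set.univ d := hu'.memH1loc.sub hu.memH1loc
  have hd2 : SolvesHelmholtz k n Set.univ d := SolvesHelmholtz.sub hn hnb
    (fun R => by simpa using hu'.memH1loc.memLp R) (fun R => by simpa using hu.memH1loc.memLp R)
    hu'.helmholtz hu.helmholtz
  have hd3 : IsRadiating k d := by simpa [hddef] using hu'.radiating.sub hu.radiating
  have hloc := hd1.locallyIntegrable
  have hext : IsOpen (exterior Ω₁) := isClosed_closure.isOpen_compl
  have hK : IsCompact (closure Ω₁) :=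
    Metric.isCompact_of_isClosed_isBounded isClosed_closure (hΩ₂b.subset h12)
  have hdext : SolvesHelmholtz k (fun _ => 1) (exterior Ω₁) d :=
    (hd2.mono (Set.subset_univ _)).congr_index hn1
  obtain ⟨R, hR0, hR⟩ : ∃ R : ℝ, 0 ≤ R ∧ Ω₂ ⊆ Metric.closedBall 0 R := by
    obtain ⟨R, hR⟩ := hΩ₂b.subset_closedBall (0 : Space m)
    exact ⟨max R 0, le_max_right _ _,
      hR.trans (Metric.closedBall_subset_closedBall (le_max_left _ _))⟩
  have hRext : {x : Space m | R < ‖x‖} ⊆ exterior Ω₁ := fun x hx hxΩ => by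
    have : ‖x‖ ≤ R := by simpa using hR (h12 hxΩ)
    exact absurd hx (not_lt.2 this)
  -- Rellich's lemma
  have hfar : ∀ᵐ x, R < ‖x‖ → d x = 0 :=
    ae_eq_zero_of_helmholtz_exterior hk hm hloc hR0 (hdext.mono hRext)
      (tendsto_integral_shell hm hd1 (tendsto_integral_shell_sq hk hm hn hnb hd1 hd2 hd3))
  -- unique continuation
  have hdz : ∀ᵐ x, x ∈ exterior Ω₁ → d x = 0 := by
    have : Nonempty (Fin m) := ⟨⟨0, hm⟩⟩
    obtain ⟨y, hy⟩ := NormedSpace.exists_lt_norm ℝ (Space m) (R + 1)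
    refine ae_eq_zero_of_helmholtz_preconnected hloc hext hconn.isPreconnected hdext
      (y := y) (hRext (show R < ‖y‖ by linarith)) one_pos ?_
    filter_upwards [hfar] with x hx hxy
    refine hx ?_
    rw [Metric.mem_ball, dist_comm, dist_eq_norm] at hxy
    linarith [norm_sub_norm_le y x]
  -- a representative of `d` which vanishes everywhere off `closure Ω₁`, not just almost everywhere
  set d₀ : Space m → ℂ := (closure Ω₁).indicator d with hd₀
  have hdd₀ : ∀ᵐ x, d x = d₀ x := by
    filter_upwards [hdz] with x hx
    by_cases hxΩ : x ∈ closure Ω₁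
    · rw [hd₀, Set.indicator_of_mem hxΩ]
    · rw [hd₀, Set.indicator_of_notMem hxΩ, hx hxΩ]
  obtain ⟨G, hG⟩ : ∃ G, HasWeakGradient Set.univ d₀ G := by
    obtain ⟨G, hG⟩ := hd1 (R + 1)
    rw [Set.univ_inter] at hG
    obtain ⟨χ, hχ, hχc, hχs, hχ1⟩ := exists_smooth_cutoff hK Metric.isOpen_ball
      (h12.trans (hR.trans (Metric.closedBall_subset_ball (lt_add_one R))))
    have hχT : IsTestFunction (Metric.ball 0 (R + 1)) (fun x => ((χ x : ℝ) : ℂ)) :=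
      ⟨Complex.ofRealCLM.contDiff.comp hχ, hχc.comp_left (g := fun r : ℝ => (r : ℂ)) (by simp),
        (closure_mono (fun x hx h => hx (by simp [h]) :
          Function.support (fun x => ((χ x : ℝ) : ℂ)) ⊆ Function.support χ)).trans hχs⟩
    -- `d₀` agrees with `d χ`, to which the product rule applies
    refine ⟨_, (hG.testFunction_mul Metric.isOpen_ball hχT).congr ?_⟩
    rw [Measure.restrict_univ]
    filter_upwards [hdd₀] with x hx
    by_cases hxΩ : x ∈ closure Ω₁
    · have : χ x = 1 := ((eventually_nhdsSet_iff_forall.1 hχ1) x hxΩ).self_of_nhds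
      rw [hx, this, Complex.ofReal_one, mul_one]
    · rw [hx, hd₀, Set.indicator_of_notMem hxΩ, zero_mul]
  have h0 := hint.ae_eq_zero hΩ₂ hK h12 hG
    ((hd2.mono (Set.subset_univ Ω₂)).congr (ae_restrict_of_ae hdd₀))
    fun x hx => Set.indicator_of_notMem hx _
  rw [ae_restrict_iff' hΩ₂.measurableSet] at h0
  filter_upwards [hdd₀, hdz, h0] with x hx hx1 hx2
  refine sub_eq_zero.1 (?_ : d x = 0)
  by_cases hxΩ : x ∈ Ω₂
  · rw [hx, hx2 hxΩ]
  · exact hx1 fun h => hxΩ (h12 h)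

/-! ### The overlapping decomposition -/

/-- The interior and the exterior field agree on the overlap: their difference solves the
homogeneous Dirichlet problem there. -/
theorem SolvesInterfaceSystem.ae_eq {k : ℝ} {n : Space m → ℝ} {Ω₁ Ω₂ : Set (Space m)}
    {uinc fSig fGam w ω : Space m → ℂ} (hm : 1 ≤ m) (hΩ₂b : Bornology.IsBounded Ω₂)
    (h12 : closure Ω₁ ⊆ Ω₂) (hGam : HasSmoothBoundary Ω₁) (hSig : HasLipschitzBoundary Ω₂)
    (hn1 : ∀ x ∈ exterior Ω₁, n x = 1) (hoverlap : OverlapDirichletUnique k Ω₁ Ω₂)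
    (huinc : IsIncidentWave k uinc) (h : SolvesInterfaceSystem k n Ω₁ Ω₂ uinc fSig fGam w ω) :
    ∀ᵐ x ∂(volume.restrict (exterior Ω₁ ∩ Ω₂)), w x = ω x + uinc x := by
  have hb : Bornology.IsBounded (exterior Ω₁ ∩ Ω₂) := hΩ₂b.subset Set.inter_subset_right
  have hΩ₁b : Bornology.IsBounded Ω₁ := hΩ₂b.subset (subset_closure.trans h12)
  obtain ⟨R, hR⟩ := hΩ₂b.subset_ball (0 : Space m)
  have hu1 : ContDiff ℝ 1 uinc := huinc.contDiff.of_le (by norm_num)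
  obtain ⟨Gw, hGw⟩ := h.interiorField.memH1
  obtain ⟨Gω, hGω⟩ := h.exteriorField.memH1loc R
  have hw := hGw.mono (Set.inter_subset_right : exterior Ω₁ ∩ Ω₂ ⊆ Ω₂)
  have hω := hGω.mono (Set.inter_subset_inter_right (exterior Ω₁) hR)
  have hui := hasWeakGradient_of_contDiff hu1 hb
  have hloc : ∀ {D : Set (Space m)} {v : Space m → ℂ}, MemLp v 2 (volume.restrict D) →
      ∀ R, MemLp v 2 (volume.restrict (D ∩ Metric.ball 0 R)) := fun hv R =>
    hv.mono_measure (Measure.restrict_mono Set.inter_subset_left le_rfl)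
  have hone : ∃ C, ∀ _ : Space m, |(1 : ℝ)| ≤ C := ⟨1, fun _ => by simp⟩
  have hhelm : SolvesHelmholtz k (fun _ => 1) (exterior Ω₁ ∩ Ω₂) ((w - ω) - uinc) := by
    refine SolvesHelmholtz.sub measurable_const hone (hloc (hw.memLp.sub hω.memLp))
      (hloc hui.memLp) (SolvesHelmholtz.sub measurable_const hone (hloc hw.memLp) (hloc hω.memLp)
        ?_ (h.exteriorField.helmholtz.mono Set.inter_subset_left)) (huinc.solvesHelmholtz _)
    exact (h.interiorField.helmholtz.mono Set.inter_subset_right).congr_index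
      fun x hx => hn1 x hx.1
  obtain ⟨gSig, hgSig, heqSig⟩ := h.equationSig
  obtain ⟨gGam, hgGam, heqGam⟩ := h.equationGam
  have htrGam : IsTrace (exterior Ω₁ ∩ Ω₂) (frontier Ω₁) ((w - ω) - uinc) 0 := by
    refine (((hgGam.mono Set.inter_subset_right).sub
      (h.exteriorField.trace.mono Set.inter_subset_left)).sub (isTrace_of_contDiff hb
        (hΩ₁b.closure.subset frontier_subset_closure) isClosed_frontier.measurableSet
        (hGam.isFiniteMeasure_surfaceMeasure hm hΩ₁b) hu1)).congr_trace ?_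
    filter_upwards [heqGam] with x hx
    simp only [Pi.sub_apply, Pi.zero_apply]
    linear_combination -hx
  have htrSig : IsTrace (exterior Ω₁ ∩ Ω₂) (frontier Ω₂) ((w - ω) - uinc) 0 := by
    refine (((h.interiorField.trace.mono Set.inter_subset_right).sub
      (hgSig.mono Set.inter_subset_left)).sub (isTrace_of_contDiff hb
        (hΩ₂b.closure.subset frontier_subset_closure) isClosed_frontier.measurableSet
        (hSig.isFiniteMeasure_surfaceMeasure hm hΩ₂b) hu1)).congr_trace ?_
    filter_upwards [heqSig] with x hx
    simp only [Pi.sub_apply, Pi.zero_apply]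
    linear_combination hx
  filter_upwards [hoverlap _ ⟨_, (hw.sub hω).sub hui⟩ hhelm htrGam htrSig] with x hx
  simp only [Pi.sub_apply] at hx
  linear_combination hx

/-- Fields on `Ω₂` and on the exterior of `Ω₁` which agree on the overlap form a total field. -/
theorem isTotalField_of_overlap {k : ℝ} {n : Space m → ℝ} (hn : Measurable n)
    (hnb : ∃ C, ∀ x, |n x| ≤ C) {Ω₁ Ω₂ : Set (Space m)} (hΩ₂ : IsOpen Ω₂)
    (hΩ₂b : Bornology.IsBounded Ω₂) (h12 : closure Ω₁ ⊆ Ω₂) (hn1 : ∀ x ∈ exterior Ω₁, n x = 1)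
    {uinc w ω u : Space m → ℂ} (huinc : IsIncidentWave k uinc) (hw : MemH1 Ω₂ w)
    (hwH : SolvesHelmholtz k n Ω₂ w) (hω : MemH1loc (exterior Ω₁) ω)
    (hωH : SolvesHelmholtz k (fun _ => 1) (exterior Ω₁) ω) (hωr : IsRadiating k ω)
    (huw : ∀ᵐ x ∂(volume.restrict Ω₂), u x = w x)
    (huω : ∀ᵐ x ∂(volume.restrict (exterior Ω₁)), u x = ω x + uinc x) :
    IsTotalField k n uinc u := by
  have hext : IsOpen (exterior Ω₁) := isClosed_closure.isOpen_compl
  have hcover : Ω₂ ∪ exterior Ω₁ = Set.univ := Set.eq_univ_of_forall fun x => by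
    by_cases hx : x ∈ Ω₂
    · exact Or.inl hx
    · exact Or.inr fun h => hx (h12 h)
  have hu1 : ContDiff ℝ 1 uinc := huinc.contDiff.of_le (by norm_num)
  have huw' : w =ᵐ[volume.restrict Ω₂] u := huw.mono fun x hx => hx.symm
  have huω' : (ω + uinc) =ᵐ[volume.restrict (exterior Ω₁)] u := huω.mono fun x hx => hx.symm
  have hg2 : ∀ R : ℝ, MemH1 (Ω₂ ∩ Metric.ball 0 R) u := fun R => by
    obtain ⟨G, hG⟩ := hw
    exact ⟨G, (hG.congr huw').mono Set.inter_subset_left⟩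
  have hg1 : ∀ R : ℝ, MemH1 (exterior Ω₁ ∩ Metric.ball 0 R) u := fun R => by
    obtain ⟨G, hG⟩ := hω R
    exact ⟨_, (hG.add (hasWeakGradient_of_contDiff hu1
      (Metric.isBounded_ball.subset Set.inter_subset_right))).congr
      (ae_restrict_of_ae_restrict_of_subset Set.inter_subset_left huω')⟩
  have hl2 : ∀ R : ℝ, MemLp u 2 (volume.restrict (Ω₂ ∩ Metric.ball 0 R)) :=
    fun R => (hg2 R).choose_spec.memLp
  have hl1 : ∀ R : ℝ, MemLp u 2 (volume.restrict (exterior Ω₁ ∩ Metric.ball 0 R)) :=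
    fun R => (hg1 R).choose_spec.memLp
  refine ⟨fun R => ?_, ?_, ?_⟩
  · obtain ⟨G, hG⟩ := hg2 R
    obtain ⟨G', hG'⟩ := hg1 R
    rw [← hcover, Set.union_inter_distrib_right]
    exact HasWeakGradient.union (hΩ₂.inter Metric.isOpen_ball) (hext.inter Metric.isOpen_ball) hG hG'
  · rw [← hcover]
    refine SolvesHelmholtz.union hn hnb hΩ₂ hext hl2 hl1 (hwH.congr huw') ?_
    have hone : ∃ C, ∀ _ : Space m, |(1 : ℝ)| ≤ C := ⟨1, fun _ => by simp⟩
    exact ((SolvesHelmholtz.add measurable_const hone (fun R => (hω R).choose_spec.memLp)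
      (fun R => (hasWeakGradient_of_contDiff hu1
        (Metric.isBounded_ball.subset Set.inter_subset_right)).memLp) hωH
      (huinc.solvesHelmholtz _)).congr huω').congr_index fun x hx => (hn1 x hx).symm
  · obtain ⟨R, hR⟩ := hΩ₂b.subset_closedBall (0 : Space m)
    have hRext : {x : Space m | R < ‖x‖} ⊆ exterior Ω₁ := fun x hx hxΩ => by
      have : ‖x‖ ≤ R := by simpa using hR (h12 hxΩ)
      exact absurd hx (not_lt.2 this)
    refine hωr.congr (R := R) ?_
    filter_upwards [ae_restrict_of_ae_restrict_of_subset hRext huω] with x hx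
    simp [hx]

end OverlapHelmholtz

theorem mainTheorem2 (m : ℕ) (hm : m = 2 ∨ m = 3) (k : ℝ) (hk : 0 < k)
    (Ω₀ Ω₁ Ω₂ : Set (OverlapHelmholtz.Space m))
    (hΩ₀ : IsOpen Ω₀) (hΩ₁ : IsOpen Ω₁) (hΩ₂ : IsOpen Ω₂) (hΩ₂b : Bornology.IsBounded Ω₂)
    (h01 : closure Ω₀ ⊆ Ω₁) (h12 : closure Ω₁ ⊆ Ω₂)
    (hGam : OverlapHelmholtz.HasSmoothBoundary Ω₁)
    (hSig : OverlapHelmholtz.HasLipschitzBoundary Ω₂)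
    (hconn : IsConnected (OverlapHelmholtz.exterior Ω₁))
    (n : OverlapHelmholtz.Space m → ℝ) (hn : Measurable n) (hnb : ∃ C, ∀ x, |n x| ≤ C)
    (hn1 : ∀ x ∈ OverlapHelmholtz.exterior Ω₀, n x = 1)
    (hint : OverlapHelmholtz.InteriorUniquelySolvable k n Ω₂)
    (hoverlap : OverlapHelmholtz.OverlapDirichletUnique k Ω₁ Ω₂)
    (uinc : OverlapHelmholtz.Space m → ℂ) (huinc : OverlapHelmholtz.IsIncidentWave k uinc)
    (fSig fGam w ω : OverlapHelmholtz.Space m → ℂ)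
    (hsys : OverlapHelmholtz.SolvesInterfaceSystem k n Ω₁ Ω₂ uinc fSig fGam w ω) :
    (∀ᵐ x ∂(MeasureTheory.volume.restrict (OverlapHelmholtz.exterior Ω₁ ∩ Ω₂)),
      w x = ω x + uinc x) ∧
    ∃ u : OverlapHelmholtz.Space m → ℂ,
      (∀ᵐ x ∂(MeasureTheory.volume.restrict Ω₂), u x = w x) ∧
      (∀ᵐ x ∂(MeasureTheory.volume.restrict (OverlapHelmholtz.exterior Ω₁)),
        u x = ω x + uinc x) ∧
      OverlapHelmholtz.MemH1loc Set.univ u ∧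
      OverlapHelmholtz.IsTotalField k n uinc u ∧
      ∀ u' : OverlapHelmholtz.Space m → ℂ, OverlapHelmholtz.IsTotalField k n uinc u' →
        ∀ᵐ x, u' x = u x := by
  have hm1 : 1 ≤ m := by omega
  have hsub : OverlapHelmholtz.exterior Ω₁ ⊆ OverlapHelmholtz.exterior Ω₀ :=
    Set.compl_subset_compl.2 (h01.trans subset_closure)
  have hn1' : ∀ x ∈ OverlapHelmholtz.exterior Ω₁, n x = 1 := fun x hx => hn1 x (hsub hx)
  have hext : MeasurableSet (OverlapHelmholtz.exterior Ω₁) :=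
    isClosed_closure.isOpen_compl.measurableSet
  have hov := hsys.ae_eq hm1 hΩ₂b h12 hGam hSig hn1' hoverlap huinc
  classical
  set u : OverlapHelmholtz.Space m → ℂ := Ω₂.piecewise w (fun x => ω x + uinc x) with hu
  have huw : ∀ᵐ x ∂(MeasureTheory.volume.restrict Ω₂), u x = w x :=
    MeasureTheory.ae_restrict_of_forall_mem hΩ₂.measurableSet
      fun x hx => Set.piecewise_eq_of_mem _ _ _ hx
  have huω : ∀ᵐ x ∂(MeasureTheory.volume.restrict (OverlapHelmholtz.exterior Ω₁)),
      u x = ω x + uinc x := by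
    rw [MeasureTheory.ae_restrict_iff' (hext.inter hΩ₂.measurableSet)] at hov
    rw [MeasureTheory.ae_restrict_iff' hext]
    filter_upwards [hov] with x hx hxe
    by_cases hx2 : x ∈ Ω₂
    · rw [hu, Set.piecewise_eq_of_mem _ _ _ hx2, hx ⟨hxe, hx2⟩]
    · rw [hu, Set.piecewise_eq_of_notMem _ _ _ hx2]
  have htot := OverlapHelmholtz.isTotalField_of_overlap hn hnb hΩ₂ hΩ₂b h12 hn1' huinc
    hsys.interiorField.memH1 hsys.interiorField.helmholtz hsys.exteriorField.memH1loc
    hsys.exteriorField.helmholtz hsys.exteriorField.radiating huw huω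
  exact ⟨hov, u, huw, huω, htot.memH1loc, htot, fun u' hu' =>
    htot.ae_eq hk hm1 hn hnb hΩ₂ hΩ₂b h12 hconn hn1' hint hu'⟩
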